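/- Let $d\ge 1$ and let $\eta$ be a symmetric, full probability law on $\mathbb{R}^d$ (full: not carried by a proper affine subspace) which is operator-stable with exponent $E\in\mathrm{End}(\mathbb{R}^d)$: $\eta$ embeds in a continuous convolution semigroup $(\eta^t)_{t\ge0}$ of probability measures with $\eta^1=\eta$, and there is a map $a:(0,\infty)\to\mathbb{R}^d$ with $t^E(\eta)*\delta_{a(t)}=\eta^t$ for all $t>0$, where $t^E=\exp((\log t)E)$ and $t^E(\eta)$ denotes the image measure. Let $(0,Q,W)$ be the Lévy–Khinchine triple of $\eta$: $Q=(q_{ij})$ is a positive semidefinite matrix, $W$ is a symmetric Lévy measure ($W(\{0\})=0$, $\int\min(1,\|x\|^2)\,W(dx)<\infty$), and $$\hat\eta(\xi)=\exp\Big(-\tfrac12\langle Q\xi,\xi\rangle-\int(1-\cos\langle x,\xi\rangle)\,W(dx)\Big),\qquad \xi\in\mathbb{R}^d .$$ For a Lipschitz function $u$ on $\mathbb{R}^d$ which is compactly supported, respectively $\mathbb{Z}^d$-periodic (a function on $\mathbb{T}=\mathbb{R}^d/\mathbb{Z}^d$, identified with $[-\frac12,\frac12)^d$), put $$\mathcal{E}_\eta(u,u)=\frac12\int_{\mathbb{R}^d}\sum_{i,j}q_{ij}\,\partial_iu\,\partial_ju\,dx+\frac12\int_{\mathbb{R}^d}\int_{\mathbb{R}^d}(u(x+y)-u(x))^2\,W(dy)\,dx,$$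 respectively $$\mathcal{E}_{\tilde\eta}(u,u)=\frac12\int_{\mathbb{T}}\sum_{i,j}q_{ij}\,\partial_iu\,\partial_ju\,dx+\frac12\int_{\mathbb{T}}\int_{\mathbb{R}^d}(u(x+y)-u(x))^2\,W(dy)\,dx$$ (the Dirichlet form of the projection $\tilde\eta$ of $\eta$ to $\mathbb{T}$). Let $\mathcal{F}_{\mathbb{T}}=\{f\in C^\infty(\mathbb{T}): f\ge0,\ \int_{\mathbb{T}} f=1\}$; for open $\Omega\subset\mathbb{R}^d$ let $\mathcal{F}_\Omega=\{f\in C_c^\infty(\Omega): f\ge0,\ \int f=1\}$; and let $\mathcal{G}$ be the set of bounded domains $\Omega\subset\mathbb{R}^d$ with $0\in\Omega$ and $\partial\Omega$ of Lebesgue measure $0$. Let $\widetilde F:[0,\infty)\to[0,\infty)$ be not identically zero and homogeneous with exponent $\gamma\in[0,1]$: $\widetilde F(0)=0$ and $\widetilde F(y)=\widetilde F(1)y^\gamma$ for $y>0$. Then there is a constant $k(\eta,\widetilde F)\in(0,\infty)$ such that $$k(\eta,\widetilde F)=\sup_{\lambda>0}\inf_{f\in\mathcal{F}_{\mathbb{T}}}\Big\{\lambda^{-1}\mathcal{E}_{\tilde\eta}(\sqrt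 f,\sqrt f)+\lambda^{(1-\gamma)\operatorname{tr}E}\int_{\mathbb{T}}\widetilde F(f(x))\,dx\Big\}=\inf_{\Omega\in\mathcal{G}}\inf_{f\in\mathcal{F}_\Omega}\Big\{\mathcal{E}_\eta(\sqrt f,\sqrt f)+\int_\Omega\widetilde F(f(x))\,dx\Big\}.$$ -/

import Mathlib

open MeasureTheory
open scoped ENNReal NNReal ContDiff

noncomputable section

namespace OperatorStable

/-- The Euclidean space `ℝ^d`. -/
abbrev V (d : ℕ) : Type := EuclideanSpace ℝ (Fin d)

variable {d : ℕ}

/-! ### Operator-stable laws -/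

/-- The operator `t^E = exp ((log t) E)`, for `t > 0`. -/
def opPow {X : Type*} [NormedAddCommGroup X] [NormedSpace ℝ X] (E : X →L[ℝ] X) (t : ℝ) :
    X →L[ℝ] X :=
  NormedSpace.exp (Real.log t • E)

/-- A (weakly) continuous convolution semigroup of probability measures. -/
structure IsConvolutionSemigroup (ν : ℝ≥0 → ProbabilityMeasure (V d)) : Prop where
  continuous : Continuous ν
  zero : (ν 0 : Measure (V d)) = Measure.dirac 0
  add : ∀ s t : ℝ≥0,
    (ν (s + t) : Measure (V d)) = (ν s : Measure (V d)).conv (ν t : Measure (V d))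

/-- `η` is operator-stable with exponent `E`: `η` embeds in a continuous convolution semigroup
`(η^t)` (that is, `η` is infinitely divisible) and there is `a : (0,∞) → ℝ^d` with
`t^E(η) * δ_{a(t)} = η^t` for all `t > 0`. -/
def IsOperatorStable (η : Measure (V d)) (E : V d →L[ℝ] V d) : Prop :=
  ∃ ν : ℝ≥0 → ProbabilityMeasure (V d), IsConvolutionSemigroup ν ∧
    (ν 1 : Measure (V d)) = η ∧
    ∃ a : ℝ≥0 → V d, ∀ t : ℝ≥0, 0 < t →
      (η.map (opPow E t)).conv (Measure.dirac (a t)) = (ν t : Measure (V d))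

/-- `η` is full: it is not carried by any proper affine subspace. -/
def IsFull (η : Measure (V d)) : Prop :=
  ∀ S : AffineSubspace ℝ (V d), S ≠ ⊤ → η (S : Set (V d)) ≠ 1

/-- `W` is a Lévy measure. -/
structure IsLevyMeasure (W : Measure (V d)) : Prop where
  zero : W {0} = 0
  lintegral_lt_top : ∫⁻ x, ENNReal.ofReal (min 1 (‖x‖ ^ 2)) ∂W < ⊤

/-- The symmetric law `η` has Lévy-Khinchine triple `(0, Q, W)`: `Q` is positive semidefinite, `W`
is a symmetric Lévy measure, and the Fourier transform of `η` at `ξ` is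
`exp (- ⟨Qξ, ξ⟩ / 2 - ∫ (1 - cos ⟨x, ξ⟩) W(dx))`. -/
structure HasSymmetricTriple (η : Measure (V d)) (Q : Matrix (Fin d) (Fin d) ℝ)
    (W : Measure (V d)) : Prop where
  posSemidef : Q.PosSemidef
  levy : IsLevyMeasure W
  symm : W.map (fun x => -x) = W
  charFun_eq : ∀ ξ : V d, charFun η ξ =
    ((Real.exp (-((1 / 2) * (∑ i, ∑ j, Q i j * ξ i * ξ j)
      + ∫ x, (1 - Real.cos (inner ℝ x ξ)) ∂W)) : ℝ) : ℂ)

/-! ### Dirichlet forms -/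

/-- The partial derivative `∂u/∂x_i`. -/
def partialDeriv (u : V d → ℝ) (i : Fin d) (x : V d) : ℝ :=
  fderiv ℝ u x (EuclideanSpace.single i 1)

/-- The energy density at `x`:
`(1/2) ∑ q_{ij} ∂_i u(x) ∂_j u(x) + (1/2) ∫ (u(x+y) - u(x))² W(dy)`. It is applied below to
functions `u = √f` with `f ≥ 0` a `C^∞` function that is periodic or compactly supported; these are
Lipschitz, hence differentiable almost everywhere. -/
def energyDensity (Q : Matrix (Fin d) (Fin d) ℝ) (W : Measure (V d)) (u : V d → ℝ) (x : V d) :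
    ℝ≥0∞ :=
  ENNReal.ofReal ((1 / 2) * ∑ i, ∑ j, Q i j * partialDeriv u i x * partialDeriv u j x)
    + (1 / 2) * ∫⁻ y, ENNReal.ofReal ((u (x + y) - u x) ^ 2) ∂W

/-- `𝓔_η(u, u)` on `ℝ^d`, for `η` with triple `(0, Q, W)`. -/
def dirichletForm (Q : Matrix (Fin d) (Fin d) ℝ) (W : Measure (V d)) (u : V d → ℝ) : ℝ≥0∞ :=
  ∫⁻ x, energyDensity Q W u x

/-- The fundamental domain `[-1/2, 1/2)^d` of the torus `ℝ^d / ℤ^d`. -/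
def cube (d : ℕ) : Set (V d) := {x | ∀ i, x i ∈ Set.Ico (-(1 / 2) : ℝ) (1 / 2)}

/-- Functions on the torus are `ℤ^d`-periodic functions on `ℝ^d`. -/
def IsPeriodic (u : V d → ℝ) : Prop :=
  ∀ (i : Fin d) (x : V d), u (x + EuclideanSpace.single i 1) = u x

/-- `𝓔_η̃(u, u)` for periodic `u`, where `η̃` is the projection of `η` to the torus: the projected
convolution semigroup has Gaussian part `Q` and jumps `y mod ℤ^d` at rate `W(dy)`. -/
def torusDirichletForm (Q : Matrix (Fin d) (Fin d) ℝ) (W : Measure (V d)) (u : V d → ℝ) : ℝ≥0∞ :=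
  ∫⁻ x in cube d, energyDensity Q W u x

/-! ### Classes of densities and domains, and the two variational quantities -/

/-- `𝓕_𝕋`: smooth probability densities on the torus. -/
def torusDensities (d : ℕ) : Set (V d → ℝ) :=
  {f | ContDiff ℝ ∞ f ∧ IsPeriodic f ∧ (∀ x, 0 ≤ f x) ∧ (∫ x in cube d, f x) = 1}

/-- `𝓕_Ω`: smooth probability densities with compact support in `Ω`. -/
def domainDensities (Ω : Set (V d)) : Set (V d → ℝ) :=
  {f | ContDiff ℝ ∞ f ∧ HasCompactSupport f ∧ tsupport f ⊆ Ω ∧ (∀ x, 0 ≤ f x) ∧ (∫ x, f x) = 1}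

/-- `𝓖`: bounded domains containing `0` with Lebesgue-null boundary. -/
def domains (d : ℕ) : Set (Set (V d)) :=
  {Ω | IsOpen Ω ∧ IsConnected Ω ∧ Bornology.IsBounded Ω ∧ 0 ∈ Ω ∧ volume (frontier Ω) = 0}

/-- `∫_S F(f(x)) dx` for `f ≥ 0`. -/
def integralF (F : ℝ≥0 → ℝ≥0) (S : Set (V d)) (f : V d → ℝ) : ℝ≥0∞ :=
  ∫⁻ x in S, (F (f x).toNNReal : ℝ≥0∞)

/-- `sup_{λ>0} inf_{f ∈ 𝓕_𝕋} { λ⁻¹ 𝓔_η̃(√f, √f) + λ^{(1-γ) tr E} ∫_𝕋 F(f) }`. -/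
def torusConstant (Q : Matrix (Fin d) (Fin d) ℝ) (W : Measure (V d)) (E : V d →L[ℝ] V d)
    (F : ℝ≥0 → ℝ≥0) (γ : ℝ) : ℝ≥0∞ :=
  ⨆ (l : ℝ) (_ : 0 < l), ⨅ f ∈ torusDensities d,
    (ENNReal.ofReal l⁻¹ * torusDirichletForm Q W (fun x => Real.sqrt (f x))
      + ENNReal.ofReal (l ^ ((1 - γ) * LinearMap.trace ℝ (V d) E.toLinearMap))
        * integralF F (cube d) f)

/-- `inf_{Ω ∈ 𝓖} inf_{f ∈ 𝓕_Ω} { 𝓔_η(√f, √f) + ∫_Ω F(f) }`. -/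
def spaceConstant (Q : Matrix (Fin d) (Fin d) ℝ) (W : Measure (V d)) (F : ℝ≥0 → ℝ≥0) : ℝ≥0∞ :=
  ⨅ Ω ∈ domains d, ⨅ f ∈ domainDensities Ω,
    (dirichletForm Q W (fun x => Real.sqrt (f x)) + integralF F Ω f)

end OperatorStable

end

noncomputable section

namespace OperatorStable

variable {d : ℕ}

open Filter Topology

/-! Write ψ for the symbol, so that the Fourier transform of η is exp(-ψ). Operator-stability
becomes ψ((t^E)^* ξ) = tψ(ξ) (`symbol_adjoint_opPow`), and this identity splits into its Gaussian
and jump parts. Hence f ↦ t^(-tr E) f(t^(-E) x) divides the energy of √f by t and multiplies ∫F(f)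
by t^((1-γ) tr E): on ℝ^d the functional with parameter λ has the same infimum for every λ, namely
the space constant (`spaceConstant_eq_iInf`). It remains to compare, for each λ, a torus infimum
with a whole-space infimum that does not depend on λ.

Torus ≤ space, at every λ: summing f over its integer translates does not increase the functional,
because the energy of √f is convex and homogeneous of degree one in f, hence subadditive, and F is
subadditive too (`torusConstant_le_spaceConstant`).

Space ≤ torus: multiply a periodic near-minimiser f by the square of a translated cutoff χ(· - z)
and average over z in the cube. The main terms reproduce the torus functional times ∫χ² up to a
factor 1 + δ, and the error is λ⁻¹ times a multiple of the energy of χ, which disappears as λ → ∞;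
then δ → 0 (`spaceConstant_mul_le_of_cutoff`, `spaceConstant_le_torusConstant`). The localized
functions have mass at most 1, and γ ≤ 1 makes their normalization harmless
(`spaceConstant_mul_mass_le`).

Finiteness comes from the test density χ² / ∫χ². For positivity, fullness and scaling bound ψ below
away from the origin (`exists_le_symbol`), so by Plancherel a small translation moves √f in squared
L² norm by at most 1/8 + C · energy. If the energy and ∫F(f) were both small, most of the mass of f
would sit at heights above M and stay there under all translations in a fixed ball, so {f > M} would
have volume comparable to the ball; Markov's inequality forbids this for M large
(`half_mul_volume_le`, `spaceConstant_pos`). -/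

/-! ### The symbol of a symmetric operator-stable law -/

/-- A continuous nonnegative multiplicative function on `ℝ≥0` is an exponential. -/
theorem eq_exp_of_continuous_mul {h : ℝ≥0 → ℝ} (hc : Continuous h) (h0 : ∀ t, 0 ≤ h t)
    (hm : ∀ s t, h (s + t) = h s * h t) {c : ℝ} (h1 : h 1 = Real.exp (-c)) (t : ℝ≥0) :
    h t = Real.exp (-(t * c)) := by
  have hnat : ∀ n : ℕ, 0 < h n := by
    intro n
    induction n with
    | zero =>
      have h2 := hm 0 1
      rw [zero_add, h1] at h2
      have : h 0 = 1 := by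
        have := Real.exp_pos (-c)
        field_simp at h2
        linarith
      simp [this]
    | succ n ih =>
      push_cast
      rw [hm, h1]
      exact mul_pos ih (Real.exp_pos _)
  -- For n ≥ t the value h t is a factor of h n > 0.
  have hpos : ∀ t, 0 < h t := by
    intro t
    obtain ⟨n, hn⟩ := exists_nat_ge t
    have h2 := hm t (n - t)
    rw [add_tsub_cancel_of_le hn] at h2
    have h3 := hnat n
    rw [h2] at h3
    exact lt_of_le_of_ne (h0 t) fun h4 => by simp [← h4] at h3
  let L : ℝ≥0 →+ ℝ := AddMonoidHom.mk' (fun t => Real.log (h t)) fun s t => by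
    rw [hm, Real.log_mul (hpos s).ne' (hpos t).ne']
  have hLc : Continuous L := by
    change Continuous fun t => Real.log (h t)
    exact hc.log fun t => (hpos t).ne'
  have hL1 : L 1 = -c := by
    change Real.log (h 1) = -c
    rw [h1, Real.log_exp]
  -- Additivity fixes the logarithm at nonnegative rationals; the approximants ⌊tn⌋/n and continuity
  -- extend this to t.
  have hlim : Tendsto (fun n : ℕ => ((⌊(t : ℝ) * n⌋₊ : ℝ≥0) / (n : ℝ≥0))) atTop (𝓝 t) := by
    rw [← NNReal.tendsto_coe]
    push_cast
    exact (tendsto_nat_floor_mul_div_atTop (R := ℝ) t.2).comp tendsto_natCast_atTop_atTop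
  have hval : ∀ n : ℕ, 0 < n →
      L ((⌊(t : ℝ) * n⌋₊ : ℝ≥0) / (n : ℝ≥0)) =
        (((⌊(t : ℝ) * n⌋₊ : ℝ≥0) / (n : ℝ≥0) : ℝ≥0) : ℝ) * (-c) := by
    intro n hn
    set k := ⌊(t : ℝ) * n⌋₊
    have hn' : (n : ℝ≥0) ≠ 0 := by exact_mod_cast hn.ne'
    have e1 : (n : ℝ) * L ((k : ℝ≥0) / (n : ℝ≥0)) = k * L 1 := by
      rw [← nsmul_eq_mul, ← nsmul_eq_mul, ← map_nsmul, ← map_nsmul]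
      congr 1
      simp only [nsmul_eq_mul, mul_one]
      field_simp
    have hn'' : (n : ℝ) ≠ 0 := by exact_mod_cast hn.ne'
    rw [hL1] at e1
    push_cast
    field_simp
    linarith
  have l1 := (hLc.tendsto t).comp hlim
  have l2 : Tendsto (fun n : ℕ => (((⌊(t : ℝ) * n⌋₊ : ℝ≥0) / (n : ℝ≥0) : ℝ≥0) : ℝ) * (-c))
      atTop (𝓝 (t * (-c))) := ((NNReal.tendsto_coe.2 hlim).mul_const _)
  have l3 := tendsto_nhds_unique (l1.congr' (f₂ := fun n : ℕ =>
    (((⌊(t : ℝ) * n⌋₊ : ℝ≥0) / (n : ℝ≥0) : ℝ≥0) : ℝ) * (-c)) (by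
      filter_upwards [eventually_gt_atTop 0] with n hn using hval n hn)) l2
  have l4 : Real.log (h t) = t * (-c) := l3
  rw [← Real.exp_log (hpos t), l4, mul_neg]

/-- The quadratic form `⟨Qp, p⟩`. -/
def qForm (Q : Matrix (Fin d) (Fin d) ℝ) (p : Fin d → ℝ) : ℝ := ∑ i, ∑ j, Q i j * p i * p j

/-- The jump part `∫ (1 - cos ⟨x, ξ⟩) W(dx)` of the symbol. -/
def jumpSymbol (W : Measure (V d)) (ξ : V d) : ℝ := ∫ x, (1 - Real.cos (inner ℝ x ξ)) ∂W

/-- The symbol `ψ` of the law with triple `(0, Q, W)`, whose Fourier transform is `exp (-ψ)`. -/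
def symbol (Q : Matrix (Fin d) (Fin d) ℝ) (W : Measure (V d)) (ξ : V d) : ℝ :=
  (1 / 2) * qForm Q ξ + jumpSymbol W ξ

theorem qForm_nonneg {Q : Matrix (Fin d) (Fin d) ℝ} (hQ : Q.PosSemidef) (p : Fin d → ℝ) :
    0 ≤ qForm Q p := by
  have h := hQ.dotProduct_mulVec_nonneg p
  refine h.trans_eq ?_
  simp only [qForm, dotProduct, Matrix.mulVec, star_trivial, Finset.mul_sum]
  exact Finset.sum_congr rfl fun i _ => Finset.sum_congr rfl fun j _ => by ring

theorem qForm_smul (Q : Matrix (Fin d) (Fin d) ℝ) (s : ℝ) (p : Fin d → ℝ) :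
    qForm Q (s • p) = s ^ 2 * qForm Q p := by
  simp only [qForm, Finset.mul_sum, Pi.smul_apply, smul_eq_mul]
  exact Finset.sum_congr rfl fun i _ => Finset.sum_congr rfl fun j _ => by ring

theorem one_sub_cos_le_min (x ξ : V d) :
    1 - Real.cos (inner ℝ x ξ) ≤ (2 + ‖ξ‖ ^ 2) * min 1 (‖x‖ ^ 2) := by
  have h1 := Real.one_sub_sq_div_two_le_cos (x := inner ℝ x ξ)
  have h2 := Real.neg_one_le_cos (inner ℝ x ξ)
  have h3 : (inner ℝ x ξ) ^ 2 ≤ ‖x‖ ^ 2 * ‖ξ‖ ^ 2 := by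
    rw [← mul_pow]
    exact sq_le_sq' (by linarith [neg_le_of_abs_le (abs_real_inner_le_norm x ξ)])
      (real_inner_le_norm x ξ)
  rcases le_total 1 (‖x‖ ^ 2) with h | h
  · rw [min_eq_left h]
    nlinarith [sq_nonneg ‖ξ‖]
  · rw [min_eq_right h]
    nlinarith [sq_nonneg ‖x‖]

theorem IsLevyMeasure.integrable_min {W : Measure (V d)} (hW : IsLevyMeasure W) :
    Integrable (fun x : V d => min 1 (‖x‖ ^ 2)) W := by
  refine ⟨by fun_prop, ?_⟩
  rw [hasFiniteIntegral_iff_ofReal (ae_of_all _ fun x => by positivity)]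
  exact hW.lintegral_lt_top

theorem IsLevyMeasure.integrable_one_sub_cos {W : Measure (V d)} (hW : IsLevyMeasure W) (ξ : V d) :
    Integrable (fun x : V d => 1 - Real.cos (inner ℝ x ξ)) W := by
  refine (hW.integrable_min.const_mul (2 + ‖ξ‖ ^ 2)).mono' ?_ (ae_of_all _ fun x => ?_)
  · exact Continuous.aestronglyMeasurable (by fun_prop)
  · rw [Real.norm_of_nonneg (by linarith [Real.cos_le_one (inner ℝ x ξ)])]
    exact one_sub_cos_le_min x ξ

theorem jumpSymbol_nonneg (W : Measure (V d)) (ξ : V d) : 0 ≤ jumpSymbol W ξ :=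
  integral_nonneg fun x => by simp only [Pi.zero_apply]; linarith [Real.cos_le_one (inner ℝ x ξ)]

theorem symbol_nonneg {Q : Matrix (Fin d) (Fin d) ℝ} (hQ : Q.PosSemidef) (W : Measure (V d))
    (ξ : V d) : 0 ≤ symbol Q W ξ := by
  have := qForm_nonneg hQ ξ
  have := jumpSymbol_nonneg W ξ
  unfold symbol
  positivity

/-- Dominated convergence: each integrand is at most 2/n², and the quadratic bound scales exactly
like n², so one multiple of min(1, ‖x‖²) dominates for all n. -/
theorem tendsto_jumpSymbol_div_sq {W : Measure (V d)} (hW : IsLevyMeasure W) (ξ : V d) :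
    Tendsto (fun n : ℕ => jumpSymbol W ((n : ℝ) • ξ) / (n : ℝ) ^ 2) atTop (𝓝 0) := by
  have : Tendsto (fun n : ℕ => ∫ x, (1 - Real.cos (inner ℝ x ((n : ℝ) • ξ))) / (n : ℝ) ^ 2 ∂W) atTop
      (𝓝 (∫ _, (0 : ℝ) ∂W)) := by
    refine tendsto_integral_of_dominated_convergence
      (fun x => (2 + ‖ξ‖ ^ 2) * min 1 (‖x‖ ^ 2)) (fun n => ?_)
      (hW.integrable_min.const_mul _) (fun n => ae_of_all _ fun x => ?_) (ae_of_all _ fun x => ?_)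
    · exact Continuous.aestronglyMeasurable (by fun_prop)
    · have h0 := Real.cos_le_one (inner ℝ x ((n : ℝ) • ξ))
      rw [Real.norm_of_nonneg (div_nonneg (by linarith) (by positivity))]
      rcases Nat.eq_zero_or_pos n with rfl | hn
      · simp; positivity
      · have hn1 : (1 : ℝ) ≤ (n : ℝ) ^ 2 := one_le_pow₀ (by exact_mod_cast hn)
        rw [div_le_iff₀ (by positivity)]
        refine (one_sub_cos_le_min x _).trans ?_
        rw [norm_smul, mul_pow, Real.norm_of_nonneg (Nat.cast_nonneg n)]
        have : 0 ≤ min 1 (‖x‖ ^ 2) := by positivity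
        nlinarith
    · have h2 : Tendsto (fun n : ℕ => 2 / (n : ℝ) ^ 2) atTop (𝓝 0) :=
        (tendsto_const_nhds.div_atTop
          ((tendsto_pow_atTop two_ne_zero).comp tendsto_natCast_atTop_atTop))
      refine squeeze_zero (fun n => div_nonneg ?_ (by positivity)) (fun n => ?_) h2
      · linarith [Real.cos_le_one (inner ℝ x ((n : ℝ) • ξ))]
      · gcongr
        linarith [Real.neg_one_le_cos (inner ℝ x ((n : ℝ) • ξ))]
  simpa [jumpSymbol, integral_div] using this

/-- The Gaussian part is the quadratic growth rate of the symbol at infinity. This lets identities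
for the symbol be split into identities for Q and for W. -/
theorem tendsto_symbol_div_sq (Q : Matrix (Fin d) (Fin d) ℝ) {W : Measure (V d)}
    (hW : IsLevyMeasure W) (ξ : V d) :
    Tendsto (fun n : ℕ => symbol Q W ((n : ℝ) • ξ) / (n : ℝ) ^ 2) atTop
      (𝓝 ((1 / 2) * qForm Q ξ)) := by
  have := (tendsto_jumpSymbol_div_sq hW ξ).const_add ((1 / 2) * qForm Q ξ)
  rw [add_zero] at this
  refine this.congr' ?_
  filter_upwards [eventually_gt_atTop 0] with n hn
  have hn' : (n : ℝ) ≠ 0 := by exact_mod_cast hn.ne'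
  have : qForm Q (((n : ℝ) • ξ : V d) : Fin d → ℝ) = (n : ℝ) ^ 2 * qForm Q ξ := qForm_smul Q n ξ
  rw [symbol, this]
  field_simp

theorem abs_sin_nat_mul_le (k : ℕ) (x : ℝ) : |Real.sin (k * x)| ≤ k * |Real.sin x| := by
  induction k with
  | zero => simp
  | succ k ih =>
    have : ((k + 1 : ℕ) : ℝ) * x = k * x + x := by push_cast; ring
    rw [this, Real.sin_add]
    refine (abs_add_le _ _).trans ?_
    rw [abs_mul, abs_mul]
    have h1 := Real.abs_cos_le_one x
    have h2 := Real.abs_cos_le_one (k * x)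
    push_cast
    nlinarith [abs_nonneg (Real.sin (k * x)), abs_nonneg (Real.sin x)]

theorem one_sub_cos_nat_mul_le (k : ℕ) (x : ℝ) :
    1 - Real.cos (k * x) ≤ k ^ 2 * (1 - Real.cos x) := by
  have h : ∀ y : ℝ, 1 - Real.cos y = 2 * |Real.sin (y / 2)| ^ 2 := by
    intro y
    rw [sq_abs, Real.sin_sq_eq_half_sub, mul_div_cancel₀ y two_ne_zero]
    ring
  rw [h, h, mul_div_assoc]
  have h1 := abs_sin_nat_mul_le k (x / 2)
  have : |Real.sin (k * (x / 2))| ^ 2 ≤ (k * |Real.sin (x / 2)|) ^ 2 := by gcongr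
  nlinarith

/-- Equality for the Gaussian part, and 1 - cos(kθ) ≤ k²(1 - cos θ) under the Lévy integral. It
transfers smallness of the symbol near the origin to vectors of fixed length. -/
theorem symbol_nat_smul_le {Q : Matrix (Fin d) (Fin d) ℝ} {W : Measure (V d)}
    (hW : IsLevyMeasure W) (k : ℕ) (ξ : V d) :
    symbol Q W ((k : ℝ) • ξ) ≤ k ^ 2 * symbol Q W ξ := by
  have h1 : qForm Q (((k : ℝ) • ξ : V d) : Fin d → ℝ) = (k : ℝ) ^ 2 * qForm Q ξ := qForm_smul Q k ξ
  have h2 : jumpSymbol W ((k : ℝ) • ξ) ≤ k ^ 2 * jumpSymbol W ξ := by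
    unfold jumpSymbol
    rw [← integral_const_mul]
    refine integral_mono (hW.integrable_one_sub_cos _) ((hW.integrable_one_sub_cos _).const_mul _)
      fun x => ?_
    simp only [inner_smul_right]
    exact one_sub_cos_nat_mul_le k _
  rw [symbol, symbol, h1]
  linarith

/-! ### Scaling of the symbol under t^E -/

section Law

variable {η : Measure (V d)} {Q : Matrix (Fin d) (Fin d) ℝ} {W : Measure (V d)}
  {E : V d →L[ℝ] V d}

theorem HasSymmetricTriple.charFun (hη : HasSymmetricTriple η Q W) (ξ : V d) :
    charFun η ξ = (Real.exp (-symbol Q W ξ) : ℝ) := hη.charFun_eq ξ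

theorem HasSymmetricTriple.norm_charFun (hη : HasSymmetricTriple η Q W) (ξ : V d) :
    ‖MeasureTheory.charFun η ξ‖ = Real.exp (-symbol Q W ξ) := by
  rw [hη.charFun, Complex.norm_real, Real.norm_of_nonneg (Real.exp_pos _).le]

theorem HasSymmetricTriple.continuous_symbol [IsProbabilityMeasure η]
    (hη : HasSymmetricTriple η Q W) : Continuous (symbol Q W) := by
  have : symbol Q W = fun ξ => -Real.log ‖MeasureTheory.charFun η ξ‖ := by
    ext ξ
    rw [hη.norm_charFun, Real.log_exp, neg_neg]
  rw [this]
  refine (Continuous.log (continuous_charFun).norm fun ξ => ?_).neg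
  rw [hη.norm_charFun]
  exact (Real.exp_pos _).ne'

theorem charFun_map_clm [IsProbabilityMeasure η] (A : V d →L[ℝ] V d) (ξ : V d) :
    MeasureTheory.charFun (η.map A) ξ = MeasureTheory.charFun η (A.adjoint ξ) := by
  rw [charFun_apply, charFun_apply, integral_map A.continuous.aemeasurable (by fun_prop)]
  simp_rw [ContinuousLinearMap.adjoint_inner_right]

/-- Taking moduli of characteristic functions removes the phase created by the shift a(t). What is
left of the semigroup is continuous and multiplicative in t with value exp(-ψ(ξ)) at t = 1, hence
equal to exp(-tψ(ξ)). -/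
theorem symbol_adjoint_opPow [IsProbabilityMeasure η] (hη : HasSymmetricTriple η Q W)
    (hE : IsOperatorStable η E) {t : ℝ} (ht : 0 < t) (ξ : V d) :
    symbol Q W ((opPow E t).adjoint ξ) = t * symbol Q W ξ := by
  obtain ⟨ν, hν, hν1, a, ha⟩ := hE
  have hcont : Continuous fun t : ℝ≥0 => ‖MeasureTheory.charFun (ν t : Measure (V d)) ξ‖ := by
    refine Continuous.norm ?_
    rw [continuous_iff_continuousAt]
    intro t
    have h := (ProbabilityMeasure.tendsto_iff_forall_integral_rclike_tendsto ℂ).1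
      (hν.continuous.tendsto t) (BoundedContinuousFunction.innerProbChar ξ)
    simpa only [ContinuousAt, charFun_eq_integral_innerProbChar] using h
  have h := eq_exp_of_continuous_mul hcont (fun _ => norm_nonneg _)
    (fun s t => by rw [hν.add, charFun_conv, norm_mul]) (c := symbol Q W ξ)
    (by rw [hν1, hη.norm_charFun]) ⟨t, ht.le⟩
  have h2 := ha ⟨t, ht.le⟩ ht
  rw [← h2] at h
  have : IsProbabilityMeasure (η.map (opPow E t)) :=
    Measure.isProbabilityMeasure_map (opPow E t).continuous.aemeasurable
  rw [charFun_conv, norm_mul, charFun_dirac, Complex.norm_exp_ofReal_mul_I, mul_one,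
    charFun_map_clm, hη.norm_charFun, Real.exp_eq_exp] at h
  exact neg_injective h

theorem qForm_adjoint_opPow [IsProbabilityMeasure η] (hη : HasSymmetricTriple η Q W)
    (hE : IsOperatorStable η E) {t : ℝ} (ht : 0 < t) (ξ : V d) :
    qForm Q ((opPow E t).adjoint ξ) = t * qForm Q ξ := by
  have h1 := tendsto_symbol_div_sq Q hη.levy ((opPow E t).adjoint ξ)
  have h2 := (tendsto_symbol_div_sq Q hη.levy ξ).const_mul t
  have := tendsto_nhds_unique h1 (h2.congr fun n => by
    rw [← map_smul, symbol_adjoint_opPow hη hE ht]; ring)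
  linarith

theorem jumpSymbol_adjoint_opPow [IsProbabilityMeasure η] (hη : HasSymmetricTriple η Q W)
    (hE : IsOperatorStable η E) {t : ℝ} (ht : 0 < t) (ξ : V d) :
    jumpSymbol W ((opPow E t).adjoint ξ) = t * jumpSymbol W ξ := by
  have h1 := symbol_adjoint_opPow hη hE ht ξ
  have h2 := qForm_adjoint_opPow hη hE ht ξ
  unfold symbol at h1
  rw [h2] at h1
  linarith

/-- The symbol of a full law does not vanish on any line. -/
theorem exists_symbol_smul_ne_zero [IsProbabilityMeasure η] (hη : HasSymmetricTriple η Q W)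
    (hfull : IsFull η) {ζ : V d} (hζ : ζ ≠ 0) : ∃ s : ℝ, 0 < s ∧ symbol Q W (s • ζ) ≠ 0 := by
  by_contra! hcon
  have h1 : ∀ s : ℝ, MeasureTheory.charFun η (s • ζ) = 1 := by
    intro s
    rcases lt_trichotomy s 0 with hs | rfl | hs
    · have : s • ζ = -((-s) • ζ) := by simp
      rw [this, charFun_neg, hη.charFun, hcon _ (by linarith)]
      simp
    · simp
    · rw [hη.charFun, hcon s hs]
      simp
  -- The characteristic function is 1 along the line of ζ, so the image of η under ⟨ζ, ·⟩ is a point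
  -- mass at 0 and η is carried by the hyperplane orthogonal to ζ.
  let φ : V d →L[ℝ] ℝ := innerSL ℝ ζ
  have : IsProbabilityMeasure (η.map φ) :=
    Measure.isProbabilityMeasure_map φ.continuous.aemeasurable
  have h2 : η.map φ = Measure.dirac 0 := by
    refine Measure.ext_of_charFun ?_
    ext s
    rw [charFun_dirac, inner_zero_left, charFun_apply,
      integral_map φ.continuous.aemeasurable (by fun_prop)]
    rw [Complex.ofReal_zero, zero_mul, Complex.exp_zero, ← h1 s, charFun_apply]
    congr 1
    ext x
    simp [φ, inner_smul_right, real_inner_comm, mul_comm]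
  let S : AffineSubspace ℝ (V d) := φ.ker.toAffineSubspace
  refine hfull S ?_ ?_
  · intro hS
    have : ζ ∈ S := by rw [hS]; trivial
    have : φ ζ = 0 := by simpa [S] using this
    exact hζ (by simpa [φ] using this)
  · have : (S : Set (V d)) = φ ⁻¹' {0} := by
      ext x
      simp [S]
    rw [this, ← Measure.map_apply φ.continuous.measurable (measurableSet_singleton _), h2]
    simp

end Law

/-! ### The one-parameter group t^E -/

theorem opPow_one (E : V d →L[ℝ] V d) : opPow E 1 = 1 := by
  simp [opPow, NormedSpace.exp_zero]

theorem opPow_mul (E : V d →L[ℝ] V d) {s t : ℝ} (hs : 0 < s) (ht : 0 < t) :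
    opPow E (s * t) = opPow E s * opPow E t := by
  unfold opPow
  let _ : NormedAlgebra ℚ (V d →L[ℝ] V d) := NormedAlgebra.restrictScalars ℚ ℝ _
  rw [Real.log_mul hs.ne' ht.ne', add_smul]
  refine NormedSpace.exp_add_of_commute ?_
  change _ * _ = _ * _
  ext x
  simp [mul_left_comm]

theorem continuousOn_opPow (E : V d →L[ℝ] V d) : ContinuousOn (opPow E) (Set.Ioi 0) := by
  unfold opPow
  let _ : NormedAlgebra ℚ (V d →L[ℝ] V d) := NormedAlgebra.restrictScalars ℚ ℝ _
  refine NormedSpace.exp_continuous.comp_continuousOn ?_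
  exact (Real.continuousOn_log.mono fun t ht => (ne_of_gt ht : t ≠ 0)).smul continuousOn_const

/-! ### Lower bounds for the symbol of a full law -/

section Law

variable {η : Measure (V d)} {Q : Matrix (Fin d) (Fin d) ℝ} {W : Measure (V d)}
  {E : V d →L[ℝ] V d}

/-- Every sequence of nonzero vectors has a subsequence whose directions converge. -/
theorem exists_subseq_tendsto_direction (ξ : ℕ → V d) (hξ : ∀ n, ξ n ≠ 0) :
    ∃ ζ : V d, ζ ≠ 0 ∧ ∃ φ : ℕ → ℕ, StrictMono φ ∧
      Tendsto (fun n => ‖ξ (φ n)‖⁻¹ • ξ (φ n)) atTop (𝓝 ζ) := by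
  obtain ⟨ζ, hζ, φ, hφ, hlim⟩ := (isCompact_sphere (0 : V d) 1).tendsto_subseq
    (x := fun n => ‖ξ n‖⁻¹ • ξ n) fun n => by
      simp [norm_smul, hξ n]
  refine ⟨ζ, ?_, φ, hφ, hlim⟩
  rintro rfl
  simp at hζ

/-- The symbol of a full law is bounded below by a multiple of `‖ξ‖²` near the origin. -/
theorem exists_mul_sq_le_symbol [IsProbabilityMeasure η] (hη : HasSymmetricTriple η Q W)
    (hfull : IsFull η) :
    ∃ c : ℝ, 0 < c ∧ ∃ r : ℝ, 0 < r ∧ ∀ ξ : V d, ‖ξ‖ ≤ r → c * ‖ξ‖ ^ 2 ≤ symbol Q W ξ := by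
  by_contra! hcon
  have hn : ∀ n : ℕ, (0 : ℝ) < 1 / ((n : ℝ) + 1) := fun n => Nat.one_div_pos_of_nat
  choose ξ hξr hξ using fun n : ℕ => hcon _ (hn n) _ (hn n)
  have hne : ∀ n, ξ n ≠ 0 := by
    intro n h0
    have h1 := hξ n
    have h2 := symbol_nonneg hη.posSemidef W (ξ n)
    rw [h0] at h1 h2
    simp at h1
    linarith
  obtain ⟨ζ, hζ, φ, hφ, hlim⟩ := exists_subseq_tendsto_direction ξ hne
  obtain ⟨s, hs, hs0⟩ := exists_symbol_smul_ne_zero hη hfull hζ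
  apply hs0
  have hpos : ∀ n, 0 < ‖ξ n‖ := fun n => norm_pos_iff.2 (hne n)
  have hφ1 : Tendsto (fun n => 1 / ((φ n : ℝ) + 1)) atTop (𝓝 0) :=
    tendsto_one_div_add_atTop_nhds_zero_nat.comp hφ.tendsto_atTop
  have hnorm : Tendsto (fun n => ‖ξ (φ n)‖) atTop (𝓝 0) :=
    squeeze_zero (fun _ => norm_nonneg _) (fun n => hξr (φ n)) hφ1
  -- Integer multiples bring the short vectors up to length about s: k ξ → s ζ, while ψ(k ξ) ≤ k²
  -- ψ(ξ) ≤ s²/(n+1) along the subsequence. So ψ(s ζ) = 0, contradicting fullness.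
  let k : ℕ → ℕ := fun n => ⌊s / ‖ξ (φ n)‖⌋₊
  have hk1 : ∀ n, (k n : ℝ) * ‖ξ (φ n)‖ ≤ s := fun n => by
    have := Nat.floor_le (div_nonneg hs.le (norm_nonneg (ξ (φ n))))
    exact (le_div_iff₀ (hpos _)).1 this
  have hk2 : ∀ n, s - ‖ξ (φ n)‖ ≤ (k n : ℝ) * ‖ξ (φ n)‖ := fun n => by
    have := Nat.lt_floor_add_one (s / ‖ξ (φ n)‖)
    rw [div_lt_iff₀ (hpos _)] at this
    linarith
  have hk : Tendsto (fun n => (k n : ℝ) * ‖ξ (φ n)‖) atTop (𝓝 s) := by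
    refine tendsto_of_tendsto_of_tendsto_of_le_of_le ?_ tendsto_const_nhds hk2 hk1
    simpa using hnorm.const_sub s
  have h1 : Tendsto (fun n => (k n : ℝ) • ξ (φ n)) atTop (𝓝 (s • ζ)) := by
    refine (hk.smul hlim).congr fun n => ?_
    rw [smul_smul, mul_assoc, mul_inv_cancel₀ (hpos _).ne', mul_one]
  have h2 : Tendsto (fun n => symbol Q W ((k n : ℝ) • ξ (φ n))) atTop (𝓝 (symbol Q W (s • ζ))) :=
    (hη.continuous_symbol.tendsto _).comp h1
  refine tendsto_nhds_unique h2 ?_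
  have h3 : Tendsto (fun n => s ^ 2 * (1 / ((φ n : ℝ) + 1))) atTop (𝓝 0) := by
    simpa using hφ1.const_mul (s ^ 2)
  refine squeeze_zero (fun n => symbol_nonneg hη.posSemidef W _) (fun n => ?_) h3
  calc symbol Q W ((k n : ℝ) • ξ (φ n)) ≤ (k n : ℝ) ^ 2 * symbol Q W (ξ (φ n)) :=
        symbol_nat_smul_le hη.levy _ _
    _ ≤ (k n : ℝ) ^ 2 * (1 / ((φ n : ℝ) + 1) * ‖ξ (φ n)‖ ^ 2) := by
        gcongr
        exact (hξ (φ n)).le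
    _ = ((k n : ℝ) * ‖ξ (φ n)‖) ^ 2 * (1 / ((φ n : ℝ) + 1)) := by ring
    _ ≤ s ^ 2 * (1 / ((φ n : ℝ) + 1)) := by
        gcongr
        exact hk1 n

/-- The adjoint flow `(t^E)^* ξ` comes arbitrarily close to the origin for `t ≤ 1`. -/
theorem exists_norm_adjoint_opPow_le [IsProbabilityMeasure η] (hη : HasSymmetricTriple η Q W)
    (hfull : IsFull η) (hE : IsOperatorStable η E) (ξ : V d) {ε : ℝ} (hε : 0 < ε) :
    ∃ t : ℝ, 0 < t ∧ t ≤ 1 ∧ ‖(opPow E t).adjoint ξ‖ ≤ ε := by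
  by_contra! hcon
  have hn : ∀ n : ℕ, (0 : ℝ) < 1 / ((n : ℝ) + 1) := fun n => Nat.one_div_pos_of_nat
  have hn1 : ∀ n : ℕ, 1 / ((n : ℝ) + 1) ≤ 1 := fun n => by
    rw [div_le_one (by positivity)]
    linarith [Nat.cast_nonneg (α := ℝ) n]
  let ξ' : ℕ → V d := fun n => (opPow E (1 / ((n : ℝ) + 1))).adjoint ξ
  have hξ' : ∀ n, ε < ‖ξ' n‖ := fun n => hcon _ (hn n) (hn1 n)
  obtain ⟨ζ, hζ, φ, hφ, hlim⟩ := exists_subseq_tendsto_direction ξ'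
    fun n => norm_pos_iff.1 (hε.trans (hξ' n))
  obtain ⟨s, hs, hs0⟩ := exists_symbol_smul_ne_zero hη hfull hζ
  apply hs0
  have hφ1 : Tendsto (fun n => 1 / ((φ n : ℝ) + 1)) atTop (𝓝 0) :=
    tendsto_one_div_add_atTop_nhds_zero_nat.comp hφ.tendsto_atTop
  have h2 : Tendsto (fun n => symbol Q W (s • ‖ξ' (φ n)‖⁻¹ • ξ' (φ n))) atTop
      (𝓝 (symbol Q W (s • ζ))) :=
    (hη.continuous_symbol.tendsto _).comp (hlim.const_smul s)
  refine tendsto_nhds_unique h2 ?_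
  -- If the flow stays outside the ε-ball, rescaling it to length s amounts to flowing r ξ with r ≤
  -- s/ε. The symbol is bounded by C on that segment, and the scaling factor t = 1/(n+1) sends it to
  -- 0.
  obtain ⟨C, hC⟩ := (isCompact_Icc (a := (0 : ℝ)) (b := s / ε)).bddAbove_image
    (f := fun r => symbol Q W (r • ξ))
    (hη.continuous_symbol.comp (continuous_id.smul continuous_const)).continuousOn
  have h3 : Tendsto (fun n => (1 / ((φ n : ℝ) + 1)) * C) atTop (𝓝 0) := by
    simpa using hφ1.mul_const C
  refine squeeze_zero (fun n => symbol_nonneg hη.posSemidef W _) (fun n => ?_) h3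
  rw [smul_smul, ← map_smul, symbol_adjoint_opPow hη hE (hn _)]
  refine mul_le_mul_of_nonneg_left (hC ⟨_, ⟨by positivity, ?_⟩, rfl⟩) (hn _).le
  rw [← div_eq_mul_inv]
  exact div_le_div_of_nonneg_left hs.le hε (hξ' _).le

/-- The symbol of a full operator-stable law is bounded below away from the origin. -/
theorem exists_le_symbol [IsProbabilityMeasure η] (hη : HasSymmetricTriple η Q W)
    (hfull : IsFull η) (hE : IsOperatorStable η E) :
    ∃ c : ℝ, 0 < c ∧ ∃ r : ℝ, 0 < r ∧ ∀ ξ : V d, r ≤ ‖ξ‖ → c ≤ symbol Q W ξ := by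
  obtain ⟨c, hc, r, hr, h⟩ := exists_mul_sq_le_symbol hη hfull
  refine ⟨c * r ^ 2, by positivity, r, hr, fun ξ hξ => ?_⟩
  obtain ⟨t₀, ht₀, ht₁, hle⟩ := exists_norm_adjoint_opPow_le hη hfull hE ξ hr
  have hcont : ContinuousOn (fun t => ‖(opPow E t).adjoint ξ‖) (Set.Icc t₀ 1) := by
    have h1 : ContinuousOn (opPow E) (Set.Icc t₀ 1) :=
      (continuousOn_opPow E).mono fun t ht => ht₀.trans_le ht.1
    have h2 : ContinuousOn (fun t => (opPow E t).adjoint) (Set.Icc t₀ 1) :=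
      (ContinuousLinearMap.adjoint (𝕜 := ℝ) (E := V d) (F := V d)).continuous.comp_continuousOn h1
    exact (h2.clm_apply continuousOn_const).norm
  -- The norm of the flow is at least r at t = 1 and at most r at t₀, so it equals r at some t ≤ 1.
  -- The bound near the origin gives c r² ≤ tψ(ξ) ≤ ψ(ξ).
  obtain ⟨t, ht, hteq⟩ := intermediate_value_Icc ht₁ hcont ⟨hle, by
    simp only [opPow_one]
    rwa [ContinuousLinearMap.one_def, ContinuousLinearMap.adjoint_id]⟩
  have htpos : 0 < t := ht₀.trans_le ht.1
  have h1 := h _ hteq.le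
  rw [symbol_adjoint_opPow hη hE htpos] at h1
  simp only at hteq
  rw [hteq] at h1
  have := symbol_nonneg hη.posSemidef W ξ
  nlinarith [ht.2]

end Law

/-! ### The spectral measure of a square integrable function -/

section Plancherel

open FourierTransform SchwartzMap

/-- The phase factor by which the Fourier transform intertwines the translation by `y`. -/
def phase (y ξ : V d) : ℂ := (Real.fourierChar (inner ℝ y ξ) : ℂ)

theorem norm_phase (y ξ : V d) : ‖phase y ξ‖ = 1 := Circle.norm_coe _

theorem continuous_phase (y : V d) : Continuous (phase y) := by
  unfold phase
  have : Continuous fun ξ : V d => Real.fourierChar (inner ℝ y ξ) :=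
    Real.continuous_fourierChar.comp (by fun_prop)
  exact continuous_subtype_val.comp this

theorem norm_phase_sub_one_sq (y ξ : V d) :
    ‖phase y ξ - 1‖ ^ 2 = 2 * (1 - Real.cos (inner ℝ y ((2 * Real.pi) • ξ))) := by
  rw [phase, Real.fourierChar_apply, inner_smul_right, Complex.sq_norm, Complex.normSq_apply,
    Complex.sub_re, Complex.sub_im, Complex.exp_ofReal_mul_I_re, Complex.exp_ofReal_mul_I_im,
    Complex.one_re, Complex.one_im]
  nlinarith [Real.sin_sq_add_cos_sq (2 * Real.pi * inner ℝ y ξ)]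

theorem memLp_phase_mul (y : V d) (g : Lp (α := V d) ℂ 2) :
    MemLp (fun ξ => phase y ξ * g ξ) 2 := by
  refine (Lp.memLp g).of_le ?_ (ae_of_all _ fun ξ => ?_)
  · exact (continuous_phase y).aestronglyMeasurable.mul (Lp.aestronglyMeasurable g)
  · rw [norm_mul, norm_phase, one_mul]

/-- Multiplication by the phase factor, on `L²`. -/
def phaseMul (y : V d) (g : Lp (α := V d) ℂ 2) : Lp (α := V d) ℂ 2 := (memLp_phase_mul y g).toLp

theorem coeFn_phaseMul (y : V d) (g : Lp (α := V d) ℂ 2) :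
    phaseMul y g =ᵐ[volume] fun ξ => phase y ξ * g ξ := (memLp_phase_mul y g).coeFn_toLp

theorem continuous_phaseMul (y : V d) : Continuous (phaseMul y) := by
  refine Isometry.continuous fun g h => ?_
  rw [Lp.edist_def, Lp.edist_def]
  refine eLpNorm_congr_norm_ae ?_
  filter_upwards [coeFn_phaseMul y g, coeFn_phaseMul y h] with ξ h1 h2
  rw [Pi.sub_apply, Pi.sub_apply, h1, h2, ← mul_sub, norm_mul, norm_phase, one_mul]

/-- Translation by `y`, on `L²`. -/
def translate (y : V d) (g : Lp (α := V d) ℂ 2) : Lp (α := V d) ℂ 2 :=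
  Lp.compMeasurePreserving (fun x => x + y) (measurePreserving_add_right volume y) g

theorem coeFn_translate (y : V d) (g : Lp (α := V d) ℂ 2) :
    translate y g =ᵐ[volume] fun x => g (x + y) :=
  Lp.coeFn_compMeasurePreserving g (measurePreserving_add_right volume y)

/-- Both sides are continuous in g for the L² norm, so it suffices to treat the dense class of
Schwartz functions, where the Fourier integral can be shifted directly. -/
theorem fourier_translate (y : V d) (g : Lp (α := V d) ℂ 2) :
    𝓕 (translate y g) = phaseMul y (𝓕 g) := by
  refine DenseRange.induction_on (p := fun g => 𝓕 (translate y g) = phaseMul y (𝓕 g))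
    (SchwartzMap.denseRange_toLpCLM (p := 2) ENNReal.ofNat_ne_top) g ?_ fun f => ?_
  · refine isClosed_eq ?_ ((continuous_phaseMul y).comp
      (Lp.fourierTransformₗᵢ (V d) ℂ).continuous)
    exact (Lp.fourierTransformₗᵢ (V d) ℂ).continuous.comp
      (Lp.isometry_compMeasurePreserving (measurePreserving_add_right volume y)).continuous
  · change 𝓕 (translate y (f.toLp 2)) = phaseMul y (𝓕 (f.toLp 2))
    have h1 : translate y (f.toLp 2) = (f.compSubConstCLM ℂ (-y)).toLp 2 := by
      refine Lp.ext ?_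
      have h0 : ∀ᵐ x : V d, f.toLp 2 volume (x + y) = f (x + y) :=
        (measurePreserving_add_right volume y).quasiMeasurePreserving.ae (f.coeFn_toLp 2 volume)
      filter_upwards [coeFn_translate y (f.toLp 2), (f.compSubConstCLM ℂ (-y)).coeFn_toLp 2, h0]
        with x hx1 hx2 hx3
      rw [hx1, hx2, hx3]
      simp
    rw [h1, SchwartzMap.toLp_fourier_eq, SchwartzMap.toLp_fourier_eq]
    refine Lp.ext ?_
    filter_upwards [coeFn_phaseMul y ((𝓕 f).toLp 2), (𝓕 f).coeFn_toLp 2,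
      (𝓕 (f.compSubConstCLM ℂ (-y))).coeFn_toLp 2] with ξ h1 h2 h3
    rw [h1, h2, h3, SchwartzMap.fourier_coe, SchwartzMap.fourier_coe]
    have h4 := congrFun (VectorFourier.fourierIntegral_comp_add_right Real.fourierChar
      (volume : Measure (V d)) (innerₗ (V d)) f y) ξ
    have h5 : ((f.compSubConstCLM ℂ (-y) : 𝓢(V d, ℂ)) : V d → ℂ) = f ∘ fun x => x + y := by
      ext x
      simp
    rw [h5]
    exact h4

/-- Plancherel: the `L²` modulus of continuity of `u` is given by a spectral measure. -/
theorem exists_spectral_measure {u : V d → ℝ} (hu : MemLp u 2) :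
    ∃ m : Measure (V d), m Set.univ = ∫⁻ x, ENNReal.ofReal (u x ^ 2) ∧
      ∀ y : V d, ∫⁻ x, ENNReal.ofReal ((u (x + y) - u x) ^ 2) =
        ∫⁻ ξ, ENNReal.ofReal (2 * (1 - Real.cos (inner ℝ y ξ))) ∂m := by
  have hlp : ∀ g : Lp (α := V d) ℂ 2, ∫⁻ x, ‖g x‖ₑ ^ 2 = ‖g‖ₑ ^ 2 := by
    intro g
    have h1 := eLpNorm_nnreal_pow_eq_lintegral (f := (g : V d → ℂ)) (μ := volume) (p := 2) (by simp)
    simp only [NNReal.coe_ofNat, ENNReal.rpow_ofNat, ENNReal.coe_ofNat] at h1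
    rw [Lp.enorm_def, h1]
  have huc : MemLp (fun x => (u x : ℂ)) 2 := hu.ofReal
  let f : Lp (α := V d) ℂ 2 := huc.toLp
  have hf : f =ᵐ[volume] fun x => (u x : ℂ) := huc.coeFn_toLp
  let G : Lp (α := V d) ℂ 2 := 𝓕 f
  have hsq : ∀ a : ℝ, ‖(a : ℂ)‖ₑ ^ 2 = ENNReal.ofReal (a ^ 2) := by
    intro a
    rw [← ofReal_norm, Complex.norm_real, ← ENNReal.ofReal_pow (norm_nonneg _),
      Real.norm_eq_abs, sq_abs]
  have hmeas : Measurable fun ξ => ‖G ξ‖ₑ ^ 2 :=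
    ((Lp.stronglyMeasurable G).measurable.enorm).pow_const 2
  have hmul : Measurable fun ξ : V d => (2 * Real.pi) • ξ := by fun_prop
  -- The measure is |û|² dξ, pushed forward by ξ ↦ 2πξ to absorb the 2π in the normalization of the
  -- Fourier transform.
  refine ⟨(volume.withDensity fun ξ => ‖G ξ‖ₑ ^ 2).map fun ξ => (2 * Real.pi) • ξ, ?_, fun y => ?_⟩
  · rw [Measure.map_apply hmul MeasurableSet.univ, Set.preimage_univ,
      withDensity_apply _ MeasurableSet.univ, Measure.restrict_univ, hlp]
    have : ‖G‖ₑ = ‖f‖ₑ := by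
      rw [← ofReal_norm, ← ofReal_norm, Lp.norm_fourier_eq]
    rw [this, ← hlp]
    refine lintegral_congr_ae ?_
    filter_upwards [hf] with x hx
    rw [hx, hsq]
  · rw [lintegral_map (by fun_prop) hmul, lintegral_withDensity_eq_lintegral_mul _ hmeas
      (by fun_prop)]
    have h1 : ∫⁻ x, ENNReal.ofReal ((u (x + y) - u x) ^ 2) =
        ∫⁻ x, ‖(translate y f - f) x‖ₑ ^ 2 := by
      refine lintegral_congr_ae ?_
      filter_upwards [Lp.coeFn_sub (translate y f) f, coeFn_translate y f, hf,
        (measurePreserving_add_right volume y).quasiMeasurePreserving.ae hf] with x h1 h2 h3 h4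
      rw [h1, Pi.sub_apply, h2, h3, h4, ← hsq]
      push_cast
      rfl
    have h2 : ‖translate y f - f‖ₑ = ‖phaseMul y G - G‖ₑ := by
      rw [← fourier_translate, ← ofReal_norm, ← ofReal_norm,
        ← Lp.norm_fourier_eq (translate y f - f)]
      congr 2
      exact (Lp.fourierTransformₗᵢ (V d) ℂ).map_sub _ _
    rw [h1, hlp, h2, ← hlp]
    refine lintegral_congr_ae ?_
    filter_upwards [Lp.coeFn_sub (phaseMul y G) G, coeFn_phaseMul y G] with ξ h1 h2
    have : phase y ξ * G ξ - G ξ = G ξ * (phase y ξ - 1) := by ring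
    rw [h1, Pi.sub_apply, h2, Pi.mul_apply, this, enorm_mul, mul_pow, ← norm_phase_sub_one_sq,
      ENNReal.ofReal_pow (norm_nonneg _), ofReal_norm]

end Plancherel

/-! ### The determinant of `t^E` -/

section Determinant

variable {X : Type*} [NormedAddCommGroup X] [NormedSpace ℝ X] [FiniteDimensional ℝ X]

theorem differentiable_det :
    Differentiable ℝ fun A : X →L[ℝ] X => LinearMap.det A.toLinearMap := by
  let b := Module.finBasis ℝ X
  let c (i) : X →L[ℝ] ℝ := (b.coord i).toContinuousLinearMap
  have : (fun A : X →L[ℝ] X => LinearMap.det A.toLinearMap) = fun A =>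
      ∑ σ : Equiv.Perm (Fin (Module.finrank ℝ X)), (Equiv.Perm.sign σ : ℝ) *
        ∏ i, c (σ i) (A (b i)) := by
    ext A
    rw [← LinearMap.det_toMatrix b, Matrix.det_apply']
    simp [LinearMap.toMatrix_apply, c]
  rw [this]
  fun_prop

/-- As a polynomial in s, the determinant is 1 + s tr E plus a multiple of s². -/
theorem hasDerivAt_det_one_add_smul (E : X →L[ℝ] X) :
    HasDerivAt (fun s : ℝ => LinearMap.det (1 + s • E).toLinearMap)
      (LinearMap.trace ℝ X E.toLinearMap) 0 := by
  set b := Module.finBasis ℝ X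
  set M := LinearMap.toMatrix b b E.toLinearMap with hM
  have h1 : (fun s : ℝ => LinearMap.det (1 + s • E).toLinearMap) = fun s =>
      1 + M.trace * s +
        (Matrix.det (1 + (Polynomial.X : Polynomial ℝ) • M.map Polynomial.C)).divX.divX.eval s
          * s ^ 2 := by
    ext s
    rw [← Matrix.det_one_add_smul, ← LinearMap.det_toMatrix b]
    congr 1
    have : (1 + s • E).toLinearMap = LinearMap.id + s • E.toLinearMap := rfl
    rw [this, map_add, map_smul, LinearMap.toMatrix_id]
  rw [h1, LinearMap.trace_eq_matrix_trace ℝ b, ← hM]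
  have h2 := ((Polynomial.hasDerivAt
    (Matrix.det (1 + (Polynomial.X : Polynomial ℝ) • M.map Polynomial.C)).divX.divX (0 : ℝ)).mul
      ((hasDerivAt_id (0 : ℝ)).pow 2))
  have h3 := (((hasDerivAt_id (0 : ℝ)).const_mul M.trace).const_add 1).add h2
  refine h3.congr_deriv ?_
  simp

/-- The function g(s) = det exp(sE) satisfies g(s + t) = g(s) g(t) and g'(0) = tr E, hence solves g'
= (tr E) g with g(0) = 1. -/
theorem det_exp_smul (E : X →L[ℝ] X) (s : ℝ) :
    LinearMap.det (NormedSpace.exp (s • E)).toLinearMap =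
      Real.exp (s * LinearMap.trace ℝ X E.toLinearMap) := by
  let _ : NormedAlgebra ℚ (X →L[ℝ] X) := NormedAlgebra.restrictScalars ℚ ℝ _
  set τ := LinearMap.trace ℝ X E.toLinearMap
  set g : ℝ → ℝ := fun s => LinearMap.det (NormedSpace.exp (s • E)).toLinearMap with hg
  have hadd : ∀ s t, g (s + t) = g s * g t := by
    intro s t
    have hc : Commute (s • E) (t • E) := by
      exact ((Commute.refl E).smul_left s).smul_right t
    simp only [hg]
    rw [add_smul, NormedSpace.exp_add_of_commute hc]
    exact LinearMap.det_comp _ _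
  have h0 : HasDerivAt g τ 0 := by
    have hD := (differentiable_det (X := X) 1).hasFDerivAt
    have e1 : HasDerivAt (fun s : ℝ => (1 : X →L[ℝ] X) + s • E) E 0 := by
      simpa using ((hasDerivAt_id (0 : ℝ)).smul_const E).const_add 1
    have e2 : HasDerivAt (fun s : ℝ => NormedSpace.exp (s • E)) E 0 := by
      simpa using hasDerivAt_exp_smul_const (𝕂 := ℝ) E (0 : ℝ)
    have hD1 := hD
    have hD2 := hD
    rw [show (1 : X →L[ℝ] X) = 1 + (0 : ℝ) • E by simp] at hD1
    rw [show (1 : X →L[ℝ] X) = NormedSpace.exp ((0 : ℝ) • E) by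
      simp [NormedSpace.exp_zero]] at hD2
    have f1 := hD1.comp_hasDerivAt 0 e1
    have f2 := hD2.comp_hasDerivAt 0 e2
    -- The curves 1 + sE and exp(sE) pass through 1 with the same velocity E, so the determinant has
    -- the same derivative along both.
    have f3 := f1.unique (hasDerivAt_det_one_add_smul E)
    refine f2.congr_deriv (Eq.trans ?_ f3)
    simp [NormedSpace.exp_zero]
  have h1 : ∀ s, HasDerivAt g (g s * τ) s := by
    intro s
    have e1 : HasDerivAt (fun r => g s * g (r - s)) (g s * τ) s := by
      refine HasDerivAt.const_mul _ ?_
      have : HasDerivAt g τ (s - s) := by rwa [sub_self]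
      simpa using this.comp_sub_const s s
    refine e1.congr_of_eventuallyEq (Eventually.of_forall fun r => ?_)
    simp only
    rw [← hadd, add_sub_cancel]
  have h2 : ∀ s, HasDerivAt (fun s => g s * Real.exp (-(s * τ))) 0 s := by
    intro s
    have e1 : HasDerivAt (fun s : ℝ => Real.exp (-(s * τ))) (Real.exp (-(s * τ)) * -(1 * τ)) s :=
      (((hasDerivAt_id s).mul_const τ).neg).exp
    refine ((h1 s).mul e1).congr_deriv ?_
    ring
  have h3 := is_const_of_deriv_eq_zero (fun s => (h2 s).differentiableAt)
    (fun s => (h2 s).deriv) s 0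
  have h4 : g 0 = 1 := by
    simp [hg, NormedSpace.exp_zero, ContinuousLinearMap.one_def]
  simp only [zero_mul, neg_zero, Real.exp_zero, mul_one, h4] at h3
  rw [Real.exp_neg] at h3
  have := Real.exp_pos (s * τ)
  field_simp at h3
  exact h3

theorem det_opPow (E : X →L[ℝ] X) {t : ℝ} (ht : 0 < t) :
    LinearMap.det (opPow E t).toLinearMap = t ^ LinearMap.trace ℝ X E.toLinearMap := by
  rw [opPow, det_exp_smul, Real.rpow_def_of_pos ht]

end Determinant

/-! ### The two parts of the Dirichlet form -/

/-- The Gaussian part of the energy. -/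
def gradEnergy (Q : Matrix (Fin d) (Fin d) ℝ) (u : V d → ℝ) : ℝ≥0∞ :=
  ∫⁻ x, ENNReal.ofReal ((1 / 2) * qForm Q (fun i => partialDeriv u i x))

/-- The jump part of the energy. -/
def jumpEnergy (W : Measure (V d)) (u : V d → ℝ) : ℝ≥0∞ :=
  ∫⁻ x, (1 / 2) * ∫⁻ y, ENNReal.ofReal ((u (x + y) - u x) ^ 2) ∂W

theorem energyDensity_eq (Q : Matrix (Fin d) (Fin d) ℝ) (W : Measure (V d)) (u : V d → ℝ)
    (x : V d) : energyDensity Q W u x =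
      ENNReal.ofReal ((1 / 2) * qForm Q (fun i => partialDeriv u i x)) +
        (1 / 2) * ∫⁻ y, ENNReal.ofReal ((u (x + y) - u x) ^ 2) ∂W := rfl

theorem measurable_partialDeriv (u : V d → ℝ) (i : Fin d) : Measurable (partialDeriv u i) :=
  measurable_fderiv_apply_const ℝ u _

theorem measurable_qForm_partialDeriv (Q : Matrix (Fin d) (Fin d) ℝ) (u : V d → ℝ) :
    Measurable fun x => qForm Q (fun i => partialDeriv u i x) := by
  unfold qForm
  have := measurable_partialDeriv u
  fun_prop

theorem dirichletForm_eq_add (Q : Matrix (Fin d) (Fin d) ℝ) (W : Measure (V d)) (u : V d → ℝ) :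
    dirichletForm Q W u = gradEnergy Q u + jumpEnergy W u := by
  unfold dirichletForm
  simp only [energyDensity_eq]
  exact lintegral_add_left ((measurable_qForm_partialDeriv Q u).const_mul _).ennreal_ofReal _

/-- Markov's inequality makes {min(1, ‖x‖²) ≥ 1/(n+1)} finite, and these sets exhaust the complement
of the null point 0. This is what Tonelli's theorem requires throughout. -/
theorem IsLevyMeasure.sigmaFinite {W : Measure (V d)} (hW : IsLevyMeasure W) : SigmaFinite W := by
  have hcompl : ({0}ᶜ : Set (V d)) = ⋃ n : ℕ, {x | 1 / ((n : ℝ) + 1) ≤ min 1 (‖x‖ ^ 2)} := by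
    ext x
    simp only [Set.mem_compl_iff, Set.mem_singleton_iff, Set.mem_iUnion, Set.mem_ofPred_eq]
    constructor
    · intro hx
      have : 0 < min 1 (‖x‖ ^ 2) := by
        have := norm_pos_iff.2 hx
        positivity
      obtain ⟨n, hn⟩ := exists_nat_one_div_lt this
      exact ⟨n, hn.le⟩
    · rintro ⟨n, hn⟩ rfl
      have : (0 : ℝ) < 1 / ((n : ℝ) + 1) := Nat.one_div_pos_of_nat
      simp at hn
      simp at this
      linarith
  refine ⟨⟨⟨fun n => {0} ∪ {x | 1 / ((n : ℝ) + 1) ≤ min 1 (‖x‖ ^ 2)}, fun _ => trivial,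
    fun n => ?_, ?_⟩⟩⟩
  · refine (measure_union_le _ _).trans_lt ?_
    rw [hW.zero, zero_add]
    exact hW.integrable_min.measure_ge_lt_top Nat.one_div_pos_of_nat
  · rw [← Set.union_iUnion, ← hcompl, Set.union_compl_self]

theorem ofReal_jumpSymbol {W : Measure (V d)} (hW : IsLevyMeasure W) (ξ : V d) :
    ENNReal.ofReal (jumpSymbol W ξ) = ∫⁻ y, ENNReal.ofReal (1 - Real.cos (inner ℝ y ξ)) ∂W :=
  ofReal_integral_eq_lintegral_ofReal (hW.integrable_one_sub_cos ξ)
    (ae_of_all _ fun y => by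
      simp only [Pi.zero_apply]
      linarith [Real.cos_le_one (inner ℝ y ξ)])

/-- With x integrated first, the inner integral is an L² modulus of continuity, to which Plancherel
applies. -/
theorem jumpEnergy_eq_lintegral {W : Measure (V d)} [SFinite W] {u : V d → ℝ} (hu : Measurable u) :
    jumpEnergy W u = ∫⁻ y, ((1 / 2) * ∫⁻ x, ENNReal.ofReal ((u (x + y) - u x) ^ 2)) ∂W := by
  have hm : Measurable fun p : V d × V d => ENNReal.ofReal ((u (p.1 + p.2) - u p.1) ^ 2) :=
    (((hu.comp (measurable_fst.add measurable_snd)).sub (hu.comp measurable_fst)).pow_const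
      2).ennreal_ofReal
  unfold jumpEnergy
  rw [lintegral_const_mul _ hm.lintegral_prod_right', lintegral_const_mul _ hm.lintegral_prod_left',
    lintegral_lintegral_swap hm.aemeasurable]

/-- The jump energy along a linear image, in terms of the spectral measure. -/
theorem lintegral_translate_clm {W : Measure (V d)} (hW : IsLevyMeasure W) {u : V d → ℝ}
    {m : Measure (V d)} [SFinite m]
    (hm : ∀ y : V d, ∫⁻ x, ENNReal.ofReal ((u (x + y) - u x) ^ 2) =
        ∫⁻ ξ, ENNReal.ofReal (2 * (1 - Real.cos (inner ℝ y ξ))) ∂m) (B : V d →L[ℝ] V d) :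
    ∫⁻ y, ((1 / 2) * ∫⁻ x, ENNReal.ofReal ((u (x + B y) - u x) ^ 2)) ∂W =
      ∫⁻ ξ, ENNReal.ofReal (jumpSymbol W (B.adjoint ξ)) ∂m := by
  have := hW.sigmaFinite
  have h1 : ∀ y, (1 / 2) * ∫⁻ x, ENNReal.ofReal ((u (x + B y) - u x) ^ 2) =
      ∫⁻ ξ, ENNReal.ofReal (1 - Real.cos (inner ℝ y (B.adjoint ξ))) ∂m := by
    intro y
    rw [hm, ← lintegral_const_mul _ (by fun_prop)]
    refine lintegral_congr fun ξ => ?_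
    rw [ENNReal.ofReal_mul zero_le_two, ← mul_assoc, ContinuousLinearMap.adjoint_inner_right]
    simp [ENNReal.inv_mul_cancel]
  simp only [h1, ofReal_jumpSymbol hW]
  refine lintegral_lintegral_swap ?_
  refine Measurable.aemeasurable ?_
  unfold Function.uncurry
  fun_prop

/-! ### Scaling -/

section Scaling

variable {η : Measure (V d)} {Q : Matrix (Fin d) (Fin d) ℝ} {W : Measure (V d)}
  {E : V d →L[ℝ] V d}

theorem opPow_inv_mul (E : V d →L[ℝ] V d) {t : ℝ} (ht : 0 < t) (x : V d) :
    opPow E t⁻¹ (opPow E t x) = x := by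
  have h := opPow_mul E (inv_pos.2 ht) ht
  rw [inv_mul_cancel₀ ht.ne', opPow_one] at h
  exact (congrArg (fun A : V d →L[ℝ] V d => A x) h).symm

/-- `t^E` as a linear equivalence. -/
def opPowEquiv (E : V d →L[ℝ] V d) {t : ℝ} (ht : 0 < t) : V d ≃L[ℝ] V d :=
  ContinuousLinearEquiv.equivOfInverse (opPow E t) (opPow E t⁻¹) (opPow_inv_mul E ht)
    (fun x => by simpa using opPow_inv_mul E (inv_pos.2 ht) x)

theorem lintegral_comp_opPow (E : V d →L[ℝ] V d) {t : ℝ} (ht : 0 < t) {g : V d → ℝ≥0∞}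
    (hg : Measurable g) :
    ∫⁻ x, g (opPow E t⁻¹ x) =
      ENNReal.ofReal (t ^ LinearMap.trace ℝ (V d) E.toLinearMap) * ∫⁻ x, g x := by
  have hdet := det_opPow E (inv_pos.2 ht)
  have hpos : 0 < t⁻¹ ^ LinearMap.trace ℝ (V d) E.toLinearMap :=
    Real.rpow_pos_of_pos (inv_pos.2 ht) _
  have h := Measure.map_linearMap_addHaar_eq_smul_addHaar (volume : Measure (V d))
    (f := (opPow E t⁻¹).toLinearMap) (by rw [hdet]; exact hpos.ne')
  rw [hdet, abs_of_pos (inv_pos.2 hpos), Real.inv_rpow ht.le, inv_inv] at h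
  rw [← smul_eq_mul, ← lintegral_smul_measure, ← h, lintegral_map hg]
  · rfl
  · exact (opPow E t⁻¹).continuous.measurable

/-- The density `t^{-tr E} f(t^{-E} x)`. -/
def scaleDensity (E : V d →L[ℝ] V d) (t : ℝ) (f : V d → ℝ) (x : V d) : ℝ :=
  t ^ (-LinearMap.trace ℝ (V d) E.toLinearMap) * f (opPow E t⁻¹ x)

theorem partialDeriv_eq_inner (u : V d → ℝ) (i : Fin d) (x : V d) :
    partialDeriv u i x = (InnerProductSpace.toDual ℝ (V d)).symm (fderiv ℝ u x) i := by
  rw [partialDeriv, ← InnerProductSpace.toDual_symm_apply, EuclideanSpace.inner_single_right]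
  simp

theorem qForm_partialDeriv_comp [IsProbabilityMeasure η] (hη : HasSymmetricTriple η Q W)
    (hE : IsOperatorStable η E) {t : ℝ} (ht : 0 < t) (u : V d → ℝ) (c : ℝ) (x : V d) :
    qForm Q (fun i => partialDeriv (fun x => c * u (opPow E t⁻¹ x)) i x) =
      c ^ 2 * (t⁻¹ * qForm Q (fun i => partialDeriv u i (opPow E t⁻¹ x))) := by
  set B := opPow E t⁻¹ with hB
  set ξ := (InnerProductSpace.toDual ℝ (V d)).symm (fderiv ℝ u (B x)) with hξ
  have h1 : ∀ i, partialDeriv (fun x => c * u (B x)) i x = c * B.adjoint ξ i := by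
    intro i
    have e1 : fderiv ℝ (fun x => c * u (B x)) x = c • fderiv ℝ (fun x => u (B x)) x :=
      congrFun (fderiv_const_smul_field (𝕜 := ℝ) (f := fun x => u (B x)) c) x
    -- Because B is invertible, the chain rule also holds for the default value 0 of `fderiv`, so no
    -- differentiability of u is needed.
    have e2 : fderiv ℝ (fun x => u (B x)) x =
        (fderiv ℝ u (B x)).comp (opPowEquiv E (inv_pos.2 ht) : V d →L[ℝ] V d) :=
      (opPowEquiv E (inv_pos.2 ht)).comp_right_fderiv
    have e3 : inner ℝ (B.adjoint ξ) (EuclideanSpace.single i (1 : ℝ)) = B.adjoint ξ i := by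
      rw [EuclideanSpace.inner_single_right]
      simp
    rw [partialDeriv, e1, e2, ← e3, ContinuousLinearMap.adjoint_inner_left, hξ,
      InnerProductSpace.toDual_symm_apply]
    rfl
  have h2 : (fun i => partialDeriv (fun x => c * u (B x)) i x) = c • (B.adjoint ξ : Fin d → ℝ) := by
    ext i
    rw [h1]
    rfl
  have h3 : (fun i => partialDeriv u i (B x)) = (ξ : Fin d → ℝ) := by
    ext i
    rw [partialDeriv_eq_inner]
  rw [h2, h3, qForm_smul, qForm_adjoint_opPow hη hE (inv_pos.2 ht)]

theorem gradEnergy_scale [IsProbabilityMeasure η] (hη : HasSymmetricTriple η Q W)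
    (hE : IsOperatorStable η E) {t : ℝ} (ht : 0 < t) (u : V d → ℝ) {c : ℝ}
    (hc : c ^ 2 = t ^ (-LinearMap.trace ℝ (V d) E.toLinearMap)) :
    gradEnergy Q (fun x => c * u (opPow E t⁻¹ x)) = ENNReal.ofReal t⁻¹ * gradEnergy Q u := by
  have hpos : 0 < t ^ LinearMap.trace ℝ (V d) E.toLinearMap := Real.rpow_pos_of_pos ht _
  have hm : Measurable fun x =>
      ENNReal.ofReal ((1 / 2) * qForm Q (fun i => partialDeriv u i x)) :=
    ((measurable_qForm_partialDeriv Q u).const_mul _).ennreal_ofReal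
  unfold gradEnergy
  simp only [qForm_partialDeriv_comp hη hE ht]
  have h1 : ∀ x, ENNReal.ofReal ((1 / 2) *
      (c ^ 2 * (t⁻¹ * qForm Q (fun i => partialDeriv u i (opPow E t⁻¹ x))))) =
      ENNReal.ofReal (c ^ 2 * t⁻¹) * ENNReal.ofReal ((1 / 2) *
        qForm Q (fun i => partialDeriv u i (opPow E t⁻¹ x))) := by
    intro x
    rw [← ENNReal.ofReal_mul (by positivity)]
    congr 1
    ring
  simp only [h1]
  rw [lintegral_const_mul _ (by exact hm.comp (opPow E t⁻¹).continuous.measurable),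
    lintegral_comp_opPow E ht hm, ← mul_assoc, ← ENNReal.ofReal_mul (by positivity), hc,
    Real.rpow_neg ht.le]
  congr 2
  field_simp

/-- The scaling relation is available for the symbol of W, not for W itself. The change of variables
turns the increment along y into one along t^(-E) y, and the spectral measure of u then moves the
operator onto `jumpSymbol`. -/
theorem jumpEnergy_scale [IsProbabilityMeasure η] (hη : HasSymmetricTriple η Q W)
    (hE : IsOperatorStable η E) {t : ℝ} (ht : 0 < t) {u : V d → ℝ} (hu : Measurable u)
    (hu2 : MemLp u 2) {c : ℝ} (hc : c ^ 2 = t ^ (-LinearMap.trace ℝ (V d) E.toLinearMap)) :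
    jumpEnergy W (fun x => c * u (opPow E t⁻¹ x)) = ENNReal.ofReal t⁻¹ * jumpEnergy W u := by
  have hpos : 0 < t ^ LinearMap.trace ℝ (V d) E.toLinearMap := Real.rpow_pos_of_pos ht _
  have := hη.levy.sigmaFinite
  obtain ⟨m, hm1, hm2⟩ := exists_spectral_measure hu2
  have hfin : IsFiniteMeasure m := by
    refine ⟨?_⟩
    rw [hm1]
    exact hu2.integrable_sq.lintegral_lt_top
  have hBm : Measurable (opPow E t⁻¹) := (opPow E t⁻¹).continuous.measurable
  rw [jumpEnergy_eq_lintegral (by fun_prop), jumpEnergy_eq_lintegral hu]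
  have h1 : ∀ y, ∫⁻ x, ENNReal.ofReal
      ((c * u (opPow E t⁻¹ (x + y)) - c * u (opPow E t⁻¹ x)) ^ 2) =
      ∫⁻ x, ENNReal.ofReal ((u (x + opPow E t⁻¹ y) - u x) ^ 2) := by
    intro y
    have hmy : Measurable fun x => ENNReal.ofReal ((u (x + opPow E t⁻¹ y) - u x) ^ 2) := by
      fun_prop
    have e1 : ∀ x, ENNReal.ofReal ((c * u (opPow E t⁻¹ (x + y)) - c * u (opPow E t⁻¹ x)) ^ 2) =
        ENNReal.ofReal (c ^ 2) * ENNReal.ofReal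
          ((u (opPow E t⁻¹ x + opPow E t⁻¹ y) - u (opPow E t⁻¹ x)) ^ 2) := by
      intro x
      rw [← ENNReal.ofReal_mul (by positivity), map_add]
      congr 1
      ring
    simp only [e1]
    rw [lintegral_const_mul _ (by exact hmy.comp hBm), lintegral_comp_opPow E ht hmy, ← mul_assoc,
      ← ENNReal.ofReal_mul (by positivity), hc, Real.rpow_neg ht.le, inv_mul_cancel₀ hpos.ne',
      ENNReal.ofReal_one, one_mul]
  simp only [h1]
  rw [lintegral_translate_clm hη.levy hm2]
  have h2 := lintegral_translate_clm hη.levy hm2 (ContinuousLinearMap.id ℝ (V d))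
  rw [ContinuousLinearMap.adjoint_id] at h2
  simp only [ContinuousLinearMap.id_apply] at h2
  rw [h2, ← lintegral_const_mul' _ _ ENNReal.ofReal_ne_top]
  refine lintegral_congr fun ξ => ?_
  rw [jumpSymbol_adjoint_opPow hη hE (inv_pos.2 ht), ENNReal.ofReal_mul (by positivity)]

end Scaling

/-! ### Homogeneous functions -/

section Homogeneous

variable {F : ℝ≥0 → ℝ≥0} {γ : ℝ}

theorem homogeneous_mul (hFzero : F 0 = 0) (hFhom : ∀ y : ℝ≥0, 0 < y → F y = F 1 * y ^ γ)
    {c : ℝ≥0} (hc : 0 < c) (y : ℝ≥0) : F (c * y) = c ^ γ * F y := by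
  rcases eq_zero_or_pos y with rfl | hy
  · simp [hFzero]
  · rw [hFhom _ (mul_pos hc hy), hFhom y hy, NNReal.mul_rpow]
    ring

theorem homogeneous_mono (hγ0 : 0 ≤ γ) (hFzero : F 0 = 0)
    (hFhom : ∀ y : ℝ≥0, 0 < y → F y = F 1 * y ^ γ) : Monotone F := by
  intro x y hxy
  rcases eq_zero_or_pos x with rfl | hx
  · simp [hFzero]
  · rw [hFhom x hx, hFhom y (hx.trans_le hxy)]
    gcongr

theorem homogeneous_measurable (hFzero : F 0 = 0)
    (hFhom : ∀ y : ℝ≥0, 0 < y → F y = F 1 * y ^ γ) : Measurable F := by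
  have : F = fun y => if y = 0 then 0 else F 1 * y ^ γ := by
    ext y
    split_ifs with h
    · rw [h, hFzero]
    · rw [hFhom y (pos_iff_ne_zero.2 h)]
  rw [this]
  exact Measurable.ite (measurableSet_singleton 0) measurable_const (by fun_prop)

/-- Subadditivity of y^γ for γ in [0,1]; this is what lets periodization decrease ∫F(f). -/
theorem homogeneous_add_le (hγ0 : 0 ≤ γ) (hγ1 : γ ≤ 1)
    (hFhom : ∀ y : ℝ≥0, 0 < y → F y = F 1 * y ^ γ) (x y : ℝ≥0) : F (x + y) ≤ F x + F y := by
  rcases eq_zero_or_pos x with rfl | hx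
  · simp
  rcases eq_zero_or_pos y with rfl | hy
  · simp
  rw [hFhom x hx, hFhom y hy, hFhom _ (add_pos hx hy), ← mul_add]
  gcongr
  exact NNReal.rpow_add_le_add_rpow x y hγ0 hγ1

theorem homogeneous_one_ne_zero (hFzero : F 0 = 0)
    (hFhom : ∀ y : ℝ≥0, 0 < y → F y = F 1 * y ^ γ) (hFne : ∃ y : ℝ≥0, F y ≠ 0) : F 1 ≠ 0 := by
  rintro h
  obtain ⟨y, hy⟩ := hFne
  rcases eq_zero_or_pos y with rfl | hy0
  · exact hy hFzero
  · exact hy (by rw [hFhom y hy0, h, zero_mul])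

end Homogeneous

/-! ### The derivative of a square root -/

/-- With the convention `a / 0 = 0`, this holds also where `f` vanishes, because `√f` is then
minimal, so that its derivative is zero if it exists. -/
theorem partialDeriv_sqrt {f : V d → ℝ} (hf : Differentiable ℝ f) (h0 : ∀ x, 0 ≤ f x) (i : Fin d)
    (x : V d) :
    partialDeriv (fun x => Real.sqrt (f x)) i x = partialDeriv f i x / (2 * Real.sqrt (f x)) := by
  rcases (h0 x).eq_or_lt with h | h
  · have hmin : IsLocalMin (fun x => Real.sqrt (f x)) x :=
      Eventually.of_forall fun y => by simp [← h]
    rw [partialDeriv, hmin.fderiv_eq_zero, ← h]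
    simp
  · have := (hf x).hasFDerivAt.sqrt h.ne'
    rw [partialDeriv, this.fderiv, partialDeriv]
    simp
    ring

theorem partialDeriv_eq_zero {f : V d → ℝ} (h0 : ∀ x, 0 ≤ f x) (i : Fin d)
    {x : V d} (hx : f x = 0) : partialDeriv f i x = 0 := by
  have hmin : IsLocalMin f x := Eventually.of_forall fun y => by simp [hx, h0 y]
  rw [partialDeriv, hmin.fderiv_eq_zero]
  simp

/-! ### The functional on the whole space -/

/-- The functional `λ⁻¹ 𝓔_η(√f, √f) + λ^{(1-γ) tr E} ∫ F(f)` on `ℝ^d`. -/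
def spaceFunctional (Q : Matrix (Fin d) (Fin d) ℝ) (W : Measure (V d)) (E : V d →L[ℝ] V d)
    (F : ℝ≥0 → ℝ≥0) (γ l : ℝ) (f : V d → ℝ) : ℝ≥0∞ :=
  ENNReal.ofReal l⁻¹ * dirichletForm Q W (fun x => Real.sqrt (f x))
    + ENNReal.ofReal (l ^ ((1 - γ) * LinearMap.trace ℝ (V d) E.toLinearMap))
      * integralF F Set.univ f

theorem integralF_eq_univ {F : ℝ≥0 → ℝ≥0} (hFzero : F 0 = 0) {Ω : Set (V d)}
    (hΩ : MeasurableSet Ω) {f : V d → ℝ} (hf : tsupport f ⊆ Ω) :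
    integralF F Ω f = integralF F Set.univ f := by
  unfold integralF
  rw [Measure.restrict_univ, ← lintegral_indicator hΩ]
  refine lintegral_congr fun x => ?_
  by_cases hx : x ∈ Ω
  · rw [Set.indicator_of_mem hx]
  · rw [Set.indicator_of_notMem hx, image_eq_zero_of_notMem_tsupport fun h => hx (hf h)]
    simp [hFzero]

/-- A compactly supported density fits into a ball belonging to 𝓖, and F(0) = 0 makes the integral
of F(f) insensitive to the choice of Ω. -/
theorem spaceConstant_eq (Q : Matrix (Fin d) (Fin d) ℝ) (W : Measure (V d))
    {F : ℝ≥0 → ℝ≥0} (hFzero : F 0 = 0) :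
    spaceConstant Q W F = ⨅ f ∈ domainDensities (Set.univ : Set (V d)),
      (dirichletForm Q W (fun x => Real.sqrt (f x)) + integralF F Set.univ f) := by
  refine le_antisymm ?_ ?_
  · refine le_iInf₂ fun f hf => ?_
    obtain ⟨hsm, hcs, -, h0, h1⟩ := hf
    obtain ⟨R, hR⟩ := hcs.isBounded.subset_ball (0 : V d)
    -- The radius R may be nonpositive, whereas the ball must contain 0.
    let R' := max R 1
    have hR' : 0 < R' := lt_max_of_lt_right one_pos
    have hsub : tsupport f ⊆ Metric.ball (0 : V d) R' :=
      hR.trans (Metric.ball_subset_ball (le_max_left _ _))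
    have hΩ : Metric.ball (0 : V d) R' ∈ domains d := by
      refine ⟨Metric.isOpen_ball, ?_, Metric.isBounded_ball, Metric.mem_ball_self hR', ?_⟩
      · exact (convex_ball _ _).isConnected ⟨0, Metric.mem_ball_self hR'⟩
      · exact (convex_ball _ _).addHaar_frontier _
    refine (iInf₂_le_of_le _ hΩ (iInf₂_le f ⟨hsm, hcs, hsub, h0, h1⟩)).trans ?_
    rw [integralF_eq_univ hFzero Metric.isOpen_ball.measurableSet hsub]
  · refine le_iInf₂ fun Ω hΩ => le_iInf₂ fun f hf => ?_
    rw [integralF_eq_univ hFzero hΩ.1.measurableSet hf.2.2.1]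
    exact iInf₂_le f ⟨hf.1, hf.2.1, Set.subset_univ _, hf.2.2.2⟩

/-! ### Scaling invariance on the whole space -/

section Law

variable {η : Measure (V d)} {Q : Matrix (Fin d) (Fin d) ℝ} {W : Measure (V d)}
  {E : V d →L[ℝ] V d} {F : ℝ≥0 → ℝ≥0} {γ : ℝ}

theorem lintegral_of_mem_domainDensities {f : V d → ℝ} {Ω : Set (V d)}
    (hf : f ∈ domainDensities Ω) : ∫⁻ x, ENNReal.ofReal (f x) = 1 := by
  rw [← ofReal_integral_eq_lintegral_ofReal (hf.1.continuous.integrable_of_hasCompactSupport hf.2.1)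
    (ae_of_all _ hf.2.2.2.1), hf.2.2.2.2, ENNReal.ofReal_one]

/-- A membership criterion for densities on the whole space. -/
theorem mem_domainDensities_univ {f : V d → ℝ} (h1 : ContDiff ℝ ∞ f) (h2 : HasCompactSupport f)
    (h3 : ∀ x, 0 ≤ f x) (h4 : ∫⁻ x, ENNReal.ofReal (f x) = 1) :
    f ∈ domainDensities (Set.univ : Set (V d)) := by
  refine ⟨h1, h2, Set.subset_univ _, h3, ?_⟩
  rw [integral_eq_lintegral_of_nonneg_ae (ae_of_all _ h3) h1.continuous.aestronglyMeasurable, h4,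
    ENNReal.toReal_one]

theorem scaleDensity_mem (E : V d →L[ℝ] V d) {t : ℝ} (ht : 0 < t) {f : V d → ℝ}
    (hf : f ∈ domainDensities (Set.univ : Set (V d))) :
    scaleDensity E t f ∈ domainDensities (Set.univ : Set (V d)) := by
  have hpos : 0 < t ^ LinearMap.trace ℝ (V d) E.toLinearMap := Real.rpow_pos_of_pos ht _
  refine mem_domainDensities_univ ?_ ?_ (fun x => ?_) ?_
  · exact contDiff_const.mul (hf.1.comp (opPow E t⁻¹).contDiff)
  · exact (hf.2.1.comp_homeomorph (opPowEquiv E (inv_pos.2 ht)).toHomeomorph).mul_left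
  · exact mul_nonneg (Real.rpow_nonneg ht.le _) (hf.2.2.2.1 _)
  · have hm : Measurable fun x => ENNReal.ofReal (f x) := hf.1.continuous.measurable.ennreal_ofReal
    simp only [scaleDensity, ENNReal.ofReal_mul (Real.rpow_nonneg ht.le _)]
    rw [lintegral_const_mul _ (by exact hm.comp (opPow E t⁻¹).continuous.measurable),
      lintegral_comp_opPow E ht hm, lintegral_of_mem_domainDensities hf, mul_one,
      ← ENNReal.ofReal_mul (Real.rpow_nonneg ht.le _), Real.rpow_neg ht.le,
      inv_mul_cancel₀ hpos.ne', ENNReal.ofReal_one]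

theorem memLp_sqrt {f : V d → ℝ} {Ω : Set (V d)} (hf : f ∈ domainDensities Ω) :
    MemLp (fun x => Real.sqrt (f x)) 2 := by
  refine (Real.continuous_sqrt.comp hf.1.continuous).memLp_of_hasCompactSupport ?_
  exact hf.2.1.comp_left Real.sqrt_zero

theorem dirichletForm_scaleDensity [IsProbabilityMeasure η] (hη : HasSymmetricTriple η Q W)
    (hE : IsOperatorStable η E) {t : ℝ} (ht : 0 < t) {f : V d → ℝ}
    (hf : f ∈ domainDensities (Set.univ : Set (V d))) :
    dirichletForm Q W (fun x => Real.sqrt (scaleDensity E t f x)) =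
      ENNReal.ofReal t⁻¹ * dirichletForm Q W (fun x => Real.sqrt (f x)) := by
  have hpos : 0 ≤ t ^ (-LinearMap.trace ℝ (V d) E.toLinearMap) := Real.rpow_nonneg ht.le _
  have h1 : (fun x => Real.sqrt (scaleDensity E t f x)) = fun x =>
      Real.sqrt (t ^ (-LinearMap.trace ℝ (V d) E.toLinearMap)) *
        (fun x => Real.sqrt (f x)) (opPow E t⁻¹ x) := by
    ext x
    rw [scaleDensity, Real.sqrt_mul hpos]
  rw [dirichletForm_eq_add, dirichletForm_eq_add, h1,
    gradEnergy_scale hη hE ht (fun x => Real.sqrt (f x)) (Real.sq_sqrt hpos),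
    jumpEnergy_scale (u := fun x => Real.sqrt (f x)) hη hE ht (Real.continuous_sqrt.comp hf.1.continuous).measurable (memLp_sqrt hf)
      (Real.sq_sqrt hpos), mul_add]

theorem integralF_scaleDensity (hFzero : F 0 = 0)
    (hFhom : ∀ y : ℝ≥0, 0 < y → F y = F 1 * y ^ γ) (E : V d →L[ℝ] V d) {t : ℝ} (ht : 0 < t)
    {f : V d → ℝ} (hf : Measurable f) :
    integralF F Set.univ (scaleDensity E t f) =
      ENNReal.ofReal (t ^ ((1 - γ) * LinearMap.trace ℝ (V d) E.toLinearMap)) *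
        integralF F Set.univ f := by
  have hpos : 0 < t ^ (-LinearMap.trace ℝ (V d) E.toLinearMap) := Real.rpow_pos_of_pos ht _
  have hm : Measurable fun x => (F (f x).toNNReal : ℝ≥0∞) :=
    ((homogeneous_measurable hFzero hFhom).comp hf.real_toNNReal).coe_nnreal_ennreal
  have h1 : ∀ x, (F (scaleDensity E t f x).toNNReal : ℝ≥0∞) =
      ENNReal.ofReal ((t ^ (-LinearMap.trace ℝ (V d) E.toLinearMap)) ^ γ) *
        (F (f (opPow E t⁻¹ x)).toNNReal : ℝ≥0∞) := by
    intro x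
    rw [scaleDensity, Real.toNNReal_mul hpos.le,
      homogeneous_mul hFzero hFhom (Real.toNNReal_pos.2 hpos), ENNReal.coe_mul, ENNReal.ofReal,
      Real.toNNReal_rpow_of_nonneg hpos.le]
  unfold integralF
  simp only [h1, Measure.restrict_univ]
  rw [lintegral_const_mul _ (by exact hm.comp (opPow E t⁻¹).continuous.measurable),
    lintegral_comp_opPow E ht hm, ← mul_assoc, ← ENNReal.ofReal_mul (by positivity),
    ← Real.rpow_mul ht.le, ← Real.rpow_add ht]
  congr 3
  ring

/-- Scaling invariance of the functional on the whole space. -/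
theorem spaceFunctional_scaleDensity [IsProbabilityMeasure η] (hη : HasSymmetricTriple η Q W)
    (hE : IsOperatorStable η E) (hFzero : F 0 = 0)
    (hFhom : ∀ y : ℝ≥0, 0 < y → F y = F 1 * y ^ γ) {t l : ℝ} (ht : 0 < t) (hl : 0 < l)
    {f : V d → ℝ} (hf : f ∈ domainDensities (Set.univ : Set (V d))) :
    spaceFunctional Q W E F γ l (scaleDensity E t f) = spaceFunctional Q W E F γ (l * t) f := by
  unfold spaceFunctional
  rw [dirichletForm_scaleDensity hη hE ht hf,
    integralF_scaleDensity hFzero hFhom E ht hf.1.continuous.measurable, ← mul_assoc, ← mul_assoc,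
    ← ENNReal.ofReal_mul (by positivity), ← ENNReal.ofReal_mul (by positivity), mul_inv,
    Real.mul_rpow hl.le ht.le]

theorem spaceFunctional_one (Q : Matrix (Fin d) (Fin d) ℝ) (W : Measure (V d))
    (E : V d →L[ℝ] V d) (F : ℝ≥0 → ℝ≥0) (γ : ℝ) (f : V d → ℝ) :
    spaceFunctional Q W E F γ 1 f =
      dirichletForm Q W (fun x => Real.sqrt (f x)) + integralF F Set.univ f := by
  simp [spaceFunctional]

/-- Scaling a density by t replaces the parameter λ by λt; the scalings t = l and t = l⁻¹ give the
two inequalities between the infima at parameters 1 and l. -/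
theorem spaceConstant_eq_iInf [IsProbabilityMeasure η] (hη : HasSymmetricTriple η Q W)
    (hE : IsOperatorStable η E) (hFzero : F 0 = 0)
    (hFhom : ∀ y : ℝ≥0, 0 < y → F y = F 1 * y ^ γ) {l : ℝ} (hl : 0 < l) :
    spaceConstant Q W F = ⨅ f ∈ domainDensities (Set.univ : Set (V d)),
      spaceFunctional Q W E F γ l f := by
  rw [spaceConstant_eq Q W hFzero]
  simp only [← spaceFunctional_one Q W E F γ]
  refine le_antisymm ?_ ?_
  · refine le_iInf₂ fun f hf => (iInf₂_le _ (scaleDensity_mem E hl hf)).trans ?_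
    rw [spaceFunctional_scaleDensity hη hE hFzero hFhom hl one_pos hf, one_mul]
  · refine le_iInf₂ fun f hf => (iInf₂_le _ (scaleDensity_mem E (inv_pos.2 hl) hf)).trans ?_
    rw [spaceFunctional_scaleDensity hη hE hFzero hFhom (inv_pos.2 hl) hl hf,
      mul_inv_cancel₀ hl.ne']

end Law

/-! ### The integer lattice and the fundamental cube -/

/-- The vector of `ℤ^d` with coordinates `k`. -/
def latticeVec (k : Fin d → ℤ) : V d := WithLp.toLp 2 fun i => (k i : ℝ)

theorem latticeVec_apply (k : Fin d → ℤ) (i : Fin d) : latticeVec k i = k i := rfl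

theorem latticeVec_neg (k : Fin d → ℤ) : latticeVec (-k) = -latticeVec k := by
  ext i
  simp [latticeVec_apply]

theorem latticeVec_add (k l : Fin d → ℤ) : latticeVec (k + l) = latticeVec k + latticeVec l := by
  ext i
  simp [latticeVec_apply]

theorem IsPeriodic.add_latticeVec {u : V d → ℝ} (hu : IsPeriodic u) (k : Fin d → ℤ) (x : V d) :
    u (x + latticeVec k) = u x := by
  have h1 : ∀ s : Finset (Fin d), Function.Periodic u
      (∑ i ∈ s, k i • (EuclideanSpace.single i (1 : ℝ) : V d)) := by
    intro s
    induction s using Finset.induction_on with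
    | empty => intro x; simp
    | insert i s hi ih =>
      rw [Finset.sum_insert hi]
      have h2 : Function.Periodic u (EuclideanSpace.single i (1 : ℝ) : V d) := hu i
      exact (h2.zsmul (k i)).add_period ih
  have h3 : latticeVec k = ∑ i, k i • (EuclideanSpace.single i (1 : ℝ) : V d) := by
    ext j
    simp [latticeVec_apply, Finset.sum_apply, Pi.single_apply]
  rw [h3]
  exact h1 _ x

theorem measurableSet_cube : MeasurableSet (cube d) := by
  have : cube d = ⋂ i, (fun x : V d => x i) ⁻¹' Set.Ico (-(1 / 2) : ℝ) (1 / 2) := by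
    ext x
    simp [cube]
  rw [this]
  exact MeasurableSet.iInter fun i => measurableSet_Ico.preimage (by fun_prop)

theorem tsum_indicator_cube (x : V d) :
    ∑' k : Fin d → ℤ, (cube d).indicator (1 : V d → ℝ≥0∞) (x + latticeVec k) = 1 := by
  -- Since the cube is half-open, exactly one lattice translate of x falls into it, found
  -- coordinatewise by rounding.
  have hmem : ∀ k : Fin d → ℤ, x + latticeVec k ∈ cube d ↔ k = fun i => -⌊x i + 1 / 2⌋ := by
    intro k
    rw [funext_iff]
    refine forall_congr' fun i => ?_
    have : (x + latticeVec k) i = x i + k i := by simp [latticeVec_apply]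
    rw [this, Set.mem_Ico, eq_comm (a := k i), neg_eq_iff_eq_neg, Int.floor_eq_iff]
    push_cast
    constructor <;> rintro ⟨h1, h2⟩ <;> constructor <;> linarith
  rw [tsum_eq_single (fun i => -⌊x i + 1 / 2⌋) fun k hk => Set.indicator_of_notMem
    (fun h => hk ((hmem k).1 h)) _, Set.indicator_of_mem ((hmem _).2 rfl)]
  rfl

/-- The translates of the cube tile the space. -/
theorem tsum_setLIntegral_cube {h : V d → ℝ≥0∞} (hh : Measurable h) :
    ∑' k : Fin d → ℤ, ∫⁻ x in cube d, h (x + latticeVec k) = ∫⁻ x, h x := by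
  have hm : ∀ k : Fin d → ℤ, Measurable fun x : V d =>
      (cube d).indicator (1 : V d → ℝ≥0∞) (x + latticeVec k) := fun k =>
    (measurable_one.indicator measurableSet_cube).comp (measurable_add_const _)
  calc ∑' k : Fin d → ℤ, ∫⁻ x in cube d, h (x + latticeVec k)
      = ∑' k : Fin d → ℤ, ∫⁻ x, (cube d).indicator 1 (x + latticeVec (-k)) * h x := by
        refine tsum_congr fun k => ?_
        rw [← lintegral_indicator measurableSet_cube,
          ← lintegral_add_right_eq_self (μ := volume)
            (fun x => (cube d).indicator 1 (x + latticeVec (-k)) * h x) (latticeVec k)]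
        refine lintegral_congr fun x => ?_
        rw [latticeVec_neg, add_neg_cancel_right]
        by_cases hx : x ∈ cube d <;> simp [hx]
    _ = ∫⁻ x, ∑' k : Fin d → ℤ, (cube d).indicator 1 (x + latticeVec (-k)) * h x :=
        (lintegral_tsum fun k => ((hm (-k)).mul hh).aemeasurable).symm
    _ = ∫⁻ x, h x := by
        refine lintegral_congr fun x => ?_
        have := (Equiv.neg (Fin d → ℤ)).tsum_eq
          fun k => (cube d).indicator (1 : V d → ℝ≥0∞) (x + latticeVec k)
        simp only [Equiv.neg_apply] at this
        rw [ENNReal.tsum_mul_right, this, tsum_indicator_cube, one_mul]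

/-- Integrals of periodic functions over the cube are translation invariant. -/
theorem setLIntegral_cube_add {h : V d → ℝ≥0∞} (hh : Measurable h)
    (hper : ∀ (k : Fin d → ℤ) (x : V d), h (x + latticeVec k) = h x) (w : V d) :
    ∫⁻ x in cube d, h (x + w) = ∫⁻ x in cube d, h x := by
  have hm : ∀ v : V d, Measurable fun x : V d =>
      (cube d).indicator (1 : V d → ℝ≥0∞) (x + v) := fun v =>
    (measurable_one.indicator measurableSet_cube).comp (measurable_add_const _)
  calc ∫⁻ x in cube d, h (x + w)
      = ∫⁻ x, (cube d).indicator 1 (x + -w) * h x := by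
        rw [← lintegral_indicator measurableSet_cube,
          ← lintegral_add_right_eq_self (μ := volume)
            (fun x => (cube d).indicator 1 (x + -w) * h x) w]
        refine lintegral_congr fun x => ?_
        rw [add_neg_cancel_right]
        by_cases hx : x ∈ cube d <;> simp [hx]
    _ = ∑' k : Fin d → ℤ, ∫⁻ x in cube d,
          (cube d).indicator 1 (x + -w + latticeVec k) * h x := by
        refine (tsum_setLIntegral_cube ((hm (-w)).mul hh)).symm.trans ?_
        refine tsum_congr fun k => lintegral_congr fun x => ?_
        rw [Pi.mul_apply, hper, add_right_comm]
    _ = ∫⁻ x in cube d, ∑' k : Fin d → ℤ,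
          (cube d).indicator 1 (x + -w + latticeVec k) * h x := by
        refine (lintegral_tsum fun k => ?_).symm
        have := hm (-w + latticeVec k)
        simp only [← add_assoc] at this
        exact (this.mul hh).aemeasurable
    _ = ∫⁻ x in cube d, h x := by
        refine lintegral_congr fun x => ?_
        rw [ENNReal.tsum_mul_right, tsum_indicator_cube, one_mul]

/-! ### Periodization -/

/-- The periodization `∑_k g(x + k)`. -/
def periodize (g : V d → ℝ) (x : V d) : ℝ := ∑' k : Fin d → ℤ, g (x + latticeVec k)

/-- Local finiteness: one finite set of lattice vectors serves a whole ball, so periodizations can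
be differentiated termwise and compared at two points. -/
theorem exists_finset_support_periodize {g : V d → ℝ} (hg : HasCompactSupport g) (R : ℝ) :
    ∃ S : Finset (Fin d → ℤ), ∀ x : V d, ‖x‖ ≤ R → ∀ k ∉ S, g (x + latticeVec k) = 0 := by
  obtain ⟨R₀, hR₀⟩ := hg.isBounded.subset_closedBall (0 : V d)
  let N : ℤ := ⌈R + R₀⌉
  refine ⟨Fintype.piFinset fun _ => Finset.Icc (-N) N, fun x hx k hk => ?_⟩
  by_contra hne
  apply hk
  rw [Fintype.mem_piFinset]
  intro i
  have h1 : ‖x + latticeVec k‖ ≤ R₀ := by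
    have := hR₀ (subset_tsupport g hne)
    simpa using this
  have h2 : ‖latticeVec k‖ ≤ R + R₀ := by
    have : latticeVec k = (x + latticeVec k) - x := by abel
    rw [this]
    exact (norm_sub_le _ _).trans (by linarith)
  have h3 : |(k i : ℝ)| ≤ N := by
    have h4 := PiLp.norm_apply_le (latticeVec k) i
    rw [latticeVec_apply, Real.norm_eq_abs] at h4
    exact h4.trans (h2.trans (Int.le_ceil _))
  rw [Finset.mem_Icc, ← abs_le]
  exact_mod_cast h3

theorem periodize_eq_sum {g : V d → ℝ} {S : Finset (Fin d → ℤ)} {x : V d}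
    (hS : ∀ k ∉ S, g (x + latticeVec k) = 0) :
    periodize g x = ∑ k ∈ S, g (x + latticeVec k) := tsum_eq_sum hS

theorem periodize_eventuallyEq {g : V d → ℝ} (hg : HasCompactSupport g) (x : V d) :
    ∃ S : Finset (Fin d → ℤ), (∀ k ∉ S, g (x + latticeVec k) = 0) ∧
      periodize g =ᶠ[𝓝 x] fun y => ∑ k ∈ S, g (y + latticeVec k) := by
  obtain ⟨S, hS⟩ := exists_finset_support_periodize hg (‖x‖ + 1)
  refine ⟨S, hS x (by linarith), ?_⟩
  have : Metric.ball x 1 ∈ 𝓝 x := Metric.ball_mem_nhds x one_pos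
  filter_upwards [this] with y hy
  refine periodize_eq_sum (hS y ?_)
  rw [Metric.mem_ball, dist_eq_norm] at hy
  have : y = x + (y - x) := by abel
  rw [this]
  exact (norm_add_le _ _).trans (by linarith)

theorem contDiff_periodize {g : V d → ℝ} (hg : HasCompactSupport g) (hg' : ContDiff ℝ ∞ g) :
    ContDiff ℝ ∞ (periodize g) := by
  rw [contDiff_iff_contDiffAt]
  intro x
  obtain ⟨S, -, hS⟩ := periodize_eventuallyEq hg x
  refine ContDiffAt.congr_of_eventuallyEq ?_ hS
  refine ContDiff.contDiffAt (ContDiff.sum fun k _ => hg'.comp ?_)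
  exact contDiff_id.add contDiff_const

theorem isPeriodic_periodize (g : V d → ℝ) : IsPeriodic (periodize g) := by
  intro i x
  have h : (EuclideanSpace.single i (1 : ℝ) : V d) = latticeVec (Pi.single i 1) := by
    ext j
    rw [latticeVec_apply]
    by_cases hij : j = i
    · subst hij; simp
    · simp [hij]
  unfold periodize
  rw [h, ← (Equiv.addLeft (Pi.single i 1 : Fin d → ℤ)).tsum_eq fun k => g (x + latticeVec k)]
  refine tsum_congr fun k => ?_
  rw [Equiv.coe_addLeft, latticeVec_add, add_assoc]

theorem partialDeriv_comp_add (g : V d → ℝ) (i : Fin d) (x v : V d) :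
    partialDeriv (fun y => g (y + v)) i x = partialDeriv g i (x + v) := by
  rw [partialDeriv, fderiv_comp_add_right, partialDeriv]

theorem partialDeriv_periodize {g : V d → ℝ} (hg : HasCompactSupport g)
    (hg' : Differentiable ℝ g) (x : V d) :
    ∃ S : Finset (Fin d → ℤ), (∀ k ∉ S, g (x + latticeVec k) = 0) ∧
      periodize g x = ∑ k ∈ S, g (x + latticeVec k) ∧
      ∀ i, partialDeriv (periodize g) i x = ∑ k ∈ S, partialDeriv g i (x + latticeVec k) := by
  obtain ⟨S, hS0, hS⟩ := periodize_eventuallyEq hg x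
  refine ⟨S, hS0, periodize_eq_sum hS0, fun i => ?_⟩
  rw [partialDeriv, hS.fderiv_eq, fderiv_fun_sum fun k _ => by fun_prop]
  simp only [sum_apply, ← partialDeriv_comp_add]
  rfl

-- Factor Q as BᵀB and take the rows of B; inequalities for the quadratic form then reduce to
-- inequalities for squares of real numbers.
open scoped MatrixOrder in
theorem exists_qForm_eq_sum_sq {Q : Matrix (Fin d) (Fin d) ℝ} (hQ : Q.PosSemidef) :
    ∃ v : Fin d → V d, ∀ p : Fin d → ℝ, qForm Q p = ∑ j, (∑ i, v j i * p i) ^ 2 := by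
  obtain ⟨B, hB⟩ := CStarAlgebra.nonneg_iff_eq_star_mul_self.mp hQ.nonneg
  refine ⟨fun j => WithLp.toLp 2 (B j), fun p => ?_⟩
  have h1 : ∀ i j, Q i j = ∑ k, B k i * B k j := by
    intro i j
    rw [hB, Matrix.mul_apply]
    simp
  simp only [qForm, h1, sq, Finset.sum_mul]
  have h2 : ∀ i, ∑ j, ∑ k, B k i * B k j * p i * p j = ∑ k, ∑ j, B k i * p i * (B k j * p j) := by
    intro i
    rw [Finset.sum_comm]
    exact Finset.sum_congr rfl fun k _ => Finset.sum_congr rfl fun j _ => by ring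
  simp only [h2, Finset.mul_sum]
  rw [Finset.sum_comm]

/-- Convexity of `(p, g) ↦ ⟨Qp, p⟩ / g`. -/
theorem qForm_sum_le {ι : Type*} {Q : Matrix (Fin d) (Fin d) ℝ} (hQ : Q.PosSemidef)
    (S : Finset ι) (p : ι → Fin d → ℝ) (g : ι → ℝ) (hg : ∀ k, 0 ≤ g k)
    (hp : ∀ k, g k = 0 → p k = 0) :
    qForm Q (∑ k ∈ S, p k) ≤ (∑ k ∈ S, g k) * ∑ k ∈ S, qForm Q (p k) / g k := by
  obtain ⟨v, hv⟩ := exists_qForm_eq_sum_sq hQ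
  have h1 : ∑ k ∈ S, qForm Q (p k) / g k = ∑ j, ∑ k ∈ S, (∑ i, v j i * p k i) ^ 2 / g k := by
    rw [Finset.sum_comm]
    exact Finset.sum_congr rfl fun k _ => by rw [hv, Finset.sum_div]
  rw [h1, hv, Finset.mul_sum]
  refine Finset.sum_le_sum fun j _ => ?_
  have h2 : ∑ i, v j i * (∑ k ∈ S, p k) i = ∑ k ∈ S, ∑ i, v j i * p k i := by
    rw [Finset.sum_comm]
    exact Finset.sum_congr rfl fun i _ => by rw [Finset.sum_apply, Finset.mul_sum]
  rw [h2]
  -- Cauchy-Schwarz for each row: (∑ pₖ)² ≤ (∑ gₖ)(∑ pₖ²/gₖ). Terms with gₖ = 0 have pₖ = 0 and do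
  -- no harm.
  refine Finset.sum_sq_le_sum_mul_sum_of_sq_le_mul S (fun k _ => hg k)
    (fun k _ => div_nonneg (sq_nonneg _) (hg k)) fun k _ => ?_
  by_cases hk : g k = 0
  · simp [hk, hp k hk]
  · field_simp
    exact le_rfl

/-- The reverse triangle inequality in ℓ² for the vectors (√aₖ) and (√bₖ); expanded, it is
Cauchy-Schwarz. -/
theorem sqrt_sum_sub_sqrt_sum_sq_le {ι : Type*} (S : Finset ι) (a b : ι → ℝ) (ha : ∀ k, 0 ≤ a k)
    (hb : ∀ k, 0 ≤ b k) :
    (Real.sqrt (∑ k ∈ S, a k) - Real.sqrt (∑ k ∈ S, b k)) ^ 2 ≤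
      ∑ k ∈ S, (Real.sqrt (a k) - Real.sqrt (b k)) ^ 2 := by
  have h1 := Real.sum_sqrt_mul_sqrt_le S ha hb
  have h2 : ∑ k ∈ S, (Real.sqrt (a k) - Real.sqrt (b k)) ^ 2 =
      ∑ k ∈ S, a k + ∑ k ∈ S, b k - 2 * ∑ k ∈ S, Real.sqrt (a k) * Real.sqrt (b k) := by
    rw [Finset.mul_sum, ← Finset.sum_add_distrib, ← Finset.sum_sub_distrib]
    refine Finset.sum_congr rfl fun k _ => ?_
    rw [sub_sq, Real.sq_sqrt (ha k), Real.sq_sqrt (hb k)]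
    ring
  rw [h2, sub_sq, Real.sq_sqrt (Finset.sum_nonneg fun k _ => ha k),
    Real.sq_sqrt (Finset.sum_nonneg fun k _ => hb k)]
  linarith

/-! ### Periodization decreases the functional -/

section Periodize

variable {Q : Matrix (Fin d) (Fin d) ℝ} {W : Measure (V d)} {g : V d → ℝ}

theorem qForm_partialDeriv_sqrt {f : V d → ℝ} (hf : Differentiable ℝ f) (h0 : ∀ x, 0 ≤ f x)
    (Q : Matrix (Fin d) (Fin d) ℝ) (x : V d) :
    qForm Q (fun i => partialDeriv (fun x => Real.sqrt (f x)) i x) =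
      qForm Q (fun i => partialDeriv f i x) / (4 * f x) := by
  have : (fun i => partialDeriv (fun x => Real.sqrt (f x)) i x) =
      (2 * Real.sqrt (f x))⁻¹ • fun i => partialDeriv f i x := by
    ext i
    rw [partialDeriv_sqrt hf h0, Pi.smul_apply, smul_eq_mul]
    ring
  rw [this, qForm_smul, inv_pow, mul_pow, Real.sq_sqrt (h0 x)]
  ring

/-- The Gaussian density of √g is ⟨Q∇g, ∇g⟩/(8g), which is subadditive in g by `qForm_sum_le`; apply
this to the lattice translates of g. -/
theorem qForm_periodize_le (hQ : Q.PosSemidef) (hg : HasCompactSupport g)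
    (hg' : Differentiable ℝ g) (hp : Differentiable ℝ (periodize g)) (h0 : ∀ x, 0 ≤ g x)
    (x : V d) :
    ENNReal.ofReal ((1 / 2) * qForm Q (fun i =>
      partialDeriv (fun x => Real.sqrt (periodize g x)) i x)) ≤
    ∑' k, ENNReal.ofReal ((1 / 2) * qForm Q (fun i =>
      partialDeriv (fun x => Real.sqrt (g x)) i (x + latticeVec k))) := by
  obtain ⟨S, -, hS1, hS2⟩ := partialDeriv_periodize hg hg' x
  have hp0 : ∀ x, 0 ≤ periodize g x := fun x => tsum_nonneg fun k => h0 _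
  refine le_trans ?_ (ENNReal.sum_le_tsum S)
  rw [← ENNReal.ofReal_sum_of_nonneg fun k _ => mul_nonneg (by norm_num) (qForm_nonneg hQ _)]
  refine ENNReal.ofReal_le_ofReal ?_
  rw [← Finset.mul_sum]
  refine mul_le_mul_of_nonneg_left ?_ (by norm_num)
  rw [qForm_partialDeriv_sqrt hp hp0]
  simp only [qForm_partialDeriv_sqrt hg' h0]
  have h1 : (fun i => partialDeriv (periodize g) i x) =
      ∑ k ∈ S, fun i => partialDeriv g i (x + latticeVec k) := by
    ext i
    rw [hS2, Finset.sum_apply]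
  have h2 := qForm_sum_le hQ S (fun k i => partialDeriv g i (x + latticeVec k))
    (fun k => g (x + latticeVec k)) (fun k => h0 _)
    fun k hk => by
      ext i
      exact partialDeriv_eq_zero h0 i hk
  rw [← h1, ← hS1] at h2
  have h3 : ∑ k ∈ S, qForm Q (fun i => partialDeriv g i (x + latticeVec k)) /
      (4 * g (x + latticeVec k)) = (∑ k ∈ S, qForm Q (fun i => partialDeriv g i (x + latticeVec k)) /
      g (x + latticeVec k)) / 4 := by
    rw [Finset.sum_div]
    exact Finset.sum_congr rfl fun k _ => by rw [div_div, mul_comm 4]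
  rw [h3]
  rcases (hp0 x).eq_or_lt with h | h
  · rw [← h]
    simp only [mul_zero, div_zero]
    exact div_nonneg (Finset.sum_nonneg fun k _ => div_nonneg (qForm_nonneg hQ _) (h0 _)) (by norm_num)
  · rw [div_le_iff₀ (by positivity)]
    linarith

theorem sqrt_periodize_sub_sq_le (hg : HasCompactSupport g) (h0 : ∀ x, 0 ≤ g x) (x y : V d) :
    ENNReal.ofReal ((Real.sqrt (periodize g (x + y)) - Real.sqrt (periodize g x)) ^ 2) ≤
      ∑' k, ENNReal.ofReal ((Real.sqrt (g (x + latticeVec k + y)) -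
        Real.sqrt (g (x + latticeVec k))) ^ 2) := by
  obtain ⟨S, hS⟩ := exists_finset_support_periodize hg (max ‖x + y‖ ‖x‖)
  refine le_trans ?_ (ENNReal.sum_le_tsum S)
  rw [← ENNReal.ofReal_sum_of_nonneg fun k _ => sq_nonneg _,
    periodize_eq_sum (hS _ (le_max_left _ _)), periodize_eq_sum (hS _ (le_max_right _ _))]
  refine ENNReal.ofReal_le_ofReal ?_
  simp only [add_right_comm x _ y]
  exact sqrt_sum_sub_sqrt_sum_sq_le S _ _ (fun _ => h0 _) fun _ => h0 _

theorem measurable_jumpDensity [SFinite W] {u : V d → ℝ} (hu : Measurable u) :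
    Measurable fun x => (1 / 2) * ∫⁻ y, ENNReal.ofReal ((u (x + y) - u x) ^ 2) ∂W := by
  have hm : Measurable fun p : V d × V d => ENNReal.ofReal ((u (p.1 + p.2) - u p.1) ^ 2) :=
    (((hu.comp (measurable_fst.add measurable_snd)).sub (hu.comp measurable_fst)).pow_const
      2).ennreal_ofReal
  exact hm.lintegral_prod_right'.const_mul _

theorem measurable_energyDensity [SFinite W] (Q : Matrix (Fin d) (Fin d) ℝ) {u : V d → ℝ}
    (hu : Measurable u) : Measurable (energyDensity Q W u) := by
  have h : energyDensity Q W u = fun x => _ := funext fun x => energyDensity_eq Q W u x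
  rw [h]
  exact ((measurable_qForm_partialDeriv Q u).const_mul _).ennreal_ofReal.add
    (measurable_jumpDensity hu)

theorem torusDirichletForm_periodize_le [SFinite W] (hQ : Q.PosSemidef)
    (hg : HasCompactSupport g) (hg' : ContDiff ℝ ∞ g) (h0 : ∀ x, 0 ≤ g x) :
    torusDirichletForm Q W (fun x => Real.sqrt (periodize g x)) ≤
      dirichletForm Q W (fun x => Real.sqrt (g x)) := by
  have hsq : Measurable fun x => Real.sqrt (g x) :=
    (Real.continuous_sqrt.comp hg'.continuous).measurable
  have hm := measurable_energyDensity (W := W) Q hsq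
  unfold torusDirichletForm dirichletForm
  rw [← tsum_setLIntegral_cube hm, ← lintegral_tsum fun k => by
    exact (hm.comp (measurable_add_const _)).aemeasurable]
  refine lintegral_mono fun x => ?_
  simp only [energyDensity_eq]
  rw [ENNReal.tsum_add]
  refine add_le_add (qForm_periodize_le hQ hg (hg'.differentiable (by simp))
    ((contDiff_periodize hg hg').differentiable (by simp)) h0 x) ?_
  rw [ENNReal.tsum_mul_left, ← lintegral_tsum fun k => by
    refine Measurable.aemeasurable ?_
    exact (((hsq.comp (measurable_const_add _)).sub_const _).pow_const 2).ennreal_ofReal]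
  gcongr with y
  exact sqrt_periodize_sub_sq_le hg h0 x y

variable {F : ℝ≥0 → ℝ≥0} {γ : ℝ}

theorem integralF_periodize_le (hγ0 : 0 ≤ γ) (hγ1 : γ ≤ 1) (hFzero : F 0 = 0)
    (hFhom : ∀ y : ℝ≥0, 0 < y → F y = F 1 * y ^ γ)
    (hg : HasCompactSupport g) (hg' : Measurable g) (h0 : ∀ x, 0 ≤ g x) :
    integralF F (cube d) (periodize g) ≤ integralF F Set.univ g := by
  have hm : Measurable fun x => (F (g x).toNNReal : ℝ≥0∞) :=
    ((homogeneous_measurable hFzero hFhom).comp hg'.real_toNNReal).coe_nnreal_ennreal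
  unfold integralF
  rw [Measure.restrict_univ, ← tsum_setLIntegral_cube hm, ← lintegral_tsum fun k => by
    exact (hm.comp (measurable_add_const _)).aemeasurable]
  refine lintegral_mono fun x => ?_
  obtain ⟨S, hS⟩ := exists_finset_support_periodize hg ‖x‖
  refine le_trans ?_ (ENNReal.sum_le_tsum S)
  rw [periodize_eq_sum (hS x le_rfl), Real.toNNReal_sum_of_nonneg fun k _ => h0 _]
  have := Finset.le_sum_of_subadditive F hFzero.le
    (fun x y => homogeneous_add_le hγ0 hγ1 hFhom x y) S fun k => (g (x + latticeVec k)).toNNReal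
  rw [← ENNReal.ofNNReal_finsetSum]
  exact ENNReal.coe_le_coe.2 this

theorem periodize_mem_torusDensities (hg : g ∈ domainDensities (Set.univ : Set (V d))) :
    periodize g ∈ torusDensities d := by
  have hp0 : ∀ x, 0 ≤ periodize g x := fun x => tsum_nonneg fun k => hg.2.2.2.1 _
  have hc := contDiff_periodize hg.2.1 hg.1
  refine ⟨hc, isPeriodic_periodize g, hp0, ?_⟩
  have hm : Measurable fun x => ENNReal.ofReal (g x) := hg.1.continuous.measurable.ennreal_ofReal
  have h1 : ∫⁻ x in cube d, ENNReal.ofReal (periodize g x) = 1 := by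
    rw [← lintegral_of_mem_domainDensities hg, ← tsum_setLIntegral_cube hm,
      ← lintegral_tsum fun k => by exact (hm.comp (measurable_add_const _)).aemeasurable]
    refine lintegral_congr fun x => ?_
    obtain ⟨S, hS⟩ := exists_finset_support_periodize hg.2.1 ‖x‖
    have hS' := hS x le_rfl
    rw [periodize_eq_sum hS', ENNReal.ofReal_sum_of_nonneg fun k _ => hg.2.2.2.1 _,
      tsum_eq_sum fun k hk => by rw [hS' k hk, ENNReal.ofReal_zero]]
  rw [integral_eq_lintegral_of_nonneg_ae (ae_of_all _ hp0) hc.continuous.aestronglyMeasurable, h1,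
    ENNReal.toReal_one]

/-- For each λ the space constant is also the whole-space infimum at that λ, and periodizing a
competitor lowers both terms. -/
theorem torusConstant_le_spaceConstant {η : Measure (V d)} {E : V d →L[ℝ] V d}
    [IsProbabilityMeasure η] (hη : HasSymmetricTriple η Q W)
    (hE : IsOperatorStable η E) (hγ0 : 0 ≤ γ) (hγ1 : γ ≤ 1) (hFzero : F 0 = 0)
    (hFhom : ∀ y : ℝ≥0, 0 < y → F y = F 1 * y ^ γ) :
    torusConstant Q W E F γ ≤ spaceConstant Q W F := by
  have := hη.levy.sigmaFinite
  refine iSup₂_le fun l hl => ?_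
  rw [spaceConstant_eq_iInf hη hE hFzero hFhom hl]
  refine le_iInf₂ fun g hg => (iInf₂_le _ (periodize_mem_torusDensities hg)).trans ?_
  unfold spaceFunctional
  gcongr
  · exact torusDirichletForm_periodize_le hη.posSemidef hg.2.1 hg.1 hg.2.2.2.1
  · exact integralF_periodize_le hγ0 hγ1 hFzero hFhom hg.2.1 hg.1.continuous.measurable hg.2.2.2.1

end Periodize

/-! ### Cutoff functions -/

/-- A smooth cutoff function supported in the cube. -/
structure IsCutoff (χ : V d → ℝ) : Prop where
  contDiff : ContDiff ℝ ∞ χ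
  hasCompactSupport : HasCompactSupport χ
  tsupport_subset : tsupport χ ⊆ cube d
  nonneg : ∀ x, 0 ≤ χ x
  le_one : ∀ x, χ x ≤ 1

theorem volume_cube_lt_top : volume (cube d) < ⊤ := by
  refine (Metric.isBounded_closedBall (x := (0 : V d)) (r := Real.sqrt d)).subset (fun x hx => ?_)
    |>.measure_lt_top
  rw [mem_closedBall_zero_iff, EuclideanSpace.norm_eq]
  refine Real.sqrt_le_sqrt ?_
  calc ∑ i, ‖x i‖ ^ 2 ≤ ∑ _i : Fin d, (1 : ℝ) := by
        refine Finset.sum_le_sum fun i _ => ?_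
        have := hx i
        rw [Real.norm_eq_abs, sq_abs]
        nlinarith [this.1, this.2]
    _ = d := by simp

/-- There are smooth cutoff functions close to the indicator function of their support. -/
theorem exists_isCutoff {δ : ℝ} (hδ : 0 < δ) :
    ∃ χ : V d → ℝ, IsCutoff χ ∧ 0 < ∫⁻ x, ENNReal.ofReal (χ x ^ 2) ∧
      volume (Function.support χ) ≤
        ENNReal.ofReal (1 + δ) * ∫⁻ x, ENNReal.ofReal (χ x ^ 2) := by
  let U : Set (V d) := interior (cube d)
  have hU : IsOpen U := isOpen_interior
  have hUfin : volume U < ⊤ := (measure_mono interior_subset).trans_lt volume_cube_lt_top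
  have h0 : (0 : V d) ∈ U := by
    have hs : {x : V d | ∀ i, x i ∈ Set.Ioo (-(1 / 2) : ℝ) (1 / 2)} ⊆ cube d :=
      fun x hx i => Set.Ioo_subset_Ico_self (hx i)
    have ho : IsOpen {x : V d | ∀ i, x i ∈ Set.Ioo (-(1 / 2) : ℝ) (1 / 2)} := by
      have : {x : V d | ∀ i, x i ∈ Set.Ioo (-(1 / 2) : ℝ) (1 / 2)} =
          ⋂ i, (fun x : V d => x i) ⁻¹' Set.Ioo (-(1 / 2) : ℝ) (1 / 2) := by
        ext x
        simp
      rw [this]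
      exact isOpen_iInter_of_finite fun i => isOpen_Ioo.preimage (by fun_prop)
    refine interior_maximal hs ho ?_
    intro i
    simp
  have hUpos : 0 < volume U := hU.measure_pos volume ⟨0, h0⟩
  have hδ1 : (1 : ℝ) < 1 + δ := by linarith
  have hlt : volume U / ENNReal.ofReal (1 + δ) < volume U := by
    rw [ENNReal.div_lt_iff (Or.inl (by simp; linarith)) (Or.inl ENNReal.ofReal_ne_top)]
    conv_lhs => rw [← mul_one (volume U)]
    rw [ENNReal.mul_lt_mul_iff_right hUpos.ne' hUfin.ne]
    simpa using hδ1
  -- Inner regularity gives a compact K filling U up to the factor 1 + δ. Since χ = 1 on K and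
  -- vanishes off U, vol K ≤ ∫χ² while the support has volume at most vol U.
  obtain ⟨K, hKU, hK, hKlt⟩ := hU.exists_lt_isCompact hlt
  obtain ⟨K', hK', hKK', hK'U⟩ := exists_compact_between hK hU hKU
  obtain ⟨χ, hχ0, hχ1, hχ⟩ := exists_contMDiffMap_zero_one_of_isClosed (n := ⊤)
    (modelWithCornersSelf ℝ (V d)) (isOpen_interior (s := K')).isClosed_compl hK.isClosed
    (Set.disjoint_left.2 fun x hx hxK => hx (hKK' hxK))
  have hsupp : Function.support χ ⊆ K' := by
    intro x hx
    by_contra hxK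
    exact hx (hχ0 fun h => hxK (interior_subset h))
  have htsupp : tsupport χ ⊆ K' := closure_minimal hsupp hK'.isClosed
  have hle : volume K ≤ ∫⁻ x, ENNReal.ofReal (χ x ^ 2) := by
    rw [← lintegral_indicator_one hK.measurableSet]
    refine lintegral_mono fun x => ?_
    by_cases hx : x ∈ K
    · rw [Set.indicator_of_mem hx, hχ1 hx]
      simp
    · rw [Set.indicator_of_notMem hx]
      exact zero_le
  refine ⟨χ, ⟨χ.contMDiff.contDiff, hK'.of_isClosed_subset (isClosed_tsupport _) htsupp,
    (htsupp.trans hK'U).trans interior_subset, fun x => (hχ x).1, fun x => (hχ x).2⟩, ?_, ?_⟩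
  · exact (zero_le.trans_lt hKlt).trans_le hle
  · calc volume (Function.support χ) ≤ volume U := measure_mono (hsupp.trans hK'U)
      _ ≤ ENNReal.ofReal (1 + δ) * volume K := by
        rw [mul_comm]
        exact (ENNReal.div_le_iff (by simp; linarith) ENNReal.ofReal_ne_top).1 hKlt.le
      _ ≤ _ := by gcongr

theorem IsCutoff.lintegral_sq_lt_top {χ : V d → ℝ} (hχ : IsCutoff χ) :
    ∫⁻ x, ENNReal.ofReal (χ x ^ 2) < ⊤ := by
  have h1 : Continuous fun x => χ x ^ 2 := hχ.contDiff.continuous.pow 2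
  exact (h1.integrable_of_hasCompactSupport
    (hχ.hasCompactSupport.comp_left (g := fun a : ℝ => a ^ 2) (by simp))).lintegral_lt_top

theorem IsCutoff.gradEnergy_lt_top {χ : V d → ℝ} (hχ : IsCutoff χ)
    (Q : Matrix (Fin d) (Fin d) ℝ) : gradEnergy Q χ < ⊤ := by
  have h1 : ∀ i, Continuous (partialDeriv χ i) := fun i =>
    (hχ.contDiff.continuous_fderiv (by simp)).clm_apply continuous_const
  have h2 : Continuous fun x => (1 / 2) * qForm Q (fun i => partialDeriv χ i x) := by
    unfold qForm
    fun_prop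
  have h3 : HasCompactSupport fun x => (1 / 2) * qForm Q (fun i => partialDeriv χ i x) := by
    refine HasCompactSupport.mul_left ?_
    refine HasCompactSupport.intro hχ.hasCompactSupport fun x hx => ?_
    have : fderiv ℝ χ x = 0 := by
      by_contra h
      exact hx (support_fderiv_subset ℝ (f := χ) h)
    simp [qForm, partialDeriv, this]
  exact (h2.integrable_of_hasCompactSupport h3).lintegral_lt_top

/-- Squared increments are at most a multiple of min(1, ‖y‖²), as χ is Lipschitz with values in
[0,1], and they vanish unless x or x + y lies in the support. Integrability of the Lévy measure does
the rest. -/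
theorem IsCutoff.jumpEnergy_lt_top {χ : V d → ℝ} (hχ : IsCutoff χ) {W : Measure (V d)}
    (hW : IsLevyMeasure W) : jumpEnergy W χ < ⊤ := by
  have := hW.sigmaFinite
  obtain ⟨C, hC⟩ := ContDiff.lipschitzWith_of_hasCompactSupport hχ.hasCompactSupport
    hχ.contDiff (by simp)
  rw [jumpEnergy_eq_lintegral hχ.contDiff.continuous.measurable]
  set K := tsupport χ
  have hK : MeasurableSet K := (isClosed_tsupport χ).measurableSet
  have hKfin : volume K < ⊤ := hχ.hasCompactSupport.measure_lt_top
  have hpt : ∀ x y : V d, (χ (x + y) - χ x) ^ 2 ≤ (1 + (C : ℝ) ^ 2) * min 1 (‖y‖ ^ 2) := by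
    intro x y
    have h1 : (χ (x + y) - χ x) ^ 2 ≤ 1 :=
      (sq_le_one_iff_abs_le_one _).2 (abs_le.2 ⟨by linarith [hχ.nonneg (x + y), hχ.le_one x],
        by linarith [hχ.nonneg x, hχ.le_one (x + y)]⟩)
    have h2 : (χ (x + y) - χ x) ^ 2 ≤ (C : ℝ) ^ 2 * ‖y‖ ^ 2 := by
      have := hC.dist_le_mul (x + y) x
      rw [Real.dist_eq, dist_eq_norm, add_sub_cancel_left] at this
      rw [← sq_abs, ← mul_pow]
      gcongr
    rcases le_total 1 (‖y‖ ^ 2) with h | h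
    · rw [min_eq_left h]
      nlinarith [sq_nonneg (C : ℝ)]
    · rw [min_eq_right h]
      nlinarith [sq_nonneg ‖y‖]
  have hy : ∀ y : V d, ∫⁻ x, ENNReal.ofReal ((χ (x + y) - χ x) ^ 2) ≤
      ENNReal.ofReal ((1 + (C : ℝ) ^ 2) * min 1 (‖y‖ ^ 2)) * (2 * volume K) := by
    intro y
    calc ∫⁻ x, ENNReal.ofReal ((χ (x + y) - χ x) ^ 2)
        ≤ ∫⁻ x, ENNReal.ofReal ((1 + (C : ℝ) ^ 2) * min 1 (‖y‖ ^ 2)) *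
            (K.indicator 1 (x + y) + K.indicator 1 x) := by
          refine lintegral_mono fun x => ?_
          by_cases h : x + y ∈ K ∨ x ∈ K
          · refine (ENNReal.ofReal_le_ofReal (hpt x y)).trans ?_
            refine le_mul_of_one_le_right zero_le ?_
            rcases h with h | h
            · simp [h]
            · simp [h]
          · push Not at h
            rw [image_eq_zero_of_notMem_tsupport h.1, image_eq_zero_of_notMem_tsupport h.2]
            simp
      _ = _ := by
          rw [lintegral_const_mul' _ _ ENNReal.ofReal_ne_top, lintegral_add_right _
            (measurable_one.indicator hK), lintegral_add_right_eq_self (μ := volume)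
            (fun x => K.indicator (1 : V d → ℝ≥0∞) x) y, lintegral_indicator_one hK, two_mul]
  refine (lintegral_mono fun y => mul_le_mul_right (hy y) _).trans_lt ?_
  have h2 : ∀ y : V d, (1 / 2 : ℝ≥0∞) * (ENNReal.ofReal ((1 + (C : ℝ) ^ 2) * min 1 (‖y‖ ^ 2)) *
      (2 * volume K)) = ENNReal.ofReal (min 1 (‖y‖ ^ 2)) *
        (ENNReal.ofReal (1 + (C : ℝ) ^ 2) * (1 / 2 * (2 * volume K))) := by
    intro y
    rw [ENNReal.ofReal_mul (by positivity)]
    ring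
  simp only [h2]
  have hne : ENNReal.ofReal (1 + (C : ℝ) ^ 2) * (1 / 2 * (2 * volume K)) ≠ ⊤ := by
    finiteness
  rw [lintegral_mul_const' _ _ hne]
  exact ENNReal.mul_lt_top hW.lintegral_lt_top hne.lt_top

theorem IsCutoff.dirichletForm_lt_top {χ : V d → ℝ} (hχ : IsCutoff χ)
    (Q : Matrix (Fin d) (Fin d) ℝ) {W : Measure (V d)} (hW : IsLevyMeasure W) :
    dirichletForm Q W χ < ⊤ := by
  rw [dirichletForm_eq_add]
  exact ENNReal.add_lt_top.2 ⟨hχ.gradEnergy_lt_top Q, hχ.jumpEnergy_lt_top hW⟩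

theorem dirichletForm_const_mul (Q : Matrix (Fin d) (Fin d) ℝ) (W : Measure (V d)) (c : ℝ)
    (u : V d → ℝ) :
    dirichletForm Q W (fun x => c * u x) = ENNReal.ofReal (c ^ 2) * dirichletForm Q W u := by
  unfold dirichletForm
  rw [← lintegral_const_mul' _ _ ENNReal.ofReal_ne_top]
  refine lintegral_congr fun x => ?_
  have h1 : (fun i => partialDeriv (fun x => c * u x) i x) = c • fun i => partialDeriv u i x := by
    ext i
    have e1 : fderiv ℝ (fun x => c * u x) x = c • fderiv ℝ u x :=
      congrFun (fderiv_const_smul_field (𝕜 := ℝ) (f := u) c) x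
    rw [partialDeriv, e1]
    rfl
  have h2 : ∀ y, ENNReal.ofReal ((c * u (x + y) - c * u x) ^ 2) =
      ENNReal.ofReal (c ^ 2) * ENNReal.ofReal ((u (x + y) - u x) ^ 2) := by
    intro y
    rw [← ENNReal.ofReal_mul (sq_nonneg c)]
    congr 1
    ring
  simp only [energyDensity_eq, h1, h2, qForm_smul]
  rw [lintegral_const_mul' _ _ ENNReal.ofReal_ne_top, mul_left_comm,
    ENNReal.ofReal_mul (sq_nonneg c)]
  ring

/-! ### Localization -/

/-- Young's inequality with an uneven weight: the main term loses only 1 + δ, and the large factor 1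
+ δ⁻¹ falls on the cutoff term, later suppressed by λ⁻¹. -/
theorem add_sq_le_mul_add {δ : ℝ} (hδ : 0 < δ) (a b : ℝ) :
    (a + b) ^ 2 ≤ (1 + δ) * a ^ 2 + (1 + δ⁻¹) * b ^ 2 := by
  have h : (1 + δ) * a ^ 2 + (1 + δ⁻¹) * b ^ 2 - (a + b) ^ 2 = δ⁻¹ * (δ * a - b) ^ 2 := by
    field_simp
    ring
  have : 0 ≤ δ⁻¹ * (δ * a - b) ^ 2 := by positivity
  linarith

theorem qForm_add_le {Q : Matrix (Fin d) (Fin d) ℝ} (hQ : Q.PosSemidef) {δ : ℝ} (hδ : 0 < δ)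
    (p q : Fin d → ℝ) :
    qForm Q (p + q) ≤ (1 + δ) * qForm Q p + (1 + δ⁻¹) * qForm Q q := by
  obtain ⟨v, hv⟩ := exists_qForm_eq_sum_sq hQ
  simp only [hv, Finset.mul_sum, ← Finset.sum_add_distrib, Pi.add_apply, mul_add]
  refine Finset.sum_le_sum fun j _ => ?_
  rw [Finset.sum_add_distrib]
  exact add_sq_le_mul_add hδ _ _

/-- The density `f` multiplied by the square of a translated cutoff function. -/
def localize (f χ : V d → ℝ) (z x : V d) : ℝ := f x * χ (x - z) ^ 2

section Localize

variable {Q : Matrix (Fin d) (Fin d) ℝ} {W : Measure (V d)} {f χ : V d → ℝ}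

theorem localize_nonneg (h0 : ∀ x, 0 ≤ f x) (z x : V d) : 0 ≤ localize f χ z x :=
  mul_nonneg (h0 x) (sq_nonneg _)

theorem sqrt_localize (h0 : ∀ x, 0 ≤ f x) (hχ : ∀ x, 0 ≤ χ x) (z x : V d) :
    Real.sqrt (localize f χ z x) = Real.sqrt (f x) * χ (x - z) := by
  rw [localize, Real.sqrt_mul (h0 x), Real.sqrt_sq (hχ _)]

/-- Where f > 0 this is the Leibniz rule for √f · χ followed by Young's inequality. Where f = 0 the
localized root is minimal, so its derivative contributes nothing. -/
theorem qForm_localize_le (hQ : Q.PosSemidef) {δ : ℝ} (hδ : 0 < δ) (hf : Differentiable ℝ f)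
    (h0 : ∀ x, 0 ≤ f x) (hχ : Differentiable ℝ χ) (hχ0 : ∀ x, 0 ≤ χ x) (z x : V d) :
    qForm Q (fun i => partialDeriv (fun x => Real.sqrt (localize f χ z x)) i x) ≤
      (1 + δ) * (χ (x - z) ^ 2 * qForm Q (fun i => partialDeriv (fun x => Real.sqrt (f x)) i x)) +
        (1 + δ⁻¹) * (qForm Q (fun i => partialDeriv χ i (x - z)) * f x) := by
  rcases (h0 x).eq_or_lt with h | h
  · have h1 : (fun i => partialDeriv (fun x => Real.sqrt (localize f χ z x)) i x) = 0 := by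
      ext i
      exact partialDeriv_eq_zero (fun x => Real.sqrt_nonneg _) i (by simp [localize, ← h])
    have h2 := qForm_nonneg hQ (fun i => partialDeriv (fun x => Real.sqrt (f x)) i x)
    have h3 := qForm_nonneg hQ (fun i => partialDeriv χ i (x - z))
    have h4 : qForm Q (0 : Fin d → ℝ) = 0 := by simp [qForm]
    rw [h1, h4, ← h]
    positivity
  · have h1 : (fun i => partialDeriv (fun x => Real.sqrt (localize f χ z x)) i x) =
        (χ (x - z) • fun i => partialDeriv (fun x => Real.sqrt (f x)) i x) +
          Real.sqrt (f x) • fun i => partialDeriv χ i (x - z) := by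
      ext i
      have e1 : HasFDerivAt (fun x => Real.sqrt (f x)) (fderiv ℝ (fun x => Real.sqrt (f x)) x) x :=
        (((hf x).hasFDerivAt.sqrt h.ne').differentiableAt).hasFDerivAt
      have e2 : HasFDerivAt (fun x => χ (x - z)) (fderiv ℝ χ (x - z)) x :=
        (hasFDerivAt_comp_sub _).2 (hχ (x - z)).hasFDerivAt
      have e3 := e1.mul e2
      have e4 : (fun x => Real.sqrt (localize f χ z x)) =
          (fun x => Real.sqrt (f x)) * fun x => χ (x - z) :=
        funext fun x => sqrt_localize h0 hχ0 z x
      rw [partialDeriv, e4, e3.fderiv]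
      simp [partialDeriv]
      ring
    rw [h1]
    refine (qForm_add_le hQ hδ _ _).trans_eq ?_
    rw [qForm_smul, qForm_smul, Real.sq_sqrt (h0 x)]
    ring

/-- Unfolding of a convolution of a periodic function. -/
theorem setLIntegral_cube_lintegral_mul {a b : V d → ℝ≥0∞} (ha : Measurable a) (hb : Measurable b)
    (hper : ∀ (k : Fin d → ℤ) (x : V d), b (x + latticeVec k) = b x) :
    ∫⁻ z in cube d, ∫⁻ x, a (x - z) * b x = (∫⁻ x, a x) * ∫⁻ x in cube d, b x := by
  have h1 : ∀ z : V d, ∫⁻ x, a (x - z) * b x = ∫⁻ x, a x * b (z + x) := by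
    intro z
    rw [← lintegral_add_right_eq_self (μ := volume) (fun x => a (x - z) * b x) z]
    exact lintegral_congr fun x => by rw [add_sub_cancel_right, add_comm x z]
  simp only [h1]
  rw [lintegral_lintegral_swap (by unfold Function.uncurry; fun_prop), ← lintegral_mul_const _ ha]
  refine lintegral_congr fun x => ?_
  rw [lintegral_const_mul _ (by fun_prop), setLIntegral_cube_add hb hper]

theorem periodic_partialDeriv {u : V d → ℝ} (hu : IsPeriodic u) (i : Fin d) (k : Fin d → ℤ)
    (x : V d) : partialDeriv u i (x + latticeVec k) = partialDeriv u i x := by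
  rw [← partialDeriv_comp_add]
  congr 1
  ext y
  exact hu.add_latticeVec k y

theorem IsPeriodic.comp {u : V d → ℝ} (hu : IsPeriodic u) (g : ℝ → ℝ) :
    IsPeriodic fun x => g (u x) := fun i x => congrArg g (hu i x)

theorem lintegral_of_mem_torusDensities (hf : f ∈ torusDensities d) :
    ∫⁻ x in cube d, ENNReal.ofReal (f x) = 1 := by
  have hint : IntegrableOn f (cube d) := by
    by_contra h
    have := hf.2.2.2
    rw [integral_undef h] at this
    exact zero_ne_one this
  rw [← ofReal_integral_eq_lintegral_ofReal hint (ae_of_all _ hf.2.2.1), hf.2.2.2,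
    ENNReal.ofReal_one]

/-- Averaging over z decouples cutoff and density: each convolution with a periodic function becomes
a product of integrals. The measurable majorant G avoids having to prove the energy itself
measurable in z. -/
theorem lintegral_gradEnergy_localize_le (hQ : Q.PosSemidef) {δ : ℝ} (hδ : 0 < δ)
    (hf : f ∈ torusDensities d) (hχ : IsCutoff χ) :
    ∃ G : V d → ℝ≥0∞, Measurable G ∧
      (∀ z, gradEnergy Q (fun x => Real.sqrt (localize f χ z x)) ≤ G z) ∧
      ∫⁻ z in cube d, G z = ENNReal.ofReal (1 + δ) * ((∫⁻ x, ENNReal.ofReal (χ x ^ 2)) *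
        ∫⁻ x in cube d, ENNReal.ofReal ((1 / 2) *
          qForm Q (fun i => partialDeriv (fun x => Real.sqrt (f x)) i x))) +
        ENNReal.ofReal (1 + δ⁻¹) * gradEnergy Q χ := by
  have hδ' : 0 < δ⁻¹ := inv_pos.2 hδ
  let a₁ : V d → ℝ≥0∞ := fun x => ENNReal.ofReal (χ x ^ 2)
  let b₁ : V d → ℝ≥0∞ := fun x => ENNReal.ofReal ((1 / 2) *
    qForm Q (fun i => partialDeriv (fun x => Real.sqrt (f x)) i x))
  let a₂ : V d → ℝ≥0∞ := fun x => ENNReal.ofReal ((1 / 2) * qForm Q (fun i => partialDeriv χ i x))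
  let b₂ : V d → ℝ≥0∞ := fun x => ENNReal.ofReal (f x)
  have ha₁ : Measurable a₁ := (hχ.contDiff.continuous.measurable.pow_const 2).ennreal_ofReal
  have hb₁ : Measurable b₁ := ((measurable_qForm_partialDeriv Q _).const_mul _).ennreal_ofReal
  have ha₂ : Measurable a₂ := ((measurable_qForm_partialDeriv Q _).const_mul _).ennreal_ofReal
  have hb₂ : Measurable b₂ := hf.1.continuous.measurable.ennreal_ofReal
  have hm : ∀ a b : V d → ℝ≥0∞, Measurable a → Measurable b →
      Measurable fun z : V d => ∫⁻ x, a (x - z) * b x := fun a b ha hb => by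
    refine Measurable.lintegral_prod_right' (f := fun p : V d × V d => a (p.2 - p.1) * b p.2) ?_
    fun_prop
  refine ⟨fun z => ENNReal.ofReal (1 + δ) * (∫⁻ x, a₁ (x - z) * b₁ x) +
    ENNReal.ofReal (1 + δ⁻¹) * ∫⁻ x, a₂ (x - z) * b₂ x,
    ((hm _ _ ha₁ hb₁).const_mul _).add ((hm _ _ ha₂ hb₂).const_mul _), fun z => ?_, ?_⟩
  · have m1 : Measurable fun x => a₁ (x - z) * b₁ x := by fun_prop
    have m2 : Measurable fun x => a₂ (x - z) * b₂ x := by fun_prop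
    beta_reduce
    rw [← lintegral_const_mul _ m1, ← lintegral_const_mul _ m2,
      ← lintegral_add_left (m1.const_mul _)]
    refine lintegral_mono fun x => ?_
    have h1 := qForm_nonneg hQ (fun i => partialDeriv (fun x => Real.sqrt (f x)) i x)
    have h2 := qForm_nonneg hQ (fun i => partialDeriv χ i (x - z))
    have h3 := hf.2.2.1 x
    simp only [a₁, b₁, a₂, b₂]
    rw [← ENNReal.ofReal_mul (by positivity), ← ENNReal.ofReal_mul (by positivity),
      ← ENNReal.ofReal_mul (by positivity), ← ENNReal.ofReal_mul (by positivity),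
      ← ENNReal.ofReal_add (by positivity) (by positivity)]
    refine ENNReal.ofReal_le_ofReal ?_
    have := qForm_localize_le hQ hδ (hf.1.differentiable (by simp)) hf.2.2.1
      (hχ.contDiff.differentiable (by simp)) hχ.nonneg z x
    linarith
  · rw [lintegral_add_left ((hm _ _ ha₁ hb₁).const_mul _), lintegral_const_mul _ (hm _ _ ha₁ hb₁),
      lintegral_const_mul _ (hm _ _ ha₂ hb₂), setLIntegral_cube_lintegral_mul ha₁ hb₁,
      setLIntegral_cube_lintegral_mul ha₂ hb₂, lintegral_of_mem_torusDensities hf, mul_one]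
    · rfl
    · intro k x
      simp only [b₂, hf.2.1.add_latticeVec]
    · intro k x
      simp only [b₁, periodic_partialDeriv (hf.2.1.comp Real.sqrt)]

/-- A symmetric discrete Leibniz rule, as - bt = (a - b)(s + t)/2 + (a + b)(s - t)/2, then Young's
inequality and convexity of the square. -/
theorem sqrt_localize_sub_sq_le {δ : ℝ} (hδ : 0 < δ) (h0 : ∀ x, 0 ≤ f x) (hχ0 : ∀ x, 0 ≤ χ x)
    (x y z : V d) :
    (Real.sqrt (localize f χ z (x + y)) - Real.sqrt (localize f χ z x)) ^ 2 ≤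
      (1 + δ) * (1 / 2) * ((χ (x - z + y) ^ 2 + χ (x - z) ^ 2) *
        (Real.sqrt (f (x + y)) - Real.sqrt (f x)) ^ 2) +
      (1 + δ⁻¹) * (1 / 2) * ((χ (x - z + y) - χ (x - z)) ^ 2 * (f (x + y) + f x)) := by
  rw [sqrt_localize h0 hχ0, sqrt_localize h0 hχ0]
  have hxy : x + y - z = x - z + y := by abel
  have e1 := Real.sq_sqrt (h0 (x + y))
  have e2 := Real.sq_sqrt (h0 x)
  rw [hxy]
  set a := Real.sqrt (f (x + y))
  set b := Real.sqrt (f x)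
  set s := χ (x - z + y)
  set t := χ (x - z)
  rw [← e1, ← e2]
  have h1 := add_sq_le_mul_add hδ ((a - b) * ((s + t) / 2)) ((a + b) / 2 * (s - t))
  have h2 : a * s - b * t = (a - b) * ((s + t) / 2) + (a + b) / 2 * (s - t) := by ring
  have h3 : ((a - b) * ((s + t) / 2)) ^ 2 ≤ 1 / 2 * ((s ^ 2 + t ^ 2) * (a - b) ^ 2) := by
    rw [mul_pow]
    nlinarith [mul_nonneg (sq_nonneg (a - b)) (sq_nonneg (s - t))]
  have h4 : ((a + b) / 2 * (s - t)) ^ 2 ≤ 1 / 2 * ((s - t) ^ 2 * (a ^ 2 + b ^ 2)) := by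
    rw [mul_pow]
    nlinarith [mul_nonneg (sq_nonneg (a - b)) (sq_nonneg (s - t))]
  have hδ' : 0 < δ⁻¹ := inv_pos.2 hδ
  rw [h2]
  refine h1.trans ?_
  rw [mul_assoc, mul_assoc]
  gcongr

theorem lintegral_jumpEnergy_localize_le [SFinite W] {δ : ℝ} (hδ : 0 < δ)
    (hf : f ∈ torusDensities d) (hχ : IsCutoff χ) :
    ∃ G : V d → ℝ≥0∞, Measurable G ∧
      (∀ z, jumpEnergy W (fun x => Real.sqrt (localize f χ z x)) ≤ G z) ∧
      ∫⁻ z in cube d, G z = ENNReal.ofReal (1 + δ) * ((∫⁻ x, ENNReal.ofReal (χ x ^ 2)) *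
        ∫⁻ x in cube d, (1 / 2) * ∫⁻ y, ENNReal.ofReal
          ((Real.sqrt (f (x + y)) - Real.sqrt (f x)) ^ 2) ∂W) +
        ENNReal.ofReal (1 + δ⁻¹) * jumpEnergy W χ := by
  have hδ' : 0 < δ⁻¹ := inv_pos.2 hδ
  let a₁ : V d → V d → ℝ≥0∞ := fun y x =>
    ENNReal.ofReal (χ (x + y) ^ 2) + ENNReal.ofReal (χ x ^ 2)
  let b₁ : V d → V d → ℝ≥0∞ := fun y x =>
    ENNReal.ofReal ((Real.sqrt (f (x + y)) - Real.sqrt (f x)) ^ 2)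
  let a₂ : V d → V d → ℝ≥0∞ := fun y x => ENNReal.ofReal ((χ (x + y) - χ x) ^ 2)
  let b₂ : V d → V d → ℝ≥0∞ := fun y x => ENNReal.ofReal (f (x + y)) + ENNReal.ofReal (f x)
  have hfm : Measurable f := hf.1.continuous.measurable
  have hχm : Measurable χ := hχ.contDiff.continuous.measurable
  have hum : Measurable fun x => Real.sqrt (f x) :=
    (Real.continuous_sqrt.comp hf.1.continuous).measurable
  have ha₁ : Measurable fun p : V d × V d => a₁ p.1 p.2 := by fun_prop
  have hb₁ : Measurable fun p : V d × V d => b₁ p.1 p.2 := by fun_prop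
  have ha₂ : Measurable fun p : V d × V d => a₂ p.1 p.2 := by fun_prop
  have hb₂ : Measurable fun p : V d × V d => b₂ p.1 p.2 := by fun_prop
  have hs : ∀ {a : V d → V d → ℝ≥0∞}, (Measurable fun p : V d × V d => a p.1 p.2) →
      ∀ y, Measurable (a y) := fun h y => h.comp measurable_prodMk_left
  have hm : ∀ {a b : V d → V d → ℝ≥0∞}, (Measurable fun p : V d × V d => a p.1 p.2) →
      (Measurable fun p : V d × V d => b p.1 p.2) →
      Measurable fun q : V d × V d => ∫⁻ x, a q.2 (x - q.1) * b q.2 x := fun {a b} ha hb => by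
    refine Measurable.lintegral_prod_right'
      (f := fun p : (V d × V d) × V d => a p.1.2 (p.2 - p.1.1) * b p.1.2 p.2) ?_
    have h1 : Measurable fun p : (V d × V d) × V d => (p.1.2, p.2 - p.1.1) := by fun_prop
    have h2 : Measurable fun p : (V d × V d) × V d => (p.1.2, p.2) := by fun_prop
    exact (ha.comp h1).mul (hb.comp h2)
  let B : V d → V d → ℝ≥0∞ := fun z y =>
    ENNReal.ofReal ((1 + δ) * (1 / 2)) * (∫⁻ x, a₁ y (x - z) * b₁ y x) +
      ENNReal.ofReal ((1 + δ⁻¹) * (1 / 2)) * ∫⁻ x, a₂ y (x - z) * b₂ y x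
  have hB : Measurable fun q : V d × V d => (1 / 2) * B q.1 q.2 :=
    (((hm ha₁ hb₁).const_mul _).add ((hm ha₂ hb₂).const_mul _)).const_mul _
  refine ⟨fun z => ∫⁻ y, (1 / 2) * B z y ∂W, hB.lintegral_prod_right', fun z => ?_, ?_⟩
  · have hlm : Measurable fun x => Real.sqrt (localize f χ z x) := by
      unfold localize
      exact Real.continuous_sqrt.measurable.comp
        (hfm.mul ((hχm.comp (measurable_sub_const z)).pow_const 2))
    rw [jumpEnergy_eq_lintegral hlm]
    refine lintegral_mono fun y => mul_le_mul_right ?_ _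
    have m1 : Measurable fun x => a₁ y (x - z) * b₁ y x :=
      ((hs ha₁ y).comp (measurable_sub_const z)).mul (hs hb₁ y)
    have m2 : Measurable fun x => a₂ y (x - z) * b₂ y x :=
      ((hs ha₂ y).comp (measurable_sub_const z)).mul (hs hb₂ y)
    simp only [B]
    rw [← lintegral_const_mul _ m1, ← lintegral_const_mul _ m2,
      ← lintegral_add_left (m1.const_mul _)]
    refine lintegral_mono fun x => ?_
    have h3 := hf.2.2.1 x
    have h4 := hf.2.2.1 (x + y)
    simp only [a₁, b₁, a₂, b₂]
    rw [← ENNReal.ofReal_add (by positivity) (by positivity), ← ENNReal.ofReal_add h4 h3,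
      ← ENNReal.ofReal_mul (by positivity), ← ENNReal.ofReal_mul (by positivity),
      ← ENNReal.ofReal_mul (by positivity), ← ENNReal.ofReal_mul (by positivity),
      ← ENNReal.ofReal_add (by positivity) (by positivity)]
    exact ENNReal.ofReal_le_ofReal (sqrt_localize_sub_sq_le hδ hf.2.2.1 hχ.nonneg x y z)
  · rw [lintegral_lintegral_swap hB.aemeasurable]
    have hper : ∀ (k : Fin d → ℤ) (x y : V d), f (x + latticeVec k + y) = f (x + y) := by
      intro k x y
      rw [add_right_comm, hf.2.1.add_latticeVec]
    have hcube := lintegral_of_mem_torusDensities hf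
    -- The factors 1/2 from the symmetric Leibniz rule cancel the 2 arising because x and x + y
    -- contribute equally to ∫a₁ and ∫b₂.
    have hhalf : ∀ c : ℝ, 0 ≤ c → ∀ t : ℝ≥0∞,
        ENNReal.ofReal (c * (1 / 2)) * (2 * t) = ENNReal.ofReal c * t := by
      intro c hc t
      rw [← mul_assoc]
      congr 1
      rw [← ENNReal.ofReal_ofNat 2, ← ENNReal.ofReal_mul (by positivity)]
      congr 1
      ring
    have hsec : ∀ y : V d, Measurable fun z : V d => (z, y) := fun y => measurable_prodMk_right
    have hBy : ∀ y, ∫⁻ z in cube d, B z y =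
        ENNReal.ofReal (1 + δ) * ((∫⁻ x, ENNReal.ofReal (χ x ^ 2)) * ∫⁻ x in cube d, b₁ y x) +
          ENNReal.ofReal (1 + δ⁻¹) * ∫⁻ x, a₂ y x := by
      intro y
      have m1 : Measurable fun z => ∫⁻ x, a₁ y (x - z) * b₁ y x := by
        have := (hm ha₁ hb₁).comp (hsec y)
        exact this
      have m2 : Measurable fun z => ∫⁻ x, a₂ y (x - z) * b₂ y x := by
        have := (hm ha₂ hb₂).comp (hsec y)
        exact this
      have i1 : ∫⁻ x, a₁ y x = 2 * ∫⁻ x, ENNReal.ofReal (χ x ^ 2) := by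
        simp only [a₁]
        rw [lintegral_add_right _ (by fun_prop), lintegral_add_right_eq_self (μ := volume)
          (fun x => ENNReal.ofReal (χ x ^ 2)) y, two_mul]
      have i2 : ∫⁻ x in cube d, b₂ y x = 2 := by
        simp only [b₂]
        rw [lintegral_add_right _ (by fun_prop), setLIntegral_cube_add hfm.ennreal_ofReal
          (fun k x => by rw [hf.2.1.add_latticeVec]) y, hcube, one_add_one_eq_two]
      have j1 : ∫⁻ z in cube d, ∫⁻ x, a₁ y (x - z) * b₁ y x =
          (∫⁻ x, a₁ y x) * ∫⁻ x in cube d, b₁ y x :=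
        setLIntegral_cube_lintegral_mul (hs ha₁ y) (hs hb₁ y) fun k x => by
          simp only [b₁, hf.2.1.add_latticeVec, hper]
      have j2 : ∫⁻ z in cube d, ∫⁻ x, a₂ y (x - z) * b₂ y x =
          (∫⁻ x, a₂ y x) * ∫⁻ x in cube d, b₂ y x :=
        setLIntegral_cube_lintegral_mul (hs ha₂ y) (hs hb₂ y) fun k x => by
          simp only [b₂, hf.2.1.add_latticeVec, hper]
      calc ∫⁻ z in cube d, B z y
          = ENNReal.ofReal ((1 + δ) * (1 / 2)) *
              (∫⁻ z in cube d, ∫⁻ x, a₁ y (x - z) * b₁ y x) +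
            ENNReal.ofReal ((1 + δ⁻¹) * (1 / 2)) *
              ∫⁻ z in cube d, ∫⁻ x, a₂ y (x - z) * b₂ y x := by
            rw [← lintegral_const_mul _ m1, ← lintegral_const_mul _ m2,
              ← lintegral_add_left (m1.const_mul _)]
        _ = ENNReal.ofReal ((1 + δ) * (1 / 2)) * (2 * ((∫⁻ x, ENNReal.ofReal (χ x ^ 2)) *
              ∫⁻ x in cube d, b₁ y x)) +
            ENNReal.ofReal ((1 + δ⁻¹) * (1 / 2)) * (2 * ∫⁻ x, a₂ y x) := by
            rw [j1, j2, i1, i2, mul_assoc 2, mul_comm _ (2 : ℝ≥0∞)]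
        _ = _ := by rw [hhalf _ (by positivity), hhalf _ (by positivity)]
    have hBm : ∀ y, Measurable fun z => B z y := fun y => by
      have := (((hm ha₁ hb₁).const_mul (ENNReal.ofReal ((1 + δ) * (1 / 2)))).add
        ((hm ha₂ hb₂).const_mul (ENNReal.ofReal ((1 + δ⁻¹) * (1 / 2))))).comp (hsec y)
      exact this
    have hb₁' : Measurable fun y => ∫⁻ x in cube d, b₁ y x := hb₁.lintegral_prod_right'
    have ha₂' : Measurable fun y => ∫⁻ x, a₂ y x := ha₂.lintegral_prod_right'
    have e1 : ∀ y, ∫⁻ z in cube d, (1 / 2) * B z y =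
        ENNReal.ofReal (1 + δ) * ((∫⁻ x, ENNReal.ofReal (χ x ^ 2)) *
          ((1 / 2) * ∫⁻ x in cube d, b₁ y x)) +
          ENNReal.ofReal (1 + δ⁻¹) * ((1 / 2) * ∫⁻ x, a₂ y x) := by
      intro y
      rw [lintegral_const_mul _ (hBm y), hBy]
      ring
    simp only [e1]
    rw [lintegral_add_left (((hb₁'.const_mul _).const_mul _).const_mul _),
      lintegral_const_mul _ ((hb₁'.const_mul _).const_mul _),
      lintegral_const_mul _ (hb₁'.const_mul _), lintegral_const_mul _ hb₁',
      lintegral_const_mul _ (ha₂'.const_mul _), jumpEnergy_eq_lintegral hχm,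
      lintegral_const_mul _ hb₁.lintegral_prod_left', lintegral_lintegral_swap hb₁.aemeasurable]

end Localize

/-! ### The whole-space constant is at most the torus constant -/

section Comparison

variable {η : Measure (V d)} {Q : Matrix (Fin d) (Fin d) ℝ} {W : Measure (V d)}
  {E : V d →L[ℝ] V d} {F : ℝ≥0 → ℝ≥0} {γ : ℝ}

theorem integralF_const_mul (hFzero : F 0 = 0) (hFhom : ∀ y : ℝ≥0, 0 < y → F y = F 1 * y ^ γ)
    {c : ℝ} (hc : 0 < c) (S : Set (V d)) (f : V d → ℝ) :
    integralF F S (fun x => c * f x) = ENNReal.ofReal (c ^ γ) * integralF F S f := by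
  unfold integralF
  rw [← lintegral_const_mul' _ _ ENNReal.ofReal_ne_top]
  refine lintegral_congr fun x => ?_
  rw [Real.toNNReal_mul hc.le, homogeneous_mul hFzero hFhom (Real.toNNReal_pos.2 hc),
    ENNReal.coe_mul, ENNReal.ofReal, Real.toNNReal_rpow_of_nonneg hc.le]

/-- The bound obtained by normalizing a nonnegative function to a probability density. -/
theorem spaceConstant_le_of_mass [IsProbabilityMeasure η] (hη : HasSymmetricTriple η Q W)
    (hE : IsOperatorStable η E) (hFzero : F 0 = 0)
    (hFhom : ∀ y : ℝ≥0, 0 < y → F y = F 1 * y ^ γ) {l : ℝ} (hl : 0 < l) {h : V d → ℝ}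
    (hsm : ContDiff ℝ ∞ h) (hcs : HasCompactSupport h) (h0 : ∀ x, 0 ≤ h x) {M : ℝ} (hM : 0 < M)
    (hmass : ∫⁻ x, ENNReal.ofReal (h x) = ENNReal.ofReal M) :
    spaceConstant Q W F ≤
      ENNReal.ofReal l⁻¹ * (ENNReal.ofReal M⁻¹ * dirichletForm Q W (fun x => Real.sqrt (h x))) +
        ENNReal.ofReal (l ^ ((1 - γ) * LinearMap.trace ℝ (V d) E.toLinearMap)) *
          (ENNReal.ofReal (M⁻¹ ^ γ) * integralF F Set.univ h) := by
  have hM' : 0 < M⁻¹ := inv_pos.2 hM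
  rw [spaceConstant_eq_iInf hη hE hFzero hFhom hl]
  have hmem : (fun x => M⁻¹ * h x) ∈ domainDensities (Set.univ : Set (V d)) := by
    refine mem_domainDensities_univ (contDiff_const.mul hsm) hcs.mul_left
      (fun x => mul_nonneg hM'.le (h0 x)) ?_
    simp only [ENNReal.ofReal_mul hM'.le]
    rw [lintegral_const_mul' _ _ ENNReal.ofReal_ne_top, hmass, ← ENNReal.ofReal_mul hM'.le,
      inv_mul_cancel₀ hM.ne', ENNReal.ofReal_one]
  refine (iInf₂_le _ hmem).trans_eq ?_
  unfold spaceFunctional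
  rw [integralF_const_mul hFzero hFhom hM']
  simp only [Real.sqrt_mul hM'.le]
  rw [dirichletForm_const_mul, Real.sq_sqrt hM'.le]

/-- Normalize h by its mass M and multiply back by M: the energy is unchanged and the F-term
acquires M^(1-γ) ≤ 1. The resulting bound can be integrated over z, including values of z where the
mass vanishes. -/
theorem spaceConstant_mul_mass_le [IsProbabilityMeasure η] (hη : HasSymmetricTriple η Q W)
    (hE : IsOperatorStable η E) (hγ1 : γ ≤ 1) (hFzero : F 0 = 0)
    (hFhom : ∀ y : ℝ≥0, 0 < y → F y = F 1 * y ^ γ) {l : ℝ} (hl : 0 < l) {h : V d → ℝ}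
    (hsm : ContDiff ℝ ∞ h) (hcs : HasCompactSupport h) (h0 : ∀ x, 0 ≤ h x)
    (hmass : ∫⁻ x, ENNReal.ofReal (h x) ≤ 1) :
    spaceConstant Q W F * ∫⁻ x, ENNReal.ofReal (h x) ≤
      ENNReal.ofReal l⁻¹ * dirichletForm Q W (fun x => Real.sqrt (h x)) +
        ENNReal.ofReal (l ^ ((1 - γ) * LinearMap.trace ℝ (V d) E.toLinearMap)) *
          integralF F Set.univ h := by
  set m := ∫⁻ x, ENNReal.ofReal (h x) with hm
  have hmtop : m ≠ ⊤ := (hmass.trans_lt ENNReal.one_lt_top).ne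
  rcases eq_or_ne m 0 with hm0 | hm0
  · simp [hm0]
  set M := m.toReal with hMdef
  have hM : 0 < M := ENNReal.toReal_pos hm0 hmtop
  have hM1 : M ≤ 1 := by
    have := ENNReal.toReal_mono ENNReal.one_ne_top hmass
    simpa using this
  have hmM : m = ENNReal.ofReal M := (ENNReal.ofReal_toReal hmtop).symm
  have h1 := spaceConstant_le_of_mass hη hE hFzero hFhom hl hsm hcs h0 hM (hm.symm.trans hmM)
  have hMγ : M⁻¹ ^ γ * M ≤ 1 := by
    have h2 : M⁻¹ ^ γ ≤ M⁻¹ ^ (1 : ℝ) :=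
      Real.rpow_le_rpow_of_exponent_le ((one_le_inv₀ hM).2 hM1) hγ1
    rw [Real.rpow_one] at h2
    calc M⁻¹ ^ γ * M ≤ M⁻¹ * M := by gcongr
      _ = 1 := inv_mul_cancel₀ hM.ne'
  have e1 : ENNReal.ofReal M⁻¹ * ENNReal.ofReal M = 1 := by
    rw [← ENNReal.ofReal_mul (inv_pos.2 hM).le, inv_mul_cancel₀ hM.ne', ENNReal.ofReal_one]
  have e2 : ENNReal.ofReal (M⁻¹ ^ γ) * ENNReal.ofReal M ≤ 1 := by
    rw [← ENNReal.ofReal_mul (by positivity)]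
    exact ENNReal.ofReal_le_one.2 hMγ
  rw [hmM]
  refine (mul_le_mul_left h1 _).trans ?_
  rw [add_mul]
  refine add_le_add (le_of_eq ?_) ?_
  · rw [mul_assoc, mul_right_comm, e1, one_mul]
  · rw [mul_assoc, mul_right_comm]
    gcongr
    exact mul_le_of_le_one_left zero_le e2

variable {f χ : V d → ℝ}

/-- The translated cutoff is at most 1 and lives in one translate of the fundamental cube, where f
has total mass 1. -/
theorem lintegral_localize_le_one (hf : f ∈ torusDensities d) (hχ : IsCutoff χ) (z : V d) :
    ∫⁻ x, ENNReal.ofReal (localize f χ z x) ≤ 1 := by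
  have hm : Measurable fun x => ENNReal.ofReal (f x) := hf.1.continuous.measurable.ennreal_ofReal
  calc ∫⁻ x, ENNReal.ofReal (localize f χ z x)
      = ∫⁻ x, ENNReal.ofReal (localize f χ z (x + z)) := (lintegral_add_right_eq_self _ z).symm
    _ ≤ ∫⁻ x, (cube d).indicator (fun x => ENNReal.ofReal (f (x + z))) x := by
        refine lintegral_mono fun x => ?_
        rw [localize, add_sub_cancel_right]
        by_cases hx : x ∈ cube d
        · rw [Set.indicator_of_mem hx]
          refine ENNReal.ofReal_le_ofReal (mul_le_of_le_one_right (hf.2.2.1 _) ?_)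
          exact pow_le_one₀ (hχ.nonneg x) (hχ.le_one x)
        · rw [image_eq_zero_of_notMem_tsupport fun h => hx (hχ.tsupport_subset h)]
          simp
    _ = 1 := by
        rw [lintegral_indicator measurableSet_cube, setLIntegral_cube_add hm
          (fun k x => by rw [hf.2.1.add_latticeVec]), lintegral_of_mem_torusDensities hf]

theorem lintegral_localize (hf : f ∈ torusDensities d) (hχ : IsCutoff χ) :
    ∫⁻ z in cube d, ∫⁻ x, ENNReal.ofReal (localize f χ z x) =
      ∫⁻ x, ENNReal.ofReal (χ x ^ 2) := by
  have hχm : Measurable χ := hχ.contDiff.continuous.measurable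
  have h1 : ∀ z x, ENNReal.ofReal (localize f χ z x) =
      ENNReal.ofReal (χ (x - z) ^ 2) * ENNReal.ofReal (f x) := by
    intro z x
    rw [localize, mul_comm, ENNReal.ofReal_mul (sq_nonneg _)]
  simp only [h1]
  rw [setLIntegral_cube_lintegral_mul (a := fun x => ENNReal.ofReal (χ x ^ 2))
    (b := fun x => ENNReal.ofReal (f x)) (by fun_prop) hf.1.continuous.measurable.ennreal_ofReal
    fun k x => by rw [hf.2.1.add_latticeVec], lintegral_of_mem_torusDensities hf, mul_one]

/-- By monotonicity, F(fχ²) ≤ F(f) on the support of χ. The volume of the support thus appears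
instead of ∫χ², which is why the cutoff must nearly be an indicator function. -/
theorem lintegral_integralF_localize_le (hγ0 : 0 ≤ γ) (hFzero : F 0 = 0)
    (hFhom : ∀ y : ℝ≥0, 0 < y → F y = F 1 * y ^ γ) (hf : f ∈ torusDensities d)
    (hχ : IsCutoff χ) :
    ∫⁻ z in cube d, integralF F Set.univ (localize f χ z) ≤
      volume (Function.support χ) * integralF F (cube d) f := by
  have hχm : Measurable χ := hχ.contDiff.continuous.measurable
  have hs : MeasurableSet (Function.support χ) := measurableSet_support hχm
  have hFm : Measurable fun x => (F (f x).toNNReal : ℝ≥0∞) :=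
    ((homogeneous_measurable hFzero hFhom).comp
      hf.1.continuous.measurable.real_toNNReal).coe_nnreal_ennreal
  unfold integralF
  rw [← lintegral_indicator_one hs, ← setLIntegral_cube_lintegral_mul
    (measurable_one.indicator hs) hFm fun k x => by rw [hf.2.1.add_latticeVec]]
  rw [Measure.restrict_univ]
  refine lintegral_mono fun z => lintegral_mono fun x => ?_
  rw [localize]
  by_cases hx : x - z ∈ Function.support χ
  · rw [Set.indicator_of_mem hx, Pi.one_apply, one_mul]
    refine ENNReal.coe_le_coe.2 (homogeneous_mono hγ0 hFzero hFhom (Real.toNNReal_mono ?_))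
    exact mul_le_of_le_one_right (hf.2.2.1 _) (pow_le_one₀ (hχ.nonneg _) (hχ.le_one _))
  · rw [Function.notMem_support.1 hx]
    simp [hFzero]

theorem torusDirichletForm_eq_add (Q : Matrix (Fin d) (Fin d) ℝ) (W : Measure (V d))
    (u : V d → ℝ) : torusDirichletForm Q W u =
      (∫⁻ x in cube d, ENNReal.ofReal ((1 / 2) * qForm Q (fun i => partialDeriv u i x))) +
        ∫⁻ x in cube d, (1 / 2) * ∫⁻ y, ENNReal.ofReal ((u (x + y) - u x) ^ 2) ∂W := by
  unfold torusDirichletForm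
  simp only [energyDensity_eq]
  exact lintegral_add_left ((measurable_qForm_partialDeriv Q u).const_mul _).ennreal_ofReal _

theorem contDiff_localize (hf : ContDiff ℝ ∞ f) (hχ : ContDiff ℝ ∞ χ) (z : V d) :
    ContDiff ℝ ∞ (localize f χ z) :=
  hf.mul ((hχ.comp (contDiff_id.sub contDiff_const)).pow 2)

theorem hasCompactSupport_localize (hχ : HasCompactSupport χ) (f : V d → ℝ) (z : V d) :
    HasCompactSupport (localize f χ z) := by
  have h1 : HasCompactSupport fun x => χ (x - z) := hχ.comp_homeomorph (Homeomorph.subRight z)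
  exact HasCompactSupport.mul_left (h1.comp_left (g := fun a : ℝ => a ^ 2) (by simp))

/-- The localization estimate. -/
theorem spaceConstant_mul_le_of_cutoff [IsProbabilityMeasure η] (hη : HasSymmetricTriple η Q W)
    (hE : IsOperatorStable η E) (hγ0 : 0 ≤ γ) (hγ1 : γ ≤ 1) (hFzero : F 0 = 0)
    (hFhom : ∀ y : ℝ≥0, 0 < y → F y = F 1 * y ^ γ) {l δ : ℝ} (hl : 0 < l) (hδ : 0 < δ)
    (hf : f ∈ torusDensities d) (hχ : IsCutoff χ)
    (hsupp : volume (Function.support χ) ≤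
      ENNReal.ofReal (1 + δ) * ∫⁻ x, ENNReal.ofReal (χ x ^ 2)) :
    spaceConstant Q W F * ∫⁻ x, ENNReal.ofReal (χ x ^ 2) ≤
      ENNReal.ofReal (1 + δ) * (∫⁻ x, ENNReal.ofReal (χ x ^ 2)) *
        (ENNReal.ofReal l⁻¹ * torusDirichletForm Q W (fun x => Real.sqrt (f x)) +
          ENNReal.ofReal (l ^ ((1 - γ) * LinearMap.trace ℝ (V d) E.toLinearMap)) *
            integralF F (cube d) f) +
        ENNReal.ofReal l⁻¹ * (ENNReal.ofReal (1 + δ⁻¹) * dirichletForm Q W χ) := by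
  have := hη.levy.sigmaFinite
  obtain ⟨G₁, hG₁, hG₁z, hG₁i⟩ := lintegral_gradEnergy_localize_le hη.posSemidef hδ hf hχ
  obtain ⟨G₂, hG₂, hG₂z, hG₂i⟩ := lintegral_jumpEnergy_localize_le (W := W) hδ hf hχ
  set N := ∫⁻ x, ENNReal.ofReal (χ x ^ 2)
  set c := ENNReal.ofReal (l ^ ((1 - γ) * LinearMap.trace ℝ (V d) E.toLinearMap))
  set I := integralF F (cube d) f
  calc spaceConstant Q W F * N
      = spaceConstant Q W F * ∫⁻ z in cube d, ∫⁻ x, ENNReal.ofReal (localize f χ z x) := by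
        rw [lintegral_localize hf hχ]
    _ ≤ ∫⁻ z in cube d, spaceConstant Q W F * ∫⁻ x, ENNReal.ofReal (localize f χ z x) :=
        lintegral_const_mul_le _ _
    _ ≤ ∫⁻ z in cube d, (ENNReal.ofReal l⁻¹ * (G₁ z + G₂ z) +
          c * integralF F Set.univ (localize f χ z)) := by
        refine lintegral_mono fun z => ?_
        refine (spaceConstant_mul_mass_le hη hE hγ1 hFzero hFhom hl
          (contDiff_localize hf.1 hχ.contDiff z) (hasCompactSupport_localize hχ.hasCompactSupport f z)
          (localize_nonneg hf.2.2.1 z) (lintegral_localize_le_one hf hχ z)).trans ?_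
        rw [dirichletForm_eq_add]
        gcongr
        · exact hG₁z z
        · exact hG₂z z
    _ = ENNReal.ofReal l⁻¹ * ((∫⁻ z in cube d, G₁ z) + ∫⁻ z in cube d, G₂ z) +
          c * ∫⁻ z in cube d, integralF F Set.univ (localize f χ z) := by
        rw [lintegral_add_left (by fun_prop), lintegral_const_mul' _ _ ENNReal.ofReal_ne_top,
          lintegral_const_mul' _ _ ENNReal.ofReal_ne_top, lintegral_add_left hG₁]
    _ ≤ ENNReal.ofReal l⁻¹ * ((∫⁻ z in cube d, G₁ z) + ∫⁻ z in cube d, G₂ z) +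
          c * (ENNReal.ofReal (1 + δ) * N * I) := by
        gcongr
        refine (lintegral_integralF_localize_le hγ0 hFzero hFhom hf hχ).trans ?_
        gcongr
    _ = _ := by
        rw [hG₁i, hG₂i, torusDirichletForm_eq_add, dirichletForm_eq_add]
        ring

theorem spaceConstant_lt_top [IsProbabilityMeasure η] (hη : HasSymmetricTriple η Q W)
    (hE : IsOperatorStable η E) (hγ0 : 0 ≤ γ) (hFzero : F 0 = 0)
    (hFhom : ∀ y : ℝ≥0, 0 < y → F y = F 1 * y ^ γ) : spaceConstant Q W F < ⊤ := by
  obtain ⟨χ, hχ, hχ0, hsupp⟩ := exists_isCutoff (d := d) one_pos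
  have hχtop := hχ.lintegral_sq_lt_top
  have hsq : HasCompactSupport fun x => χ x ^ 2 :=
    hχ.hasCompactSupport.comp_left (g := fun a : ℝ => a ^ 2) (by simp)
  refine (spaceConstant_le_of_mass hη hE hFzero hFhom one_pos (hχ.contDiff.pow 2) hsq
    (fun x => sq_nonneg _) (ENNReal.toReal_pos hχ0.ne' hχtop.ne)
    (ENNReal.ofReal_toReal hχtop.ne).symm).trans_lt ?_
  have h1 : dirichletForm Q W (fun x => Real.sqrt (χ x ^ 2)) < ⊤ := by
    simp only [Real.sqrt_sq (hχ.nonneg _)]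
    exact hχ.dirichletForm_lt_top Q hη.levy
  have h2 : integralF F Set.univ (fun x => χ x ^ 2) < ⊤ := by
    have hs : MeasurableSet (Function.support χ) :=
      measurableSet_support hχ.contDiff.continuous.measurable
    calc integralF F Set.univ (fun x => χ x ^ 2)
        ≤ ∫⁻ x, (Function.support χ).indicator (fun _ => (F 1 : ℝ≥0∞)) x := by
          unfold integralF
          rw [Measure.restrict_univ]
          refine lintegral_mono fun x => ?_
          by_cases hx : x ∈ Function.support χ
          · rw [Set.indicator_of_mem hx]
            refine ENNReal.coe_le_coe.2 (homogeneous_mono hγ0 hFzero hFhom ?_)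
            exact Real.toNNReal_le_one.2 (pow_le_one₀ (hχ.nonneg _) (hχ.le_one _))
          · have h0 : χ x = 0 := Function.notMem_support.1 hx
            simp [h0, hFzero]
      _ = F 1 * volume (Function.support χ) := by
          rw [lintegral_indicator hs, setLIntegral_const]
      _ < ⊤ := by
          refine ENNReal.mul_lt_top ENNReal.coe_lt_top (hsupp.trans_lt ?_)
          exact ENNReal.mul_lt_top ENNReal.ofReal_lt_top hχtop
  finiteness

theorem spaceConstant_le_torusConstant [IsProbabilityMeasure η] (hη : HasSymmetricTriple η Q W)
    (hE : IsOperatorStable η E) (hγ0 : 0 ≤ γ) (hγ1 : γ ≤ 1) (hFzero : F 0 = 0)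
    (hFhom : ∀ y : ℝ≥0, 0 < y → F y = F 1 * y ^ γ) :
    spaceConstant Q W F ≤ torusConstant Q W E F γ := by
  set S := torusConstant Q W E F γ with hS
  rcases eq_or_ne S ⊤ with hStop | hStop
  · rw [hStop]
    exact le_top
  have key : ∀ δ : ℝ, 0 < δ → spaceConstant Q W F ≤ ENNReal.ofReal (1 + δ) * S := by
    intro δ hδ
    obtain ⟨χ, hχ, hχ0, hsupp⟩ := exists_isCutoff (d := d) hδ
    have hχtop := hχ.lintegral_sq_lt_top
    set N := ∫⁻ x, ENNReal.ofReal (χ x ^ 2)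
    have hDtop : ENNReal.ofReal (1 + δ⁻¹) * dirichletForm Q W χ ≠ ⊤ :=
      ENNReal.mul_ne_top ENNReal.ofReal_ne_top (hχ.dirichletForm_lt_top Q hη.levy).ne
    -- The cutoff depends on δ only, so its energy stays fixed while λ → ∞. The near-minimiser is
    -- chosen with slack λ⁻¹, which vanishes in the same limit.
    have h1 : ∀ l : ℝ, 0 < l → spaceConstant Q W F * N ≤
        ENNReal.ofReal (1 + δ) * N * (S + ENNReal.ofReal l⁻¹) +
          ENNReal.ofReal l⁻¹ * (ENNReal.ofReal (1 + δ⁻¹) * dirichletForm Q W χ) := by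
      intro l hl
      have h2 : (⨅ f ∈ torusDensities d,
          (ENNReal.ofReal l⁻¹ * torusDirichletForm Q W (fun x => Real.sqrt (f x))
            + ENNReal.ofReal (l ^ ((1 - γ) * LinearMap.trace ℝ (V d) E.toLinearMap))
              * integralF F (cube d) f)) < S + ENNReal.ofReal l⁻¹ := by
        refine (le_iSup₂ (f := fun (l : ℝ) (_ : 0 < l) => ⨅ f ∈ torusDensities d,
          (ENNReal.ofReal l⁻¹ * torusDirichletForm Q W (fun x => Real.sqrt (f x))
            + ENNReal.ofReal (l ^ ((1 - γ) * LinearMap.trace ℝ (V d) E.toLinearMap))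
              * integralF F (cube d) f)) l hl).trans_lt ?_
        exact ENNReal.lt_add_right hStop (by simpa using hl)
      obtain ⟨f, hf⟩ := iInf_lt_iff.1 h2
      obtain ⟨hf, hlt⟩ := iInf_lt_iff.1 hf
      refine (spaceConstant_mul_le_of_cutoff hη hE hγ0 hγ1 hFzero hFhom hl hδ hf hχ hsupp).trans ?_
      gcongr
    have hinv : Tendsto (fun l : ℝ => ENNReal.ofReal l⁻¹) atTop (𝓝 0) := by
      simpa using ENNReal.tendsto_ofReal tendsto_inv_atTop_zero
    have h3 : Tendsto (fun l : ℝ => ENNReal.ofReal (1 + δ) * N * (S + ENNReal.ofReal l⁻¹) +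
        ENNReal.ofReal l⁻¹ * (ENNReal.ofReal (1 + δ⁻¹) * dirichletForm Q W χ)) atTop
        (𝓝 (ENNReal.ofReal (1 + δ) * N * S)) := by
      have e1 := ENNReal.Tendsto.const_mul (a := ENNReal.ofReal (1 + δ) * N)
        (hinv.const_add S) (Or.inr (ENNReal.mul_ne_top ENNReal.ofReal_ne_top hχtop.ne))
      have e2 := ENNReal.Tendsto.mul_const (b := ENNReal.ofReal (1 + δ⁻¹) * dirichletForm Q W χ)
        hinv (Or.inr hDtop)
      simpa using e1.add e2
    have h4 : spaceConstant Q W F * N ≤ ENNReal.ofReal (1 + δ) * N * S :=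
      ge_of_tendsto h3 (by filter_upwards [eventually_gt_atTop 0] with l hl using h1 l hl)
    rw [mul_right_comm] at h4
    exact (ENNReal.mul_le_mul_iff_left hχ0.ne' hχtop.ne).1 h4
  have hlim : Tendsto (fun δ : ℝ => ENNReal.ofReal (1 + δ) * S) (𝓝[>] 0) (𝓝 S) := by
    have e1 : Tendsto (fun δ : ℝ => ENNReal.ofReal (1 + δ)) (𝓝[>] 0) (𝓝 1) := by
      have : Tendsto (fun δ : ℝ => 1 + δ) (𝓝[>] 0) (𝓝 (1 + 0)) :=
        (tendsto_id.const_add 1).mono_left nhdsWithin_le_nhds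
      simpa using ENNReal.tendsto_ofReal this
    simpa using ENNReal.Tendsto.mul_const e1 (Or.inr hStop)
  exact ge_of_tendsto hlim (by filter_upwards [self_mem_nhdsWithin] with δ hδ using key δ hδ)

end Comparison

/-! ### Spectral lower bound for the Dirichlet form -/

/-- The variance of g' on [0,1] is nonnegative. -/
theorem ofReal_sub_sq_le_lintegral_deriv {g g' : ℝ → ℝ} (hg : ∀ t, HasDerivAt g (g' t) t)
    (hg' : Continuous g') :
    ENNReal.ofReal ((g 1 - g 0) ^ 2) ≤ ∫⁻ t in Set.Ioc (0 : ℝ) 1, ENNReal.ofReal (g' t ^ 2) := by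
  set a := g 1 - g 0 with ha
  have hint : ∫ t in (0 : ℝ)..1, g' t = a :=
    intervalIntegral.integral_eq_sub_of_hasDerivAt (fun t _ => hg t)
      (hg'.intervalIntegrable 0 1)
  have h1 : 0 ≤ ∫ t in (0 : ℝ)..1, (g' t - a) ^ 2 :=
    intervalIntegral.integral_nonneg zero_le_one fun t _ => sq_nonneg _
  have h2 : ∫ t in (0 : ℝ)..1, (g' t - a) ^ 2 = (∫ t in (0 : ℝ)..1, g' t ^ 2) - a ^ 2 := by
    have e : (fun t => (g' t - a) ^ 2) = fun t => g' t ^ 2 - (2 * a * g' t - a ^ 2) := by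
      ext t
      ring
    rw [e, intervalIntegral.integral_sub, intervalIntegral.integral_sub,
      intervalIntegral.integral_const_mul, hint]
    · simp only [intervalIntegral.integral_const]
      simp only [sub_zero, one_smul]
      ring
    all_goals exact Continuous.intervalIntegrable (by fun_prop) 0 1
  have h3 : IntegrableOn (fun t => g' t ^ 2) (Set.Ioc 0 1) :=
    Continuous.integrableOn_Ioc (by fun_prop)
  rw [← ofReal_integral_eq_lintegral_ofReal h3 (ae_of_all _ fun t => sq_nonneg _)]
  refine ENNReal.ofReal_le_ofReal ?_
  rw [← intervalIntegral.integral_of_le zero_le_one]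
  linarith

theorem fderiv_eq_sum_partialDeriv (u : V d → ℝ) (x v : V d) :
    fderiv ℝ u x v = ∑ i, v i * partialDeriv u i x := by
  have h : v = ∑ i, v i • EuclideanSpace.single i (1 : ℝ) := by
    ext j
    simp [Pi.single_apply]
  conv_lhs => rw [h]
  simp [partialDeriv]

/-- The function √f need not be differentiable at zeros of f, so the one-dimensional estimate is
applied to √(f + ε). Its derivative is bounded in modulus by the expression for √f, as ∇f = 0
wherever f = 0; then ε → 0. -/
theorem ofReal_sqrt_sub_sq_le {f : V d → ℝ} (hf : ContDiff ℝ 1 f) (h0 : ∀ x, 0 ≤ f x)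
    (x v : V d) :
    ENNReal.ofReal ((Real.sqrt (f (x + v)) - Real.sqrt (f x)) ^ 2) ≤
      ∫⁻ t in Set.Ioc (0 : ℝ) 1,
        ENNReal.ofReal ((∑ i, v i * partialDeriv (fun x => Real.sqrt (f x)) i (x + t • v)) ^ 2) := by
  have hdiff : Differentiable ℝ f := hf.differentiable one_ne_zero
  have hbound : ∀ ε : ℝ, 0 < ε →
      ENNReal.ofReal ((Real.sqrt (f (x + v) + ε) - Real.sqrt (f x + ε)) ^ 2) ≤
      ∫⁻ t in Set.Ioc (0 : ℝ) 1,
        ENNReal.ofReal ((∑ i, v i * partialDeriv (fun x => Real.sqrt (f x)) i (x + t • v)) ^ 2) := by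
    intro ε hε
    have hpos : ∀ y, 0 < f y + ε := fun y => add_pos_of_nonneg_of_pos (h0 y) hε
    have hline : ∀ t : ℝ, HasDerivAt (fun t : ℝ => f (x + t • v)) (fderiv ℝ f (x + t • v) v) t := by
      intro t
      have h1 : HasDerivAt (fun t : ℝ => x + t • v) v t := by
        simpa using ((hasDerivAt_id t).smul_const v).const_add x
      exact (hdiff (x + t • v)).hasFDerivAt.comp_hasDerivAt t h1
    have hg : ∀ t : ℝ, HasDerivAt (fun t : ℝ => Real.sqrt (f (x + t • v) + ε))
        (fderiv ℝ f (x + t • v) v / (2 * Real.sqrt (f (x + t • v) + ε))) t := fun t =>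
      ((hline t).add_const ε).sqrt (hpos _).ne'
    have hf' : Continuous fun y => fderiv ℝ f y v :=
      (hf.continuous_fderiv one_ne_zero).clm_apply continuous_const
    have hc : Continuous fun t : ℝ =>
        fderiv ℝ f (x + t • v) v / (2 * Real.sqrt (f (x + t • v) + ε)) := by
      refine Continuous.div (by exact hf'.comp (by fun_prop)) ?_ fun t => ?_
      · have := hf.continuous
        fun_prop
      · have := Real.sqrt_pos.2 (hpos (x + t • v))
        positivity
    have h := ofReal_sub_sq_le_lintegral_deriv hg hc
    simp only [one_smul, zero_smul, add_zero] at h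
    refine h.trans (lintegral_mono fun t => ENNReal.ofReal_le_ofReal ?_)
    set y := x + t • v
    simp only [partialDeriv_sqrt hdiff h0, ← mul_div_assoc]
    rw [← Finset.sum_div, fderiv_eq_sum_partialDeriv]
    rcases (h0 y).eq_or_lt with hy | hy
    · simp [partialDeriv_eq_zero h0 _ hy.symm]
    · rw [div_pow, div_pow]
      have := Real.sqrt_pos.2 hy
      gcongr
      linarith
  have hlim : Tendsto (fun ε : ℝ =>
      ENNReal.ofReal ((Real.sqrt (f (x + v) + ε) - Real.sqrt (f x + ε)) ^ 2)) (𝓝[>] 0)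
      (𝓝 (ENNReal.ofReal ((Real.sqrt (f (x + v)) - Real.sqrt (f x)) ^ 2))) := by
    have hc : Continuous fun ε : ℝ =>
        ENNReal.ofReal ((Real.sqrt (f (x + v) + ε) - Real.sqrt (f x + ε)) ^ 2) :=
      ENNReal.continuous_ofReal.comp (by fun_prop)
    have := (hc.tendsto 0).mono_left (nhdsWithin_le_nhds (s := Set.Ioi 0))
    simpa only [add_zero] using this
  exact le_of_tendsto hlim (by filter_upwards [self_mem_nhdsWithin] with ε hε using hbound ε hε)

theorem lintegral_sqrt_sub_sq_le {f : V d → ℝ} (hf : ContDiff ℝ 1 f) (h0 : ∀ x, 0 ≤ f x)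
    (v : V d) :
    ∫⁻ x, ENNReal.ofReal ((Real.sqrt (f (x + v)) - Real.sqrt (f x)) ^ 2) ≤
      ∫⁻ x, ENNReal.ofReal ((∑ i, v i * partialDeriv (fun x => Real.sqrt (f x)) i x) ^ 2) := by
  have hmeas : Measurable fun x : V d =>
      ENNReal.ofReal ((∑ i, v i * partialDeriv (fun x => Real.sqrt (f x)) i x) ^ 2) := by
    have := measurable_partialDeriv (fun x => Real.sqrt (f x))
    fun_prop
  refine (lintegral_mono fun x => ofReal_sqrt_sub_sq_le hf h0 x v).trans ?_
  rw [lintegral_lintegral_swap]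
  · simp only [lintegral_add_right_eq_self fun x : V d =>
      ENNReal.ofReal ((∑ i, v i * partialDeriv (fun x => Real.sqrt (f x)) i x) ^ 2)]
    rw [lintegral_const, Measure.restrict_apply_univ, Real.volume_Ioc]
    simp
  · have : Measurable fun p : V d × ℝ => p.1 + p.2 • v := by fun_prop
    exact (hmeas.comp this).aemeasurable

section Spectral

variable {f : V d → ℝ} {m : Measure (V d)}

/-- For the shift 2hv the spectral weight is 4 sin²(h⟨v, ξ⟩). Dividing by (2h)² and letting h → 0
recovers ⟨v, ξ⟩², and Fatou's lemma passes the bound to the limit. -/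
theorem lintegral_inner_sq_le (hf : ContDiff ℝ 1 f) (h0 : ∀ x, 0 ≤ f x)
    (hm : ∀ y : V d, ∫⁻ x, ENNReal.ofReal ((Real.sqrt (f (x + y)) - Real.sqrt (f x)) ^ 2) =
      ∫⁻ ξ, ENNReal.ofReal (2 * (1 - Real.cos (inner ℝ y ξ))) ∂m) (v : V d) :
    ∫⁻ ξ, ENNReal.ofReal ((inner ℝ v ξ) ^ 2) ∂m ≤
      ∫⁻ x, ENNReal.ofReal ((∑ i, v i * partialDeriv (fun x => Real.sqrt (f x)) i x) ^ 2) := by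
  set R := ∫⁻ x, ENNReal.ofReal ((∑ i, v i * partialDeriv (fun x => Real.sqrt (f x)) i x) ^ 2)
  have hstep : ∀ n : ℕ, ∫⁻ ξ, ENNReal.ofReal
      (((1 / ((n : ℝ) + 1))⁻¹ * Real.sin (1 / ((n : ℝ) + 1) * inner ℝ v ξ)) ^ 2) ∂m ≤ R := by
    intro n
    set h : ℝ := 1 / ((n : ℝ) + 1)
    have hh : 0 < h := by positivity
    have h1 := (hm ((2 * h) • v)).symm.trans_le (lintegral_sqrt_sub_sq_le hf h0 ((2 * h) • v))
    have e1 : ∀ x, ENNReal.ofReal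
        ((∑ i, ((2 * h) • v) i * partialDeriv (fun x => Real.sqrt (f x)) i x) ^ 2) =
        ENNReal.ofReal ((2 * h) ^ 2) * ENNReal.ofReal
          ((∑ i, v i * partialDeriv (fun x => Real.sqrt (f x)) i x) ^ 2) := by
      intro x
      rw [← ENNReal.ofReal_mul (by positivity), ← mul_pow, Finset.mul_sum]
      simp only [PiLp.smul_apply, smul_eq_mul, mul_assoc]
    have e2 : ∀ ξ, ENNReal.ofReal (2 * (1 - Real.cos (inner ℝ ((2 * h) • v) ξ))) =
        ENNReal.ofReal ((2 * h) ^ 2) *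
          ENNReal.ofReal ((h⁻¹ * Real.sin (h * inner ℝ v ξ)) ^ 2) := by
      intro ξ
      rw [← ENNReal.ofReal_mul (by positivity), real_inner_smul_left, mul_assoc 2 h, Real.cos_two_mul,
        Real.cos_sq']
      congr 1
      field_simp
      ring
    simp only [e1, e2] at h1
    rw [lintegral_const_mul' _ _ ENNReal.ofReal_ne_top,
      lintegral_const_mul' _ _ ENNReal.ofReal_ne_top] at h1
    exact (ENNReal.mul_le_mul_iff_right (ENNReal.ofReal_pos.2 (by positivity)).ne'
      ENNReal.ofReal_ne_top).1 h1
  have hlim : ∀ ξ : V d, Tendsto (fun n : ℕ => ENNReal.ofReal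
      (((1 / ((n : ℝ) + 1))⁻¹ * Real.sin (1 / ((n : ℝ) + 1) * inner ℝ v ξ)) ^ 2)) atTop
      (𝓝 (ENNReal.ofReal ((inner ℝ v ξ) ^ 2))) := by
    intro ξ
    have hd : HasDerivAt (fun t : ℝ => Real.sin (t * inner ℝ v ξ)) (inner ℝ v ξ) 0 := by
      have := ((hasDerivAt_id (0 : ℝ)).mul_const (inner ℝ v ξ : ℝ)).sin
      simpa using this
    have ht : Tendsto (fun n : ℕ => 1 / ((n : ℝ) + 1)) atTop (𝓝[≠] 0) :=
      tendsto_nhdsWithin_iff.2 ⟨tendsto_one_div_add_atTop_nhds_zero_nat,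
        Eventually.of_forall fun n => by
          have : (0 : ℝ) < 1 / ((n : ℝ) + 1) := by positivity
          exact this.ne'⟩
    have := hd.tendsto_slope_zero.comp ht
    simp only [zero_add, zero_mul, Real.sin_zero, sub_zero, smul_eq_mul] at this
    exact ENNReal.tendsto_ofReal (this.pow 2)
  calc ∫⁻ ξ, ENNReal.ofReal ((inner ℝ v ξ) ^ 2) ∂m
      = ∫⁻ ξ, liminf (fun n : ℕ => ENNReal.ofReal
        (((1 / ((n : ℝ) + 1))⁻¹ * Real.sin (1 / ((n : ℝ) + 1) * inner ℝ v ξ)) ^ 2)) atTop ∂m :=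
        lintegral_congr fun ξ => (hlim ξ).liminf_eq.symm
    _ ≤ liminf (fun n : ℕ => ∫⁻ ξ, ENNReal.ofReal
        (((1 / ((n : ℝ) + 1))⁻¹ * Real.sin (1 / ((n : ℝ) + 1) * inner ℝ v ξ)) ^ 2) ∂m) atTop :=
        lintegral_liminf_le fun n => by fun_prop
    _ ≤ liminf (fun _ : ℕ => R) atTop := liminf_le_liminf (Eventually.of_forall hstep)
    _ = R := liminf_const R

theorem lintegral_qForm_le_gradEnergy {Q : Matrix (Fin d) (Fin d) ℝ} (hQ : Q.PosSemidef)
    (hf : ContDiff ℝ 1 f) (h0 : ∀ x, 0 ≤ f x)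
    (hm : ∀ y : V d, ∫⁻ x, ENNReal.ofReal ((Real.sqrt (f (x + y)) - Real.sqrt (f x)) ^ 2) =
      ∫⁻ ξ, ENNReal.ofReal (2 * (1 - Real.cos (inner ℝ y ξ))) ∂m) :
    ∫⁻ ξ, ENNReal.ofReal ((1 / 2) * qForm Q ξ) ∂m ≤
      gradEnergy Q (fun x => Real.sqrt (f x)) := by
  obtain ⟨v, hv⟩ := exists_qForm_eq_sum_sq hQ
  have hsplit : ∀ p : Fin d → ℝ, ENNReal.ofReal ((1 / 2) * qForm Q p) =
      ∑ j, ENNReal.ofReal (1 / 2) * ENNReal.ofReal ((∑ i, v j i * p i) ^ 2) := by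
    intro p
    rw [hv, ENNReal.ofReal_mul (by norm_num), ENNReal.ofReal_sum_of_nonneg fun j _ => sq_nonneg _,
      Finset.mul_sum]
  have hmeas := measurable_partialDeriv (fun x => Real.sqrt (f x))
  unfold gradEnergy
  simp only [hsplit]
  rw [lintegral_finsetSum _ (fun j _ => by fun_prop),
    lintegral_finsetSum _ (fun j _ => by fun_prop)]
  refine Finset.sum_le_sum fun j _ => ?_
  rw [lintegral_const_mul' _ _ ENNReal.ofReal_ne_top, lintegral_const_mul' _ _ ENNReal.ofReal_ne_top]
  have h := lintegral_inner_sq_le hf h0 hm (v j)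
  have e : ∀ ξ : V d, inner ℝ (v j) ξ = ∑ i, v j i * ξ i := fun ξ => by
    simp [PiLp.inner_apply, mul_comm]
  simp only [e] at h
  exact mul_le_mul' le_rfl h

/-- The jump part is an equality by Plancherel; for the Gaussian part one inequality suffices for
the positivity argument. -/
theorem lintegral_symbol_le_dirichletForm {Q : Matrix (Fin d) (Fin d) ℝ} {W : Measure (V d)}
    [SFinite m] (hQ : Q.PosSemidef) (hW : IsLevyMeasure W) (hf : ContDiff ℝ 1 f)
    (h0 : ∀ x, 0 ≤ f x)
    (hm : ∀ y : V d, ∫⁻ x, ENNReal.ofReal ((Real.sqrt (f (x + y)) - Real.sqrt (f x)) ^ 2) =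
      ∫⁻ ξ, ENNReal.ofReal (2 * (1 - Real.cos (inner ℝ y ξ))) ∂m) :
    ∫⁻ ξ, ENNReal.ofReal (symbol Q W ξ) ∂m ≤
      dirichletForm Q W (fun x => Real.sqrt (f x)) := by
  have := hW.sigmaFinite
  have h1 : ∀ ξ : V d, ENNReal.ofReal (symbol Q W ξ) =
      ENNReal.ofReal ((1 / 2) * qForm Q ξ) + ENNReal.ofReal (jumpSymbol W ξ) := fun ξ =>
    ENNReal.ofReal_add (mul_nonneg (by norm_num) (qForm_nonneg hQ _)) (jumpSymbol_nonneg W ξ)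
  have h2 : Measurable fun ξ : V d => ENNReal.ofReal ((1 / 2) * qForm Q ξ) := by
    unfold qForm
    fun_prop
  have h3 := lintegral_translate_clm (u := fun x => Real.sqrt (f x)) hW hm (ContinuousLinearMap.id ℝ (V d))
  simp only [ContinuousLinearMap.adjoint_id, ContinuousLinearMap.coe_id', id_eq] at h3
  simp only [h1]
  rw [lintegral_add_left h2, dirichletForm_eq_add,
    jumpEnergy_eq_lintegral (hf.continuous.sqrt.measurable), h3]
  gcongr
  exact lintegral_qForm_le_gradEnergy hQ hf h0 hm

end Spectral

/-! ### Positivity of the variational constant -/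

section Positivity

variable {η W : Measure (V d)} {Q : Matrix (Fin d) (Fin d) ℝ} {E : V d →L[ℝ] V d}
  {F : ℝ≥0 → ℝ≥0} {γ : ℝ}

/-- For b ≤ M use (√b - √a)² + b - a/2 = (2√b - √a)²/2 ≥ 0; for b > M the last term alone is enough.
With a = f(x) and b = f(x + y), mass must move in L², sit low after translation, or land in {f > M}.
-/
theorem ofReal_half_le_add {a b M : ℝ} (ha : 0 ≤ a) (hb : 0 ≤ b) :
    (1 / 2 : ℝ≥0∞) * ENNReal.ofReal a ≤
      ENNReal.ofReal ((Real.sqrt b - Real.sqrt a) ^ 2) + ENNReal.ofReal (if b ≤ M then b else 0) +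
        ENNReal.ofReal a * (Set.Ioi M).indicator 1 b := by
  have e : (1 / 2 : ℝ≥0∞) * ENNReal.ofReal a = ENNReal.ofReal (a / 2) := by
    rw [div_eq_inv_mul, ENNReal.ofReal_mul (by norm_num), ENNReal.ofReal_inv_of_pos two_pos]
    simp
  rw [e]
  split_ifs with h
  · rw [← ENNReal.ofReal_add (sq_nonneg _) hb]
    refine le_add_right (ENNReal.ofReal_le_ofReal ?_)
    nlinarith [Real.sq_sqrt ha, Real.sq_sqrt hb, sq_nonneg (2 * Real.sqrt b - Real.sqrt a)]
  · rw [Set.indicator_of_mem (Set.mem_Ioi.2 (not_le.1 h))]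
    simp only [Pi.one_apply, mul_one]
    exact le_add_left (ENNReal.ofReal_le_ofReal (by linarith))

/-- The mass of a density at heights at most `M` is controlled by `∫ F(f)`. -/
theorem mul_lintegral_le_integralF (hγ1 : γ ≤ 1)
    (hFhom : ∀ y : ℝ≥0, 0 < y → F y = F 1 * y ^ γ) (f : V d → ℝ) (M : ℝ≥0) :
    F 1 * ∫⁻ x, ENNReal.ofReal (if f x ≤ M then f x else 0) ≤
      (M ^ (1 - γ) : ℝ≥0) * integralF F Set.univ f := by
  unfold integralF
  rw [Measure.restrict_univ, ← lintegral_const_mul' _ _ ENNReal.coe_ne_top,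
    ← lintegral_const_mul' _ _ ENNReal.coe_ne_top]
  refine lintegral_mono fun x => ?_
  split_ifs with h
  · change (F 1 : ℝ≥0∞) * ((f x).toNNReal : ℝ≥0∞) ≤ _
    rw [← ENNReal.coe_mul, ← ENNReal.coe_mul, ENNReal.coe_le_coe]
    have hz : (f x).toNNReal ≤ M := Real.toNNReal_le_iff_le_coe.2 h
    rcases eq_zero_or_pos (f x).toNNReal with h0 | h0
    · simp [h0]
    · set z := (f x).toNNReal
      rw [hFhom z h0]
      have e : z = z ^ (1 - γ) * z ^ γ := by
        rw [← NNReal.rpow_add h0.ne']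
        simp
      calc F 1 * z = z ^ (1 - γ) * (F 1 * z ^ γ) := by
            conv_lhs => rw [e]
            ring
        _ ≤ M ^ (1 - γ) * (F 1 * z ^ γ) := by
            gcongr
  · simp

theorem mul_volume_lt_le_one {f : V d → ℝ} (hf : f ∈ domainDensities (Set.univ : Set (V d)))
    (M : ℝ≥0) : M * volume {x | (M : ℝ) < f x} ≤ 1 := by
  rw [← lintegral_of_mem_domainDensities hf]
  have hmeas : Measurable fun x => ENNReal.ofReal (f x) :=
    hf.1.continuous.measurable.ennreal_ofReal
  refine le_trans ?_ (mul_meas_ge_le_lintegral hmeas M)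
  refine mul_le_mul' le_rfl (measure_mono fun x hx => ?_)
  have hx' : (M : ℝ) < f x := hx
  change (M : ℝ≥0∞) ≤ ENNReal.ofReal (f x)
  rw [← ENNReal.ofReal_coe_nnreal]
  exact ENNReal.ofReal_le_ofReal hx'.le

/-- A density whose square root is nearly invariant under the translations in `B` and which is
mostly supported where it exceeds `M` would violate `vol {f > M} ≤ 1 / M`. -/
theorem half_mul_volume_le {f : V d → ℝ} (hf : f ∈ domainDensities (Set.univ : Set (V d)))
    (M : ℝ≥0) {B : Set (V d)} {D : ℝ≥0∞}
    (hD : ∀ y ∈ B, ∫⁻ x, ENNReal.ofReal ((Real.sqrt (f (x + y)) - Real.sqrt (f x)) ^ 2) ≤ D)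
    (hB : MeasurableSet B) :
    (1 / 2) * volume B ≤ (D + ∫⁻ x, ENNReal.ofReal (if f x ≤ M then f x else 0)) * volume B +
      volume {x | (M : ℝ) < f x} := by
  have hfm : Measurable f := hf.1.continuous.measurable
  have h0 := hf.2.2.2.1
  have hmass := lintegral_of_mem_domainDensities hf
  set κ := ∫⁻ x, ENNReal.ofReal (if f x ≤ M then f x else 0)
  set G : V d → ℝ≥0∞ := fun y => ∫⁻ x, ENNReal.ofReal (f x) * (Set.Ioi (M : ℝ)).indicator 1 (f (x + y))
    with hG
  have hind : Measurable ((Set.Ioi (M : ℝ)).indicator (1 : ℝ → ℝ≥0∞)) :=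
    measurable_one.indicator measurableSet_Ioi
  have hpair : Measurable fun p : V d × V d =>
      ENNReal.ofReal (f p.2) * (Set.Ioi (M : ℝ)).indicator (1 : ℝ → ℝ≥0∞) (f (p.2 + p.1)) :=
    (hfm.comp measurable_snd).ennreal_ofReal.mul
      (hind.comp (hfm.comp (measurable_snd.add measurable_fst)))
  have hκm : Measurable fun x => ENNReal.ofReal (if f x ≤ M then f x else 0) :=
    (Measurable.ite (measurableSet_le hfm measurable_const) hfm measurable_const).ennreal_ofReal
  have h1 : ∀ y ∈ B, 1 / 2 ≤ (D + κ) + G y := by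
    intro y hy
    calc (1 / 2 : ℝ≥0∞) = ∫⁻ x, (1 / 2) * ENNReal.ofReal (f x) := by
          rw [lintegral_const_mul _ hfm.ennreal_ofReal, hmass, mul_one]
      _ ≤ ∫⁻ x, (ENNReal.ofReal ((Real.sqrt (f (x + y)) - Real.sqrt (f x)) ^ 2) +
            ENNReal.ofReal (if f (x + y) ≤ M then f (x + y) else 0) +
            ENNReal.ofReal (f x) * (Set.Ioi (M : ℝ)).indicator 1 (f (x + y))) :=
          lintegral_mono fun x => ofReal_half_le_add (h0 x) (h0 (x + y))
      _ = (∫⁻ x, ENNReal.ofReal ((Real.sqrt (f (x + y)) - Real.sqrt (f x)) ^ 2)) + κ + G y := by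
          rw [lintegral_add_right _ (by exact hpair.comp (measurable_prodMk_left (x := y))),
            lintegral_add_right _ (by exact hκm.comp (measurable_add_const y)),
            lintegral_add_right_eq_self
              (fun x => ENNReal.ofReal (if f x ≤ M then f x else 0)) y]
      _ ≤ _ := by
          gcongr
          exact hD y hy
  have hlevel : MeasurableSet {x | (M : ℝ) < f x} := measurableSet_lt measurable_const hfm
  -- Enlarging B to the whole space and integrating over y first leaves the mass of f times the
  -- volume of {f > M}.
  have h2 : ∫⁻ y in B, G y ≤ volume {x | (M : ℝ) < f x} := by
    calc ∫⁻ y in B, G y ≤ ∫⁻ y, G y := setLIntegral_le_lintegral _ _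
      _ = ∫⁻ x, ∫⁻ y, ENNReal.ofReal (f x) * (Set.Ioi (M : ℝ)).indicator 1 (f (x + y)) :=
          lintegral_lintegral_swap hpair.aemeasurable
      _ = ∫⁻ x, ENNReal.ofReal (f x) * volume {x | (M : ℝ) < f x} := by
          refine lintegral_congr fun x => ?_
          rw [lintegral_const_mul' _ _ ENNReal.ofReal_ne_top,
            lintegral_add_left_eq_self (fun y => (Set.Ioi (M : ℝ)).indicator (1 : ℝ → ℝ≥0∞) (f y)) x]
          congr 1
          rw [← lintegral_indicator_one hlevel]
          rfl
      _ = _ := by rw [lintegral_mul_const _ hfm.ennreal_ofReal, hmass, one_mul]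
  calc (1 / 2) * volume B = ∫⁻ _ in B, 1 / 2 := (setLIntegral_const B _).symm
    _ ≤ ∫⁻ y in B, ((D + κ) + G y) := setLIntegral_mono' hB h1
    _ = (D + κ) * volume B + ∫⁻ y in B, G y := by
        rw [lintegral_add_left measurable_const, setLIntegral_const]
    _ ≤ _ := by gcongr

/-- Small translations move `√f` little in `L²`, relative to the energy of `√f`. -/
theorem exists_lintegral_translate_le [IsProbabilityMeasure η] (hη : HasSymmetricTriple η Q W)
    (hfull : IsFull η) (hE : IsOperatorStable η E) :
    ∃ C : ℝ≥0, ∃ r : ℝ, 0 < r ∧ ∀ f ∈ domainDensities (Set.univ : Set (V d)),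
      ∀ y ∈ Metric.ball (0 : V d) r,
        ∫⁻ x, ENNReal.ofReal ((Real.sqrt (f (x + y)) - Real.sqrt (f x)) ^ 2) ≤
          1 / 8 + C * dirichletForm Q W (fun x => Real.sqrt (f x)) := by
  obtain ⟨c, hc, ρ, hρ, hle⟩ := exists_le_symbol hη hfull hE
  -- For ‖ξ‖ ≥ ρ the weight is at most 4 ≤ (4/c)ψ(ξ). For ‖ξ‖ < ρ the radius 1/(3ρ) gives |⟨y, ξ⟩| ≤
  -- 1/3, so the weight is at most 1/9 < 1/8.
  refine ⟨(4 / c).toNNReal, 1 / (3 * ρ), by positivity, fun f hf y hy => ?_⟩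
  obtain ⟨m, hm1, hm⟩ := exists_spectral_measure (memLp_sqrt hf)
  have hmass : m Set.univ = 1 := by
    rw [hm1, ← lintegral_of_mem_domainDensities hf]
    exact lintegral_congr fun x => by rw [Real.sq_sqrt (hf.2.2.2.1 x)]
  have : IsProbabilityMeasure m := ⟨hmass⟩
  have hsym := lintegral_symbol_le_dirichletForm (f := f) hη.posSemidef hη.levy
    (hf.1.of_le (by exact_mod_cast le_top)) hf.2.2.2.1 hm
  rw [hm]
  have hpt : ∀ ξ : V d, ENNReal.ofReal (2 * (1 - Real.cos (inner ℝ y ξ))) ≤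
      1 / 8 + ENNReal.ofReal (4 / c) * ENNReal.ofReal (symbol Q W ξ) := by
    intro ξ
    rcases le_or_gt ρ ‖ξ‖ with h | h
    · refine le_add_left ?_
      rw [← ENNReal.ofReal_mul (by positivity)]
      refine ENNReal.ofReal_le_ofReal ?_
      have h1 : 4 ≤ 4 / c * symbol Q W ξ := by
        rw [div_mul_eq_mul_div, le_div_iff₀ hc]
        linarith [hle ξ h]
      linarith [Real.neg_one_le_cos (inner ℝ y ξ)]
    · refine le_add_right ?_
      have e : (1 / 8 : ℝ≥0∞) = ENNReal.ofReal (1 / 8) := by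
        rw [ENNReal.ofReal_div_of_pos (by norm_num)]
        simp
      rw [e]
      refine ENNReal.ofReal_le_ofReal ?_
      have h1 := Real.one_sub_sq_div_two_le_cos (x := inner ℝ y ξ)
      have h2 : |inner ℝ y ξ| ≤ 1 / 3 := by
        refine (abs_real_inner_le_norm y ξ).trans ?_
        have hy' : ‖y‖ ≤ 1 / (3 * ρ) := (mem_ball_zero_iff.1 hy).le
        calc ‖y‖ * ‖ξ‖ ≤ 1 / (3 * ρ) * ρ := by gcongr
          _ = 1 / 3 := by field_simp
      have h3 := abs_le.1 h2
      nlinarith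
  calc ∫⁻ ξ, ENNReal.ofReal (2 * (1 - Real.cos (inner ℝ y ξ))) ∂m
      ≤ ∫⁻ ξ, (1 / 8 + ENNReal.ofReal (4 / c) * ENNReal.ofReal (symbol Q W ξ)) ∂m :=
        lintegral_mono hpt
    _ = 1 / 8 + ENNReal.ofReal (4 / c) * ∫⁻ ξ, ENNReal.ofReal (symbol Q W ξ) ∂m := by
        rw [lintegral_add_left measurable_const, lintegral_const_mul' _ _ ENNReal.ofReal_ne_top]
        simp
    _ ≤ _ := by
        gcongr
        exact le_rfl

theorem spaceConstant_pos [IsProbabilityMeasure η] (hη : HasSymmetricTriple η Q W)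
    (hfull : IsFull η) (hE : IsOperatorStable η E) (hγ1 : γ ≤ 1) (hFzero : F 0 = 0)
    (hFhom : ∀ y : ℝ≥0, 0 < y → F y = F 1 * y ^ γ) (hF1 : F 1 ≠ 0) :
    0 < spaceConstant Q W F := by
  obtain ⟨C, r, hr, hC⟩ := exists_lintegral_translate_le hη hfull hE
  have hBpos : 0 < volume (Metric.ball (0 : V d) r) := Metric.measure_ball_pos _ _ hr
  have hBtop : volume (Metric.ball (0 : V d) r) ≠ ⊤ := measure_ball_lt_top.ne
  set b := (volume (Metric.ball (0 : V d) r)).toNNReal with hb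
  have hbe : volume (Metric.ball (0 : V d) r) = b := (ENNReal.coe_toNNReal hBtop).symm
  have hb0 : b ≠ 0 := by
    intro h
    rw [hbe, h] at hBpos
    simp at hBpos
  -- Markov's inequality then gives vol {f > M} ≤ b/8. Against the b/2 of `half_mul_volume_le`, the
  -- two losses of 1/8 leave 1/4 to be paid by the energy and ∫F(f).
  set M : ℝ≥0 := 8 / b with hM
  set K : ℝ≥0 := max C (M ^ (1 - γ) / F 1)
  have key : ∀ f ∈ domainDensities (Set.univ : Set (V d)), (1 / 4 : ℝ≥0∞) ≤
      K * (dirichletForm Q W (fun x => Real.sqrt (f x)) + integralF F Set.univ f) := by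
    intro f hf
    have h1 := half_mul_volume_le hf M (hC f hf) measurableSet_ball
    have h2 : volume {x | (M : ℝ) < f x} ≤ (1 / 8) * b := by
      have := mul_volume_lt_le_one hf M
      rw [mul_comm] at this
      have h3 := ENNReal.le_div_iff_mul_le (b := (M : ℝ≥0∞)) (c := 1)
        (Or.inl (ENNReal.coe_ne_zero.2 (by positivity))) (Or.inl ENNReal.coe_ne_top) |>.2 this
      refine h3.trans_eq ?_
      rw [hM, ← ENNReal.coe_one, ← ENNReal.coe_div (by positivity)]
      have e : (1 : ℝ≥0) / (8 / b) = 1 / 8 * b := by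
        field_simp
      rw [e, ENNReal.coe_mul, ENNReal.coe_div (by norm_num)]
      simp
    have h4 : ∫⁻ x, ENNReal.ofReal (if f x ≤ M then f x else 0) ≤
        (M ^ (1 - γ) / F 1 : ℝ≥0) * integralF F Set.univ f := by
      have := mul_lintegral_le_integralF hγ1 hFhom f M
      refine (ENNReal.mul_le_mul_iff_right (ENNReal.coe_ne_zero.2 hF1) ENNReal.coe_ne_top).1
        (this.trans_eq ?_)
      rw [← mul_assoc, ← ENNReal.coe_mul, mul_div_cancel₀ _ hF1]
    rw [hbe] at h1
    have h5 : (1 / 2 : ℝ≥0∞) * b ≤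
        (1 / 4 + K * (dirichletForm Q W (fun x => Real.sqrt (f x)) + integralF F Set.univ f)) * b := by
      refine h1.trans ?_
      set D := dirichletForm Q W (fun x => Real.sqrt (f x))
      set I := integralF F Set.univ f
      calc _ ≤ (1 / 8 + C * D + (M ^ (1 - γ) / F 1 : ℝ≥0) * I) * b + (1 / 8) * b := by gcongr
        _ ≤ (1 / 8 + K * D + K * I) * b + (1 / 8) * b := by
            gcongr
            · exact le_max_left _ _
            · exact le_max_right _ _
        _ = ((1 / 8 + 1 / 8) + K * (D + I)) * b := by ring
        _ = _ := by
            congr 2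
            rw [← two_mul, ← mul_div_assoc, mul_one, show (8 : ℝ≥0∞) = 2 * 4 by norm_num,
              ← ENNReal.mul_div_mul_left 1 4 two_ne_zero ENNReal.ofNat_ne_top, mul_one]
    have h6 := (ENNReal.mul_le_mul_iff_left (ENNReal.coe_ne_zero.2 hb0) ENNReal.coe_ne_top).1 h5
    have e : (1 / 2 : ℝ≥0∞) = 1 / 4 + 1 / 4 := by
      rw [← two_mul, ← mul_div_assoc, mul_one, show (4 : ℝ≥0∞) = 2 * 2 by norm_num,
        ← ENNReal.mul_div_mul_left 1 2 two_ne_zero ENNReal.ofNat_ne_top, mul_one]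
    rw [e] at h6
    exact (ENNReal.add_le_add_iff_left (by finiteness)).1 h6
  have hpos : (0 : ℝ≥0∞) < (1 / 4) / K :=
    ENNReal.div_pos (by simp) ENNReal.coe_ne_top
  refine hpos.trans_le ?_
  rw [spaceConstant_eq Q W hFzero]
  refine le_iInf₂ fun f hf => ENNReal.div_le_of_le_mul' (key f hf)

end Positivity

end OperatorStable

end

/-! ### Equality, finiteness and positivity combined -/

theorem mainTheorem12 (d : ℕ) (hd : 1 ≤ d)
    (η : MeasureTheory.Measure (OperatorStable.V d)) [MeasureTheory.IsProbabilityMeasure η]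
    (Q : Matrix (Fin d) (Fin d) ℝ) (W : MeasureTheory.Measure (OperatorStable.V d))
    (hη : OperatorStable.HasSymmetricTriple η Q W)
    (hfull : OperatorStable.IsFull η)
    (E : OperatorStable.V d →L[ℝ] OperatorStable.V d)
    (hE : OperatorStable.IsOperatorStable η E)
    (F : ℝ≥0 → ℝ≥0) (γ : ℝ) (hγ0 : 0 ≤ γ) (hγ1 : γ ≤ 1)
    (hFzero : F 0 = 0) (hFhom : ∀ y : ℝ≥0, 0 < y → F y = F 1 * y ^ γ)
    (hFne : ∃ y : ℝ≥0, F y ≠ 0) :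
    ∃ k : ℝ≥0, 0 < k ∧
      (k : ℝ≥0∞) = OperatorStable.torusConstant Q W E F γ ∧
      (k : ℝ≥0∞) = OperatorStable.spaceConstant Q W F := by
  have hlt := OperatorStable.spaceConstant_lt_top hη hE hγ0 hFzero hFhom
  have hpos := OperatorStable.spaceConstant_pos hη hfull hE hγ1 hFzero hFhom
    (OperatorStable.homogeneous_one_ne_zero hFzero hFhom hFne)
  have heq : OperatorStable.spaceConstant Q W F = OperatorStable.torusConstant Q W E F γ :=
    le_antisymm (OperatorStable.spaceConstant_le_torusConstant hη hE hγ0 hγ1 hFzero hFhom)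
      (OperatorStable.torusConstant_le_spaceConstant hη hE hγ0 hγ1 hFzero hFhom)
  refine ⟨(OperatorStable.spaceConstant Q W F).toNNReal,
    ENNReal.toNNReal_pos hpos.ne' hlt.ne, ?_, ENNReal.coe_toNNReal hlt.ne⟩
  rw [ENNReal.coe_toNNReal hlt.ne, heq]
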